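/- Theorem (lower estimate for the Lyapunov exponent $\gamma_p$). Let $a:\mathbb Z^d\to[0,\infty)$ satisfy $a(z)=a(-z)$, $\sum_{z}a(z)=1$, $a(0)=0$ and $a(z)>0$ for $|z|=1$, and let $\mathcal L f(x)=\sum_{z\ne0}a(z)\,(f(x+z)-f(x))$. Let $b\in\ell^1(\mathbb Z^d)$ be real-valued, let $w(\cdot,z)$, $z\in\mathbb Z^d$, be independent standard Brownian motions with respect to a filtration, and put $W(t,x)=\sum_{z}b(x-z)w(t,z)$ and $B(x)=\sum_z b(x-z)b(-z)$, so that $\langle W(t,x)W(s,y)\rangle=\min(t,s)\,B(x-y)$. For $\varkappa>0$ let $u=u_\varkappa$ be the solution of the parabolic Anderson problem $\partial_t u=\varkappa\mathcal L u+\dot W u$, $u(0,\cdot)\equiv1$, in the Itô sense $$u(t,x)=1+\int_0^t\varkappa\mathcal L u(s,x)\,ds+\int_0^t u(s,x)\,dW(s,x),$$ i.e. $u$ is adapted, continuous in $t$ for each $x$, satisfies this equation almost surely for all $t\ge 0$, $x\in\mathbb Z^d$, and $\sup_{t\le T}\sum_x\mu(x)\langle u(t,x)^2\rangle<\infty$ for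 all $T$ and some summable weight $\mu>0$ on $\mathbb Z^d$ with $a*\mu\le C\mu$ for a constant $C$. Then for every integer $p\ge2$ the moments $\langle u_\varkappa(t,0)^p\rangle$ are finite and positive for all $t\ge 0$, the Lyapunov exponents $$\gamma_p(\varkappa)=\lim_{t\to\infty}\frac{\ln\langle u_\varkappa(t,0)^p\rangle}{t}$$ exist (as finite limits), and, writing $\gamma_p=\gamma_p(\varkappa)$, $$\frac{\gamma_p}{p-1}>\gamma_2\!\left(\frac{\varkappa}{p-1}\right)+\frac{B(0)(p-2)}{2}-2\varkappa d .$$ -/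

import Mathlib

open MeasureTheory ProbabilityTheory Filter
open scoped NNReal ENNReal Topology

noncomputable section

namespace Anderson

/-- The lattice `ℤ^d`. -/
abbrev Lattice (d : ℕ) : Type := Fin d → ℤ

/-- The jump distribution of the underlying random walk: a symmetric probability distribution on
`ℤ^d` without mass at the origin, charging all the nearest neighbours of the origin. -/
structure IsJumpKernel {d : ℕ} (a : Lattice d → ℝ) : Prop where
  nonneg : ∀ z, 0 ≤ a z
  symm : ∀ z, a (-z) = a z
  hasSum_one : HasSum a 1
  zero : a 0 = 0
  pos_of_unit : ∀ z : Lattice d, ∑ i, |z i| = 1 → 0 < a z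

/-- The non-local Laplacian `(ℒ f)(x) = ∑_{z ≠ 0} a(z) (f(x + z) - f(x))`
(the term `z = 0` vanishes). -/
def nonlocalLaplacian {d : ℕ} (a f : Lattice d → ℝ) (x : Lattice d) : ℝ :=
  ∑' z, a z * (f (x + z) - f x)

/-- The spatial correlation function `B(x) = ∑_z b(x - z) b(-z)`. -/
def corr {d : ℕ} (b : Lattice d → ℝ) (x : Lattice d) : ℝ :=
  ∑' z, b (x - z) * b (-z)

section Noise

variable {Ω : Type*} {mΩ : MeasurableSpace Ω} {d : ℕ}

/-- `w z`, `z ∈ ℤ^d`, are independent standard Brownian motions with respect to the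
filtration `ℱ`: they are adapted, and their increments after time `s` are (jointly in `z`)
independent of `ℱ s`. -/
structure IsBrownianFamily (P : Measure Ω) (ℱ : Filtration ℝ≥0 mΩ)
    (w : Lattice d → ℝ≥0 → Ω → ℝ) : Prop where
  isBrownian : ∀ z, IsBrownianReal (w z) P
  iIndep : iIndepFun (fun z ω t => w z t ω) P
  adapted : ∀ z, Adapted ℱ (w z)
  indep_increments : ∀ s t : ℝ≥0, s ≤ t →
    Indep (MeasurableSpace.comap (fun ω z => w z t ω - w z s ω) MeasurableSpace.pi) (ℱ s) P

/-- The spatially correlated Wiener process `W(t, x) = ∑_z b(x - z) w(t, z)`; the series converges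
absolutely almost surely when `b` is summable. -/
def corrWiener (b : Lattice d → ℝ) (w : Lattice d → ℝ≥0 → Ω → ℝ) (x : Lattice d)
    (t : ℝ≥0) (ω : Ω) : ℝ :=
  ∑' z, b (x - z) * w z t ω

/-- The left-endpoint (non-anticipating) Riemann sum
`∑_{k < n} X(k t / n) (W((k + 1) t / n) - W(k t / n))`. -/
def itoSum (X W : ℝ≥0 → Ω → ℝ) (t : ℝ≥0) (n : ℕ) (ω : Ω) : ℝ :=
  ∑ k ∈ Finset.range n,
    X ((k : ℝ≥0) / n * t) ω * (W (((k : ℝ≥0) + 1) / n * t) ω - W ((k : ℝ≥0) / n * t) ω)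

/-- `I` is the Itô integral `∫_0^t X dW`. This is used only when `X` is adapted with almost surely
continuous paths and `W` is a multiple of a Brownian motion for the same filtration; for such
processes the Itô integral is the limit in probability of the left-endpoint Riemann sums. -/
def IsItoIntegral (P : Measure Ω) (X W : ℝ≥0 → Ω → ℝ) (t : ℝ≥0) (I : Ω → ℝ) : Prop :=
  TendstoInMeasure P (fun n => itoSum X W t n) atTop I

/-- A weight `μ` on `ℤ^d` which is positive, summable, and for which `ℒ` is bounded on the
weighted Hilbert space `L²(ℤ^d, μ)` because `a * μ ≤ C μ`. -/
structure IsAdmissibleWeight (a μ : Lattice d → ℝ) : Prop where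
  pos : ∀ x, 0 < μ x
  summable : Summable μ
  conv_le : ∃ C : ℝ, ∀ x, ∑' z, a z * μ (x - z) ≤ C * μ x

/-- `u` is a solution of the parabolic Anderson problem
`∂u/∂t = ϰ ℒ u + ξ_t(x) u`, `u(0, x) = 1`, in the Itô sense in a weighted Hilbert space:
`u` is adapted and continuous in time, its norm in `L²(P; L²(ℤ^d, μ))` is bounded on bounded time
intervals for some admissible weight `μ`, and
`u(t, x) = 1 + ∫_0^t ϰ ℒ u(s, x) ds + ∫_0^t u(s, x) dW(s, x)`. -/
structure IsSolution (a b : Lattice d → ℝ) (ϰ : ℝ) (P : Measure Ω) (ℱ : Filtration ℝ≥0 mΩ)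
    (w : Lattice d → ℝ≥0 → Ω → ℝ) (u : ℝ≥0 → Lattice d → Ω → ℝ) : Prop where
  adapted : ∀ x, Adapted ℱ (fun t => u t x)
  continuous_paths : ∀ x, ∀ᵐ ω ∂P, Continuous (fun t => u t x ω)
  bounded : ∃ μ : Lattice d → ℝ, IsAdmissibleWeight a μ ∧
    ∀ T : ℝ≥0, ∃ K : ℝ≥0, ∀ t ≤ T,
      ∑' x, ENNReal.ofReal (μ x) * ∫⁻ ω, ‖u t x ω‖ₑ ^ 2 ∂P ≤ K
  equation : ∀ (t : ℝ≥0) (x : Lattice d),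
    IsItoIntegral P (fun s => u s x) (corrWiener b w x) t
      (fun ω => u t x ω - 1 -
        ∫ s in (0 : ℝ)..t, ϰ * nonlocalLaplacian a (fun y => u s.toNNReal y ω) x)

/-- `γ` is the `p`-th Lyapunov exponent of the field `u`: the moments `⟨u(t, 0)^p⟩` are finite and
positive, and `γ = lim_{t → ∞} ln ⟨u(t, 0)^p⟩ / t`. -/
structure HasLyapunovExponent (P : Measure Ω) (u : ℝ≥0 → Lattice d → Ω → ℝ) (p : ℕ)
    (γ : ℝ) : Prop where
  integrable : ∀ t, Integrable (fun ω => u t 0 ω ^ p) P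
  pos : ∀ t, 0 < ∫ ω, u t 0 ω ^ p ∂P
  tendsto : Tendsto (fun t : ℝ≥0 => Real.log (∫ ω, u t 0 ω ^ p ∂P) / t) atTop (𝓝 γ)

end Noise

end Anderson

end

/-!
The solution is the mean-square limit of the multiplicative Euler scheme `U_{k+1}(x) =
exp(W(t_{k+1}, x) - W(t_k, x) - h B(0) / 2) ((1 + h ϰ ℒ) U_k)(x)` with step `h`. The scheme is
positive, and its `p`-point moments are given exactly by the iterates of a transfer operator:
the weight `exp(h ∑_{i<j} B(x_i - x_j))` times the average over one step of `p` independent lazy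
walks. This yields bounds on all moments of the solution, which in turn make the moments
converge, and it yields the submultiplicativity in time from which Fekete's lemma gives the
Lyapunov exponents.

For the lower bound, keep in the transfer operator only the moves of one of the `p` particles.
The others stay put at the cost of a factor `(1 - h ϰ)^(p-1)`, and the moving particle sees the
potential `(p - 1) B`. The second moment for the diffusivity `ϰ / (p - 1)`, run with the time
step `(p - 1) h`, sees the same potential, but the difference of its two walks makes two moves
per time step. Averaging over the extra move can only lower the value at the origin, because all
functions involved are positive definite.
-/

noncomputable section

namespace Anderson

section Transfer

variable {G : Type*}

/-- The operator `F ↦ ∑_z K(z) F(· + z)` of averaging over one step of the random walk with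
transition kernel `K`. Values in `[0, ∞]` make summability questions disappear. -/
def avg [Add G] (K F : G → ℝ≥0∞) (x : G) : ℝ≥0∞ := ∑' z, K z * F (x + z)

/-- The transfer operator `F ↦ E · ∑_z K(z) F(· + z)`: one step of the random walk with kernel `K`,
followed by the multiplicative weight `E`. -/
def transfer [Add G] (E K F : G → ℝ≥0∞) (x : G) : ℝ≥0∞ := E x * avg K F x

/-- The discrete Feynman–Kac functional: the `n`-th iterate of the transfer operator applied to the
constant function `1`. -/
def transferIter [Add G] (E K : G → ℝ≥0∞) (n : ℕ) : G → ℝ≥0∞ := (transfer E K)^[n] 1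

section Add

variable [Add G] {E K F F' : G → ℝ≥0∞} {c : ℝ≥0∞}

lemma transferIter_zero (E K : G → ℝ≥0∞) : transferIter E K 0 = 1 := rfl

lemma transferIter_succ (E K : G → ℝ≥0∞) (n : ℕ) :
    transferIter E K (n + 1) = transfer E K (transferIter E K n) :=
  Function.iterate_succ_apply' _ _ _

lemma avg_mono (h : ∀ x, F x ≤ F' x) (x : G) : avg K F x ≤ avg K F' x :=
  ENNReal.tsum_le_tsum fun _ => mul_le_mul_right (h _) _

lemma avg_const_mul (K F : G → ℝ≥0∞) (c : ℝ≥0∞) (x : G) :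
    avg K (fun y => c * F y) x = c * avg K F x := by
  simp only [avg, ← ENNReal.tsum_mul_left, mul_left_comm]

lemma avg_const (hK : ∑' z, K z = 1) (c : ℝ≥0∞) (x : G) : avg K (fun _ => c) x = c := by
  simp [avg, ENNReal.tsum_mul_right, hK]

lemma transferIter_le_pow (hK : ∑' z, K z = 1) (hE : ∀ x, E x ≤ c) (n : ℕ) (x : G) :
    transferIter E K n x ≤ c ^ n := by
  induction n generalizing x with
  | zero => simp [transferIter_zero]
  | succ n ih =>
    rw [transferIter_succ, transfer, pow_succ']
    exact mul_le_mul' (hE x) ((avg_mono ih x).trans (avg_const hK _ x).le)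

lemma pow_le_transferIter (hK : ∑' z, K z = 1) (hE : ∀ x, c ≤ E x) (n : ℕ) (x : G) :
    c ^ n ≤ transferIter E K n x := by
  induction n generalizing x with
  | zero => simp [transferIter_zero]
  | succ n ih =>
    rw [transferIter_succ, transfer, pow_succ']
    exact mul_le_mul' (hE x) ((avg_const hK _ x).ge.trans (avg_mono ih x))

lemma transferIter_add_le {m : ℕ} (hc : ∀ x, transferIter E K m x ≤ c) (n : ℕ) (x : G) :
    transferIter E K (n + m) x ≤ c * transferIter E K n x := by
  induction n generalizing x with
  | zero => simpa [transferIter_zero] using hc x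
  | succ n ih =>
    rw [add_right_comm, transferIter_succ, transferIter_succ, transfer, transfer, mul_left_comm c]
    exact mul_le_mul' le_rfl ((avg_mono ih x).trans (avg_const_mul _ _ _ _).le)

end Add

lemma transferIter_add_right [AddCommSemigroup G] {E K : G → ℝ≥0∞} {c : G}
    (hE : ∀ x, E (x + c) = E x) (n : ℕ) (x : G) :
    transferIter E K n (x + c) = transferIter E K n x := by
  induction n generalizing x with
  | zero => simp [transferIter_zero]
  | succ n ih => simp only [transferIter_succ, transfer, hE, avg, add_right_comm x c, ih]

lemma prod_tsum_eq_tsum_prod {α : Type*} {n : ℕ} (f : Fin n → α → ℝ≥0∞) :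
    ∏ i, ∑' z, f i z = ∑' z : Fin n → α, ∏ i, f i (z i) := by
  induction n with
  | zero => simp
  | succ n ih =>
    rw [Fin.prod_univ_succ, ih, ← (Fin.consEquiv (fun _ : Fin (n + 1) => α)).tsum_eq,
      ENNReal.tsum_prod', ← ENNReal.tsum_mul_right]
    refine tsum_congr fun y => ?_
    rw [← ENNReal.tsum_mul_left]
    refine tsum_congr fun z => ?_
    simp [Fin.prod_univ_succ, Fin.consEquiv]

/-- The transition kernel of `p` independent random walks, each with transition kernel `K`. -/
def powKernel (K : G → ℝ≥0∞) (p : ℕ) (z : Fin p → G) : ℝ≥0∞ := ∏ i, K (z i)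

lemma tsum_powKernel {K : G → ℝ≥0∞} (hK : ∑' z, K z = 1) (p : ℕ) :
    ∑' z, powKernel K p z = 1 := by
  simp only [powKernel, ← prod_tsum_eq_tsum_prod (fun _ : Fin p => K), hK, Finset.prod_const_one]

lemma prod_avg_eq_avg_powKernel [Add G] (K f : G → ℝ≥0∞) {p : ℕ} (x : Fin p → G) :
    ∏ i, avg K f (x i) = avg (powKernel K p) (fun y => ∏ i, f (y i)) x := by
  simp only [avg, prod_tsum_eq_tsum_prod, powKernel, Finset.prod_mul_distrib, Pi.add_apply]

-- Keep only the moves of the zeroth particle.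
lemma pow_mul_avg_le_avg_powKernel_single [AddZeroClass G] (K : G → ℝ≥0∞) (p : ℕ)
    (F : (Fin (p + 1) → G) → ℝ≥0∞) (x : G) :
    K 0 ^ p * avg K (fun y => F (Pi.single 0 y)) x ≤
      avg (powKernel K (p + 1)) F (Pi.single 0 x) := by
  have hinj : Function.Injective (fun z : G => (Pi.single 0 z : Fin (p + 1) → G)) :=
    Pi.single_injective (M := fun _ : Fin (p + 1) => G) 0
  refine le_trans (le_of_eq ?_) (ENNReal.tsum_comp_le_tsum_of_injective hinj _)
  rw [avg, ← ENNReal.tsum_mul_left]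
  refine tsum_congr fun z => ?_
  have hK : powKernel K (p + 1) (Pi.single 0 z) = K z * K 0 ^ p := by
    simp [powKernel, Fin.prod_univ_succ]
  rw [← Pi.single_add, hK]
  ring

-- The difference of two independent walks with a symmetric kernel moves like a single walk that
-- makes two steps at a time.
lemma avg_powKernel_two_sub [AddCommGroup G] {K : G → ℝ≥0∞} (hK : ∀ z, K (-z) = K z)
    (f : G → ℝ≥0∞) (x : Fin 2 → G) :
    avg (powKernel K 2) (fun y => f (y 0 - y 1)) x = avg K (avg K f) (x 0 - x 1) := by
  simp only [avg]
  rw [← (finTwoArrowEquiv G).symm.tsum_eq, ENNReal.tsum_prod']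
  refine tsum_congr fun z => ?_
  rw [← ENNReal.tsum_mul_left, ← (Equiv.neg G).tsum_eq]
  refine tsum_congr fun y => ?_
  have hsub : x 0 + z - (x 1 + -y) = x 0 - x 1 + z + y := by abel
  simp [powKernel, hK, hsub, mul_assoc]

end Transfer

section Kernel

variable {G : Type*} [AddCommGroup G]

/-- A symmetric probability distribution on a group, seen as the transition kernel of a random walk
with symmetric jumps. Unlike `IsJumpKernel`, it may charge the origin and need not charge its
neighbours. -/
structure IsSymmetricKernel (a : G → ℝ) : Prop where
  nonneg : ∀ z, 0 ≤ a z
  symm : ∀ z, a (-z) = a z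
  hasSum_one : HasSum a 1

lemma IsJumpKernel.isSymmetricKernel {d : ℕ} {a : Lattice d → ℝ} (ha : IsJumpKernel a) :
    IsSymmetricKernel a :=
  ⟨ha.nonneg, ha.symm, ha.hasSum_one⟩

variable {a f g : G → ℝ} {τ M : ℝ}

namespace IsSymmetricKernel

lemma summable_mul (ha : IsSymmetricKernel a) (hf : ∀ x, |f x| ≤ M) (φ : G → G) :
    Summable fun z => a z * f (φ z) := by
  refine Summable.of_norm_bounded (ha.hasSum_one.summable.mul_right M) fun z => ?_
  rw [norm_mul, Real.norm_eq_abs, Real.norm_eq_abs, abs_of_nonneg (ha.nonneg z)]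
  exact mul_le_mul_of_nonneg_left (hf _) (ha.nonneg z)

lemma tsum_ofReal (ha : IsSymmetricKernel a) : ∑' z, ENNReal.ofReal (a z) = 1 := by
  rw [← ENNReal.ofReal_tsum_of_nonneg ha.nonneg ha.hasSum_one.summable, ha.hasSum_one.tsum_eq,
    ENNReal.ofReal_one]

lemma avg_ofReal (ha : IsSymmetricKernel a) (hf : ∀ x, |f x| ≤ M) (hf0 : ∀ x, 0 ≤ f x) (x : G) :
    avg (fun z => ENNReal.ofReal (a z)) (fun y => ENNReal.ofReal (f y)) x =
      ENNReal.ofReal (∑' z, a z * f (x + z)) := by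
  rw [ENNReal.ofReal_tsum_of_nonneg (fun z => mul_nonneg (ha.nonneg z) (hf0 _))
    (ha.summable_mul hf _)]
  simp only [avg, ENNReal.ofReal_mul (ha.nonneg _)]

end IsSymmetricKernel

open scoped Classical in
/-- The kernel `(1 - τ) δ₀ + τ a` of one explicit Euler step of length `τ` for the random walk with
jump kernel `a`. -/
def stepKernel (a : G → ℝ) (τ : ℝ) (z : G) : ℝ := (if z = 0 then 1 - τ else 0) + τ * a z

lemma hasSum_stepKernel_mul {x : G} {s : ℝ} (h : HasSum (fun z => a z * f (x + z)) s) (τ : ℝ) :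
    HasSum (fun z => stepKernel a τ z * f (x + z)) ((1 - τ) * f x + τ * s) := by
  classical
  convert (hasSum_ite_eq (0 : G) ((1 - τ) * f x)).add (h.mul_left τ) using 2 with z
  by_cases hz : z = 0
  · simp only [stepKernel, hz, if_true, add_zero]
    ring
  · simp only [stepKernel, hz, if_false]
    ring

lemma stepKernel_neg (ha : IsSymmetricKernel a) (τ : ℝ) (z : G) :
    stepKernel a τ (-z) = stepKernel a τ z := by
  rcases eq_or_ne z 0 with rfl | hz
  · rw [neg_zero]
  · simp only [stepKernel, neg_eq_zero, hz, if_false, ha.symm]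

lemma IsSymmetricKernel.stepKernel (ha : IsSymmetricKernel a) (h0 : 0 ≤ τ) (h1 : τ ≤ 1) :
    IsSymmetricKernel (Anderson.stepKernel a τ) where
  nonneg z := by
    have := mul_nonneg h0 (ha.nonneg z)
    unfold Anderson.stepKernel
    split_ifs <;> linarith
  symm := stepKernel_neg ha τ
  hasSum_one := by
    have h : HasSum (fun z => a z * (fun _ : G => (1 : ℝ)) (0 + z)) 1 := by
      simpa only [mul_one] using ha.hasSum_one
    simpa only [mul_one, sub_add_cancel] using
      hasSum_stepKernel_mul (f := fun _ => 1) (x := 0) h τ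

lemma IsSymmetricKernel.one_sub_le_stepKernel_zero (ha : IsSymmetricKernel a) (h0 : 0 ≤ τ) :
    1 - τ ≤ Anderson.stepKernel a τ 0 := by
  have := mul_nonneg h0 (ha.nonneg 0)
  simpa [Anderson.stepKernel] using this

/-- `stepKernel` with values in `[0, ∞]`, to be used with `avg`. -/
def stepKernelE (a : G → ℝ) (τ : ℝ) (z : G) : ℝ≥0∞ := ENNReal.ofReal (stepKernel a τ z)

lemma stepKernelE_neg (ha : IsSymmetricKernel a) (τ : ℝ) (z : G) :
    stepKernelE a τ (-z) = stepKernelE a τ z :=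
  congr_arg ENNReal.ofReal (stepKernel_neg ha τ z)

lemma tsum_stepKernelE (ha : IsSymmetricKernel a) (h0 : 0 ≤ τ) (h1 : τ ≤ 1) :
    ∑' z, stepKernelE a τ z = 1 :=
  (ha.stepKernel h0 h1).tsum_ofReal

/-- The Euler step `f ↦ (1 - τ) f + τ ∑_z a(z) f(· + z)` on real-valued functions; where the series
converges, it is `f + τ ℒ f`. -/
def stepAvg (a : G → ℝ) (τ : ℝ) (f : G → ℝ) (x : G) : ℝ := ∑' z, stepKernel a τ z * f (x + z)

lemma stepAvg_eq_of_summable {x : G} (h : Summable fun z => a z * f (x + z)) (τ : ℝ) :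
    stepAvg a τ f x = (1 - τ) * f x + τ * ∑' z, a z * f (x + z) :=
  (hasSum_stepKernel_mul h.hasSum τ).tsum_eq

lemma stepAvg_sub_of_summable {x : G} (hf : Summable fun z => a z * f (x + z))
    (hg : Summable fun z => a z * g (x + z)) (τ : ℝ) :
    stepAvg a τ (f - g) x = stepAvg a τ f x - stepAvg a τ g x := by
  have hfg : HasSum (fun z => a z * (f - g) (x + z))
      (∑' z, a z * f (x + z) - ∑' z, a z * g (x + z)) := by
    simpa only [Pi.sub_apply, mul_sub] using hf.hasSum.sub hg.hasSum
  rw [stepAvg_eq_of_summable hf, stepAvg_eq_of_summable hg, stepAvg_eq_of_summable hfg.summable,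
    hfg.tsum_eq, Pi.sub_apply]
  ring

lemma stepAvg_nonneg (ha : IsSymmetricKernel a) (h0 : 0 ≤ τ) (h1 : τ ≤ 1) (hf : ∀ x, 0 ≤ f x)
    (x : G) : 0 ≤ stepAvg a τ f x :=
  tsum_nonneg fun z => mul_nonneg ((ha.stepKernel h0 h1).nonneg z) (hf _)

end Kernel

section PosDef

lemma posSemidef_iff_forall_finset_sum {n : Type*} {M : Matrix n n ℝ} :
    M.PosSemidef ↔ M.IsHermitian ∧
      ∀ (s : Finset n) (c : n → ℝ), 0 ≤ ∑ i ∈ s, ∑ j ∈ s, c i * M i j * c j := by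
  classical
  refine ⟨fun hM => ⟨hM.1, fun s c => ?_⟩, fun ⟨hM, h⟩ => ⟨hM, fun x => h x.support x⟩⟩
  have hs := (hM.submatrix ((↑) : s → n)).dotProduct_mulVec_nonneg fun i => c i
  simp only [dotProduct, Matrix.mulVec, Matrix.submatrix_apply, Pi.star_apply, star_trivial,
    Finset.mul_sum, ← mul_assoc] at hs
  calc 0 ≤ ∑ i : s, ∑ j : s, c i * M i j * c j := hs
    _ = ∑ i : s, ∑ j ∈ s, c i * M i j * c j :=
      Finset.sum_congr rfl fun i _ => Finset.sum_coe_sort s fun j => c i * M i j * c j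
    _ = ∑ i ∈ s, ∑ j ∈ s, c i * M i j * c j :=
      Finset.sum_coe_sort s fun i => ∑ j ∈ s, c i * M i j * c j

lemma posSemidef_of_hasSum {α n : Type*} {M : α → Matrix n n ℝ} {N : Matrix n n ℝ}
    (hM : ∀ k, (M k).PosSemidef) (hN : ∀ i j, HasSum (fun k => M k i j) (N i j)) :
    N.PosSemidef := by
  refine posSemidef_iff_forall_finset_sum.mpr ⟨?_, fun s c => ?_⟩
  · ext i j
    refine (hN j i).unique ?_
    simpa only [fun k => ((hM k).1.apply i j).symm, star_trivial] using hN i j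
  · have hsum : HasSum (fun k => ∑ i ∈ s, ∑ j ∈ s, c i * M k i j * c j)
        (∑ i ∈ s, ∑ j ∈ s, c i * N i j * c j) :=
      hasSum_sum fun i _ => hasSum_sum fun j _ => ((hN i j).mul_left _).mul_right _
    exact hsum.nonneg fun k => (posSemidef_iff_forall_finset_sum.mp (hM k)).2 s c

lemma posSemidef_mul_self {n : Type*} (v : n → ℝ) :
    (Matrix.of fun i j => v i * v j).PosSemidef := by
  refine posSemidef_iff_forall_finset_sum.mpr ⟨?_, fun s c => ?_⟩
  · ext i j
    exact mul_comm _ _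
  · have hsq : ∑ i ∈ s, ∑ j ∈ s, c i * (v i * v j) * c j = (∑ i ∈ s, c i * v i) ^ 2 := by
      rw [sq, Finset.sum_mul_sum]
      exact Finset.sum_congr rfl fun i _ => Finset.sum_congr rfl fun j _ => by ring
    exact hsq ▸ sq_nonneg _

variable {G : Type*} [AddCommGroup G] {f g a : G → ℝ} {τ r : ℝ}

/-- Positive definite functions on an abelian group: the matrices `(f(x_i - x_j))_{ij}` are positive
semidefinite. This includes that `f` is even. -/
def IsPosDef (f : G → ℝ) : Prop := (Matrix.of fun x y => f (x - y)).PosSemidef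

lemma isPosDef_of_hasSum {α : Type*} {f : α → G → ℝ} {F : G → ℝ}
    (hf : ∀ k, IsPosDef (f k)) (hF : ∀ x, HasSum (fun k => f k x) (F x)) : IsPosDef F :=
  posSemidef_of_hasSum hf fun _ _ => hF _

lemma isPosDef_zero : IsPosDef (0 : G → ℝ) := Matrix.PosSemidef.zero

lemma isPosDef_one : IsPosDef (1 : G → ℝ) := by
  simpa [IsPosDef] using posSemidef_mul_self fun _ : G => (1 : ℝ)

namespace IsPosDef

lemma add (hf : IsPosDef f) (hg : IsPosDef g) : IsPosDef (f + g) := Matrix.PosSemidef.add hf hg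

lemma smul (hf : IsPosDef f) (hr : 0 ≤ r) : IsPosDef (r • f) := Matrix.PosSemidef.smul hf hr

lemma mul (hf : IsPosDef f) (hg : IsPosDef g) : IsPosDef (f * g) := Matrix.PosSemidef.hadamard hf hg

lemma pow (hf : IsPosDef f) : ∀ n : ℕ, IsPosDef (f ^ n)
  | 0 => by simpa using isPosDef_one
  | n + 1 => by simpa only [pow_succ] using (hf.pow n).mul hf

lemma exp (hf : IsPosDef f) : IsPosDef fun x => Real.exp (f x) := by
  refine isPosDef_of_hasSum (f := fun n : ℕ => (n.factorial : ℝ)⁻¹ • f ^ n)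
    (fun n => (hf.pow n).smul (by positivity)) fun x => ?_
  simpa [Real.exp_eq_exp_ℝ, div_eq_inv_mul] using NormedSpace.expSeries_div_hasSum_exp (f x)

lemma neg_apply (hf : IsPosDef f) (x : G) : f (-x) = f x := by
  simpa using hf.1.apply x 0

lemma apply_zero_nonneg (hf : IsPosDef f) : 0 ≤ f 0 := by
  simpa using hf.diag_nonneg (i := 0)

-- Restrict the quadratic form of `f` to the coefficients `c ⊕ ε c` on two copies of the group, the
-- second one shifted by `z`.
lemma two_smul_add_shift (hf : IsPosDef f) (z : G) {ε : ℝ} (hε : ε * ε = 1) :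
    IsPosDef fun x => 2 * f x + ε * (f (x + z) + f (x - z)) := by
  refine posSemidef_iff_forall_finset_sum.mpr ⟨?_, fun s c => ?_⟩
  · ext x y
    have hneg : ∀ v, f (y - x + v) = f (x - y - v) := fun v => by
      rw [← hf.neg_apply]
      congr 1
      abel
    have h₁ := hneg 0
    have h₂ := hneg (-z)
    simp only [add_zero, sub_zero, ← sub_eq_add_neg, sub_neg_eq_add] at h₁ h₂
    simp only [Matrix.conjTranspose_apply, Matrix.of_apply, star_trivial, h₁, h₂, hneg z]
    ring
  · have h := (posSemidef_iff_forall_finset_sum.mp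
      (Matrix.PosSemidef.submatrix hf (Sum.elim id fun x => x + z))).2 (s.disjSum s)
      (Sum.elim c fun x => ε * c x)
    simp only [Finset.sum_disjSum, Sum.elim_inl, Sum.elim_inr, Matrix.submatrix_apply,
      Matrix.of_apply, id_eq, add_sub_add_right_eq_sub, ← Finset.sum_add_distrib] at h
    convert h using 4 with x _ y _
    rw [Matrix.of_apply, show x + z - y = x - y + z by abel, show x - (y + z) = x - y - z by abel]
    linear_combination (-(c x * c y * f (x - y))) * hε

lemma abs_apply_le (hf : IsPosDef f) (x : G) : |f x| ≤ f 0 := by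
  have hplus := (hf.two_smul_add_shift x (ε := 1) (by norm_num)).apply_zero_nonneg
  have hminus := (hf.two_smul_add_shift x (ε := -1) (by norm_num)).apply_zero_nonneg
  rw [zero_add, zero_sub, hf.neg_apply] at hplus hminus
  exact abs_le.mpr ⟨by linarith, by linarith⟩

lemma summable_mul_shift (ha : IsSymmetricKernel a) (hf : IsPosDef f) (x : G) :
    Summable fun z => a z * f (x + z) :=
  ha.summable_mul hf.abs_apply_le _

-- The operators `1 ± A`, where `A` averages over the kernel `a`.
lemma add_smul_tsum (ha : IsSymmetricKernel a) (hf : IsPosDef f) {ε : ℝ} (hε : ε * ε = 1) :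
    IsPosDef fun x => f x + ε * ∑' z, a z * f (x + z) := by
  refine isPosDef_of_hasSum (fun z => (hf.two_smul_add_shift z hε).smul (r := a z / 2)
    (div_nonneg (ha.nonneg z) two_pos.le)) fun x => ?_
  have hplus := (hf.summable_mul_shift ha x).hasSum
  have hminus : HasSum (fun z => a z * f (x - z)) (∑' z, a z * f (x + z)) := by
    rw [← (Equiv.neg G).hasSum_iff]
    simpa [Function.comp_def, ha.symm] using hplus
  have hsum := (ha.hasSum_one.mul_right (f x)).add ((hplus.add hminus).mul_left (ε / 2))
  rw [show ∀ S : ℝ, 1 * f x + ε / 2 * (S + S) = f x + ε * S from fun S => by ring] at hsum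
  refine hsum.congr_fun fun z => ?_
  rw [Pi.smul_apply, smul_eq_mul]
  ring

lemma stepAvg (ha : IsSymmetricKernel a) (hf : IsPosDef f) (h0 : 0 ≤ τ) (h1 : τ ≤ 1 / 2) :
    IsPosDef (stepAvg a τ f) := by
  convert (hf.smul (r := 1 - 2 * τ) (by linarith)).add
    ((hf.add_smul_tsum ha (ε := 1) (by norm_num)).smul h0) using 1
  ext x
  rw [stepAvg_eq_of_summable (hf.summable_mul_shift ha x)]
  simp only [Pi.add_apply, Pi.smul_apply, smul_eq_mul]
  ring

lemma sub_stepAvg (ha : IsSymmetricKernel a) (hf : IsPosDef f) (h0 : 0 ≤ τ) :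
    IsPosDef (f - Anderson.stepAvg a τ f) := by
  convert (hf.add_smul_tsum ha (ε := -1) (by norm_num)).smul h0 using 1
  ext x
  rw [Pi.sub_apply, stepAvg_eq_of_summable (hf.summable_mul_shift ha x)]
  simp only [Pi.smul_apply, smul_eq_mul]
  ring

lemma avg_stepKernelE (ha : IsSymmetricKernel a) (hf : IsPosDef f) (hf0 : ∀ x, 0 ≤ f x)
    (h0 : 0 ≤ τ) (h1 : τ ≤ 1) :
    avg (stepKernelE a τ) (fun y => ENNReal.ofReal (f y)) =
      fun x => ENNReal.ofReal (Anderson.stepAvg a τ f x) :=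
  funext fun x => (ha.stepKernel h0 h1).avg_ofReal hf.abs_apply_le hf0 x

end IsPosDef

-- If `A` is the Euler step and `f_n`, `g_n` are the iterates of `E A` and of `E A²`, then
-- `f_{n+1} - g_{n+1} = E (A (f_n - g_n) + (1 - A) A g_n)` is positive definite, since `A` and
-- `1 - A` preserve positive definiteness.
lemma exists_isPosDef_sub_iterate {E : G → ℝ} (ha : IsSymmetricKernel a) (h0 : 0 ≤ τ)
    (h1 : τ ≤ 1 / 2) (hE : IsPosDef E) (hE0 : ∀ x, 0 ≤ E x) (n : ℕ) :
    ∃ f g : G → ℝ, (∀ x, 0 ≤ f x) ∧ (∀ x, 0 ≤ g x) ∧ IsPosDef g ∧ IsPosDef (f - g) ∧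
      transferIter (fun x => ENNReal.ofReal (E x)) (stepKernelE a τ) n =
        (fun x => ENNReal.ofReal (f x)) ∧
      (transfer (fun x => ENNReal.ofReal (E x)) (stepKernelE a τ) ∘
        avg (stepKernelE a τ))^[n] 1 = fun x => ENNReal.ofReal (g x) := by
  have h1' : τ ≤ 1 := by linarith
  induction n with
  | zero =>
    refine ⟨1, 1, fun _ => zero_le_one, fun _ => zero_le_one, isPosDef_one, ?_, ?_, ?_⟩
    · simpa only [sub_self] using isPosDef_zero
    all_goals ext; simp [transferIter_zero]
  | succ n ih =>
    obtain ⟨f, g, hf0, hg0, hg, hfg, hf_eq, hg_eq⟩ := ih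
    have hf : IsPosDef f := by simpa only [sub_add_cancel] using hfg.add hg
    have hAg := hg.stepAvg ha h0 h1
    have hAg0 := stepAvg_nonneg ha h0 h1' hg0
    refine ⟨E * stepAvg a τ f, E * stepAvg a τ (stepAvg a τ g),
      fun x => mul_nonneg (hE0 x) (stepAvg_nonneg ha h0 h1' hf0 x),
      fun x => mul_nonneg (hE0 x) (stepAvg_nonneg ha h0 h1' hAg0 x),
      hE.mul (hAg.stepAvg ha h0 h1), ?_, ?_, ?_⟩
    · convert hE.mul ((hfg.stepAvg ha h0 h1).add (hAg.sub_stepAvg ha h0)) using 1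
      ext x
      simp only [Pi.sub_apply, Pi.mul_apply, Pi.add_apply,
        stepAvg_sub_of_summable (hf.summable_mul_shift ha x) (hg.summable_mul_shift ha x)]
      ring
    · ext x
      rw [transferIter_succ, hf_eq, transfer, hf.avg_stepKernelE ha hf0 h0 h1', Pi.mul_apply,
        ENNReal.ofReal_mul (hE0 x)]
    · ext x
      rw [Function.iterate_succ_apply', hg_eq, Function.comp_apply, transfer,
        hg.avg_stepKernelE ha hg0 h0 h1', hAg.avg_stepKernelE ha hAg0 h0 h1', Pi.mul_apply,
        ENNReal.ofReal_mul (hE0 x)]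

lemma iterate_transfer_comp_avg_le {E : G → ℝ} (ha : IsSymmetricKernel a) (h0 : 0 ≤ τ)
    (h1 : τ ≤ 1 / 2) (hE : IsPosDef E) (hE0 : ∀ x, 0 ≤ E x) (n : ℕ) :
    (transfer (fun x => ENNReal.ofReal (E x)) (stepKernelE a τ) ∘ avg (stepKernelE a τ))^[n] 1 0 ≤
      transferIter (fun x => ENNReal.ofReal (E x)) (stepKernelE a τ) n 0 := by
  obtain ⟨f, g, -, -, -, hfg, hf_eq, hg_eq⟩ := exists_isPosDef_sub_iterate ha h0 h1 hE hE0 n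
  rw [hf_eq, hg_eq]
  exact ENNReal.ofReal_le_ofReal (sub_nonneg.mp hfg.apply_zero_nonneg)

end PosDef

section Moment

variable {G : Type*} [AddCommGroup G] {a B : G → ℝ} {ϰ h : ℝ} {p : ℕ}

/-- The potential `∑_{i < j} B(x_i - x_j)` of the `p`-particle problem, for even `B`. -/
def potential (B : G → ℝ) (x : Fin p → G) : ℝ := (∑ i, ∑ j, B (x i - x j) - p * B 0) / 2

lemma potential_add_const (B : G → ℝ) (x : Fin p → G) (c : G) :
    potential B (x + fun _ => c) = potential B x := by
  simp [potential]

lemma IsPosDef.potential_single (hB : IsPosDef B) (p : ℕ) (x : G) :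
    potential B (Pi.single (0 : Fin (p + 1)) x : Fin (p + 1) → G) =
      p * B x + p * (p - 1) / 2 * B 0 := by
  simp only [potential, Fin.sum_univ_succ, Pi.single_eq_same, sub_self, ne_eq, Fin.succ_ne_zero,
    not_false_eq_true, Pi.single_eq_of_ne, sub_zero, zero_sub, hB.neg_apply, Finset.sum_const,
    Finset.card_univ, Fintype.card_fin, nsmul_eq_mul, Nat.cast_add, Nat.cast_one]
  ring

lemma IsPosDef.potential_two (hB : IsPosDef B) (x : Fin 2 → G) :
    potential B x = B (x 0 - x 1) := by
  have hsymm : B (x 1 - x 0) = B (x 0 - x 1) := by rw [← hB.neg_apply, neg_sub]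
  simp only [potential, Fin.sum_univ_two, sub_self, hsymm, Nat.cast_ofNat]
  ring

/-- A bound for the modulus of the potential of the `p`-particle problem, hence for the exponential
growth rate of the `p`-th moments. -/
def momentRate (B : G → ℝ) (p : ℕ) : ℝ := (p * p + p) / 2 * B 0

lemma IsPosDef.momentRate_nonneg (hB : IsPosDef B) (p : ℕ) : 0 ≤ momentRate B p :=
  mul_nonneg (by positivity) hB.apply_zero_nonneg

lemma IsPosDef.abs_potential_le (hB : IsPosDef B) (x : Fin p → G) :
    |potential B x| ≤ momentRate B p := by
  have hsum : |∑ i, ∑ j, B (x i - x j)| ≤ p * p * B 0 := calc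
    |∑ i, ∑ j, B (x i - x j)| ≤ ∑ i, |∑ j, B (x i - x j)| := Finset.abs_sum_le_sum_abs _ _
    _ ≤ ∑ i, ∑ j, |B (x i - x j)| := Finset.sum_le_sum fun i _ => Finset.abs_sum_le_sum_abs _ _
    _ ≤ ∑ _i : Fin p, ∑ _j : Fin p, B 0 :=
      Finset.sum_le_sum fun i _ => Finset.sum_le_sum fun j _ => hB.abs_apply_le _
    _ = p * p * B 0 := by simp [mul_assoc]
  have h0 := mul_nonneg (Nat.cast_nonneg (α := ℝ) p) hB.apply_zero_nonneg
  rw [abs_le] at hsum ⊢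
  unfold potential momentRate
  constructor <;> linarith [hsum.1, hsum.2]

/-- The weight `exp(h ∑_{i < j} B(x_i - x_j))` of one time step of length `h`. -/
def pointWeight (B : G → ℝ) (p : ℕ) (h : ℝ) (x : Fin p → G) : ℝ≥0∞ :=
  ENNReal.ofReal (Real.exp (h * potential B x))

/-- The discrete `p`-point moment function after `n` time steps of length `h`: the Feynman–Kac
functional of `p` independent walks with diffusivity `ϰ` and potential `∑_{i < j} B(x_i - x_j)`. -/
def discreteMoment (a B : G → ℝ) (ϰ : ℝ) (p : ℕ) (h : ℝ) (n : ℕ) : (Fin p → G) → ℝ≥0∞ :=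
  transferIter (pointWeight B p h) (powKernel (stepKernelE a (h * ϰ)) p) n

lemma discreteMoment_add_const (a B : G → ℝ) (ϰ h : ℝ) (n : ℕ) (x : Fin p → G) (c : G) :
    discreteMoment a B ϰ p h n (x + fun _ => c) = discreteMoment a B ϰ p h n x :=
  transferIter_add_right (fun y => by simp only [pointWeight, potential_add_const]) n x

lemma discreteMoment_le (ha : IsSymmetricKernel a) (hB : IsPosDef B) (hϰ : 0 ≤ ϰ) (hh : 0 ≤ h)
    (h1 : h * ϰ ≤ 1) (n : ℕ) (x : Fin p → G) :
    discreteMoment a B ϰ p h n x ≤ ENNReal.ofReal (Real.exp (n * h * momentRate B p)) := by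
  refine (transferIter_le_pow
    (tsum_powKernel (tsum_stepKernelE ha (mul_nonneg hh hϰ) h1) p)
    (c := ENNReal.ofReal (Real.exp (h * momentRate B p))) (fun y => ?_) n x).trans_eq ?_
  · refine ENNReal.ofReal_le_ofReal (Real.exp_le_exp.mpr ?_)
    exact mul_le_mul_of_nonneg_left ((le_abs_self _).trans (hB.abs_potential_le y)) hh
  · rw [← ENNReal.ofReal_pow (Real.exp_pos _).le, ← Real.exp_nat_mul, mul_assoc]

lemma le_discreteMoment (ha : IsSymmetricKernel a) (hB : IsPosDef B) (hϰ : 0 ≤ ϰ) (hh : 0 ≤ h)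
    (h1 : h * ϰ ≤ 1) (n : ℕ) (x : Fin p → G) :
    ENNReal.ofReal (Real.exp (-(n * h * momentRate B p))) ≤ discreteMoment a B ϰ p h n x := by
  refine le_trans (le_of_eq ?_) (pow_le_transferIter
    (tsum_powKernel (tsum_stepKernelE ha (mul_nonneg hh hϰ) h1) p)
    (c := ENNReal.ofReal (Real.exp (-(h * momentRate B p)))) (fun y => ?_) n x)
  · rw [← ENNReal.ofReal_pow (Real.exp_pos _).le, ← Real.exp_nat_mul, mul_neg, mul_assoc]
  · refine ENNReal.ofReal_le_ofReal (Real.exp_le_exp.mpr ?_)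
    rw [← mul_neg]
    exact mul_le_mul_of_nonneg_left (abs_le.mp (hB.abs_potential_le y)).1 hh

-- The factor `(1 - hϰ)^p` is the probability that `p` of the `p + 1` particles do not move.
lemma pow_mul_transferIter_le_discreteMoment (ha : IsSymmetricKernel a) (hB : IsPosDef B)
    (h0 : 0 ≤ h * ϰ) (h1 : h * ϰ ≤ 1) (p n : ℕ) (x : G) :
    ENNReal.ofReal ((1 - h * ϰ) ^ p * Real.exp (h * (p * (p - 1) / 2 * B 0))) ^ n *
      transferIter (fun y => ENNReal.ofReal (Real.exp (h * (p * B y)))) (stepKernelE a (h * ϰ)) n x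
      ≤ discreteMoment a B ϰ (p + 1) h n (Pi.single 0 x) := by
  set K := stepKernelE a (h * ϰ)
  set c := ENNReal.ofReal ((1 - h * ϰ) ^ p * Real.exp (h * (p * (p - 1) / 2 * B 0))) with hc
  set E : G → ℝ≥0∞ := fun y => ENNReal.ofReal (Real.exp (h * (p * B y))) with hE
  have hweight : ∀ y, c * E y ≤ pointWeight B (p + 1) h (Pi.single 0 y) * K 0 ^ p := fun y => by
    rw [hc, hE, pointWeight, hB.potential_single, mul_add, add_comm (h * _), Real.exp_add,
      ENNReal.ofReal_mul (Real.exp_pos _).le, ENNReal.ofReal_mul (pow_nonneg (by linarith) _),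
      ENNReal.ofReal_pow (by linarith), mul_assoc, mul_comm]
    gcongr
    exact ENNReal.ofReal_le_ofReal (ha.one_sub_le_stepKernel_zero h0)
  unfold discreteMoment
  induction n generalizing x with
  | zero => simp [transferIter_zero]
  | succ n ih =>
    rw [transferIter_succ, transferIter_succ, transfer, transfer]
    calc c ^ (n + 1) * (E x * avg K (transferIter E K n) x)
        = (c * E x) * avg K (fun y => c ^ n * transferIter E K n y) x := by
          rw [avg_const_mul]
          ring
      _ ≤ (pointWeight B (p + 1) h (Pi.single 0 x) * K 0 ^ p) *
          avg K (fun y => transferIter (pointWeight B (p + 1) h) (powKernel K (p + 1)) n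
            (Pi.single 0 y)) x := mul_le_mul' (hweight x) (avg_mono ih x)
      _ ≤ _ := by
          rw [mul_assoc]
          exact mul_le_mul' le_rfl (pow_mul_avg_le_avg_powKernel_single _ _ _ _)

lemma discreteMoment_two (ha : IsSymmetricKernel a) (hB : IsPosDef B) (ϰ h : ℝ) (n : ℕ)
    (x : Fin 2 → G) :
    discreteMoment a B ϰ 2 h n x =
      (transfer (fun y => ENNReal.ofReal (Real.exp (h * B y))) (stepKernelE a (h * ϰ)) ∘
        avg (stepKernelE a (h * ϰ)))^[n] 1 (x 0 - x 1) := by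
  unfold discreteMoment
  induction n generalizing x with
  | zero => rfl
  | succ n ih =>
    rw [Function.iterate_succ_apply', transferIter_succ, transfer, pointWeight, hB.potential_two,
      funext ih, avg_powKernel_two_sub (stepKernelE_neg ha _)]
    rfl

-- Freezing all particles but one turns the potential into `p B`, which is the potential of the
-- two-particle problem with time step `p h`; the two particles jump at rate `ϰ / p`.
lemma pow_mul_discreteMoment_two_le (ha : IsSymmetricKernel a) (hB : IsPosDef B) (hϰ : 0 ≤ ϰ)
    (hh : 0 ≤ h) (h1 : h * ϰ ≤ 1 / 2) (hp : p ≠ 0) (n : ℕ) :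
    ENNReal.ofReal ((1 - h * ϰ) ^ p * Real.exp (h * (p * (p - 1) / 2 * B 0))) ^ n *
      discreteMoment a B (ϰ / p) 2 (p * h) n 0 ≤ discreteMoment a B ϰ (p + 1) h n 0 := by
  have h0 : 0 ≤ h * ϰ := mul_nonneg hh hϰ
  have hsingle := pow_mul_transferIter_le_discreteMoment ha hB h0 (by linarith) p n 0
  rw [Pi.single_zero] at hsingle
  refine le_trans (mul_le_mul' le_rfl ?_) hsingle
  have hE : IsPosDef fun x => Real.exp (h * (p * B x)) :=
    ((hB.smul p.cast_nonneg).smul hh).exp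
  have hτ : p * h * (ϰ / p) = h * ϰ := by field_simp
  rw [discreteMoment_two ha hB, hτ, Pi.zero_apply, Pi.zero_apply, sub_zero]
  simp only [mul_comm (p : ℝ) h, mul_assoc h]
  exact iterate_transfer_comp_avg_le ha h0 h1 hE (fun x => (Real.exp_pos _).le) n

end Moment

section Corr

variable {d : ℕ} {b : Lattice d → ℝ}

lemma hasSum_corr (hb : Summable fun z => |b z|) (x y : Lattice d) :
    HasSum (fun z => b (x - z) * b (y - z)) (corr b (x - y)) := by
  have hbound : ∀ z, |b z| ≤ ∑' z, |b z| := fun z => hb.le_tsum z fun _ _ => abs_nonneg _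
  have hsum : Summable fun z => b (x - y - z) * b (-z) := by
    refine Summable.of_norm_bounded (g := fun z => |b (x - y - z)| * ∑' z, |b z|)
      (((Equiv.subLeft (x - y)).summable_iff.mpr hb).mul_right _) fun z => ?_
    rw [Real.norm_eq_abs, abs_mul]
    exact mul_le_mul_of_nonneg_left (hbound _) (abs_nonneg _)
  refine ((Equiv.subRight y).hasSum_iff.mpr hsum.hasSum).congr_fun fun z => ?_
  simp only [Function.comp_apply, Equiv.subRight_apply, sub_sub_sub_cancel_right, neg_sub]

lemma isPosDef_corr (hb : Summable fun z => |b z|) : IsPosDef (corr b) :=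
  posSemidef_of_hasSum (fun z => posSemidef_mul_self fun x => b (x - z)) (hasSum_corr hb)

end Corr

section GaussianSeries

variable {Ω ι : Type*} {mΩ : MeasurableSpace Ω} {P : Measure Ω} {X : ι → Ω → ℝ} {Y : Ω → ℝ}
  {v : ℝ≥0}

lemma tendsto_charFun_map_of_tendsto_ae [IsFiniteMeasure P] {l : Filter ι}
    [l.IsCountablyGenerated] (hX : ∀ i, AEMeasurable (X i) P) (hY : AEMeasurable Y P)
    (h : ∀ᵐ ω ∂P, Tendsto (fun i => X i ω) l (𝓝 (Y ω))) (t : ℝ) :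
    Tendsto (fun i => charFun (P.map (X i)) t) l (𝓝 (charFun (P.map Y) t)) := by
  have hchar : ∀ f : Ω → ℝ, AEMeasurable f P →
      charFun (P.map f) t = ∫ ω, Complex.exp (t * f ω * Complex.I) ∂P := fun f hf => by
    rw [charFun_apply_real, integral_map hf (by fun_prop)]
  rw [hchar Y hY]
  simp only [hchar _ (hX _)]
  refine tendsto_integral_filter_of_dominated_convergence (fun _ => 1)
    (Eventually.of_forall fun i => ?_) (Eventually.of_forall fun i => ae_of_all _ fun ω => ?_)
    (integrable_const _) ?_
  · have := hX i
    exact AEMeasurable.aestronglyMeasurable (by fun_prop)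
  · rw [← Complex.ofReal_mul, Complex.norm_exp_ofReal_mul_I]
  · filter_upwards [h] with ω hω
    have hcont : Continuous fun y : ℝ => Complex.exp (t * y * Complex.I) := by fun_prop
    exact (hcont.tendsto _).comp hω

lemma hasLaw_gaussianReal_of_tendsto_ae {l : Filter ι} [l.IsCountablyGenerated] [l.NeBot]
    {m : ι → ℝ} {s : ι → ℝ≥0} {m₀ : ℝ} {s₀ : ℝ≥0}
    (hX : ∀ i, HasLaw (X i) (gaussianReal (m i) (s i)) P) (hm : Tendsto m l (𝓝 m₀))
    (hs : Tendsto s l (𝓝 s₀)) (h : ∀ᵐ ω ∂P, Tendsto (fun i => X i ω) l (𝓝 (Y ω))) :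
    HasLaw Y (gaussianReal m₀ s₀) P := by
  obtain ⟨i, -⟩ := l.nonempty_of_mem univ_mem
  have hprob := (hX i).isProbabilityMeasure
  have hY : AEMeasurable Y P := aemeasurable_of_tendsto_metrizable_ae l
    (fun i => (hX i).aemeasurable) h
  refine ⟨hY, Measure.ext_of_charFun (funext fun t => ?_)⟩
  refine tendsto_nhds_unique
    (tendsto_charFun_map_of_tendsto_ae (fun i => (hX i).aemeasurable) hY h t) ?_
  simp only [(hX _).map_eq, charFun_gaussianReal]
  have hm' : Tendsto (fun i => (m i : ℂ)) l (𝓝 m₀) := (Complex.continuous_ofReal.tendsto _).comp hm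
  have hs' : Tendsto (fun i => ((s i : ℝ) : ℂ)) l (𝓝 (s₀ : ℝ)) :=
    (Complex.continuous_ofReal.tendsto _).comp ((NNReal.continuous_coe.tendsto _).comp hs)
  exact (((hm'.const_mul _).mul_const _).sub ((hs'.mul_const _).div_const _)).cexp

lemma hasLaw_finsetSum_gaussian (hind : iIndepFun X P) {m : ι → ℝ} {s : ι → ℝ≥0}
    (hX : ∀ i, HasLaw (X i) (gaussianReal (m i) (s i)) P) (F : Finset ι) :
    HasLaw (fun ω => ∑ i ∈ F, X i ω) (gaussianReal (∑ i ∈ F, m i) (∑ i ∈ F, s i)) P := by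
  classical
  have hprob := hind.isProbabilityMeasure
  induction F using Finset.induction_on with
  | empty =>
    simp only [Finset.sum_empty, gaussianReal_zero_var]
    exact hasLaw_dirac_of_ae_eq (ae_of_all _ fun _ => rfl)
  | insert i F hi ih =>
    have hindep : IndepFun (X i) (fun ω => ∑ j ∈ F, X j ω) P := by
      simpa only [← Finset.sum_apply] using
        (hind.indepFun_finsetSum_of_notMem₀ (fun j => (hX j).aemeasurable) hi).symm
    simp only [Finset.sum_insert hi]
    refine ⟨(hX i).aemeasurable.fun_add ih.aemeasurable, ?_⟩
    exact gaussianReal_add_gaussianReal_of_indepFun hindep (hX i).map_eq ih.map_eq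

lemma summable_of_tsum_enorm_ne_top {α : Type*} {f : α → ℝ} (h : ∑' i, ‖f i‖ₑ ≠ ∞) :
    Summable f :=
  Summable.of_norm (by simpa only [toReal_enorm] using ENNReal.summable_toReal h)

lemma ae_summable_of_tsum_lintegral_ne_top [Countable ι] (hX : ∀ i, AEMeasurable (X i) P)
    (h : ∑' i, ∫⁻ ω, ‖X i ω‖ₑ ∂P ≠ ∞) : ∀ᵐ ω ∂P, Summable fun i => X i ω := by
  rw [← lintegral_tsum fun i => (hX i).enorm] at h
  filter_upwards [ae_lt_top' (AEMeasurable.tsum fun i => (hX i).enorm) h] with ω hω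
  exact summable_of_tsum_enorm_ne_top hω.ne

lemma ae_summable_mul_gaussian [Countable ι] (hX : ∀ i, HasLaw (X i) (gaussianReal 0 v) P)
    {c : ι → ℝ} (hc : Summable fun i => |c i|) : ∀ᵐ ω ∂P, Summable fun i => c i * X i ω := by
  refine ae_summable_of_tsum_lintegral_ne_top (fun i => (hX i).aemeasurable.const_mul _) ?_
  have hterm : ∀ i, ∫⁻ ω, ‖c i * X i ω‖ₑ ∂P = ‖c i‖ₑ * ∫⁻ y, ‖y‖ₑ ∂(gaussianReal 0 v) :=
    fun i => by
    simp only [enorm_mul]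
    rw [lintegral_const_mul' _ _ enorm_ne_top,
      (hX i).lintegral_comp (f := fun y : ℝ => ‖y‖ₑ) (by fun_prop)]
  simp only [hterm, ENNReal.tsum_mul_right]
  refine ENNReal.mul_ne_top ?_ ?_
  · simpa only [ofReal_norm] using Summable.tsum_ofReal_ne_top (f := fun i => ‖c i‖) hc
  · exact ((memLp_id_gaussianReal 1).integrable le_rfl).2.ne

lemma hasLaw_tsum_gaussian [Countable ι] (hind : iIndepFun X P)
    (hX : ∀ i, HasLaw (X i) (gaussianReal 0 v) P) {c : ι → ℝ} (hc : Summable fun i => |c i|)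
    {σ : ℝ≥0} (hσ : HasSum (fun i => c i ^ 2) σ) :
    HasLaw (fun ω => ∑' i, c i * X i ω) (gaussianReal 0 (v * σ)) P := by
  set s : ι → ℝ≥0 := fun i => .mk (c i ^ 2) (sq_nonneg _) * v
  have hs : HasSum s (v * σ) := by
    rw [mul_comm]
    exact (NNReal.hasSum_coe (f := fun i => .mk (c i ^ 2) (sq_nonneg _)).mp hσ).mul_right v
  have hcX : ∀ i, HasLaw (fun ω => c i * X i ω) (gaussianReal 0 (s i)) P := fun i => by
    simpa only [mul_zero] using gaussianReal_const_mul (hX i) (c i)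
  have hindc : iIndepFun (fun i ω => c i * X i ω) P :=
    hind.comp (fun i y => c i * y) fun i => by fun_prop
  have hpartial := hasLaw_finsetSum_gaussian hindc hcX
  simp only [Finset.sum_const_zero] at hpartial
  refine hasLaw_gaussianReal_of_tendsto_ae hpartial tendsto_const_nhds hs ?_
  filter_upwards [ae_summable_mul_gaussian hX hc] with ω hω using hω.hasSum

end GaussianSeries

section GaussianMoments

variable {Ω : Type*} {mΩ : MeasurableSpace Ω} {P : Measure Ω} {X : Ω → ℝ} {v : ℝ≥0}

lemma memLp_gaussian (hX : HasLaw X (gaussianReal 0 v) P) (p : ℝ≥0) : MemLp X p P := by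
  have h : MemLp id p (P.map X) := hX.map_eq ▸ memLp_id_gaussianReal p
  exact h.comp_of_map hX.aemeasurable

lemma integral_gaussian (hX : HasLaw X (gaussianReal 0 v) P) : ∫ ω, X ω ∂P = 0 := by
  rw [hX.integral_eq, integral_id_gaussianReal]

lemma integral_sq_gaussian (hX : HasLaw X (gaussianReal 0 v) P) : ∫ ω, X ω ^ 2 ∂P = v := by
  rw [← variance_of_integral_eq_zero hX.aemeasurable (integral_gaussian hX), hX.variance_eq,
    variance_id_gaussianReal]

lemma integrable_exp_gaussian (hX : HasLaw X (gaussianReal 0 v) P) (t : ℝ) :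
    Integrable (fun ω => Real.exp (t * X ω)) P := by
  have h : Integrable (fun y => Real.exp (t * y)) (P.map X) :=
    hX.map_eq ▸ integrable_exp_mul_gaussianReal t
  exact h.comp_aemeasurable hX.aemeasurable

lemma integral_exp_gaussian (hX : HasLaw X (gaussianReal 0 v) P) (t : ℝ) :
    ∫ ω, Real.exp (t * X ω) ∂P = Real.exp (v * t ^ 2 / 2) := by
  simpa only [mgf, zero_mul, zero_add] using mgf_gaussianReal hX.map_eq t

lemma lintegral_ofReal_exp_gaussian (hX : HasLaw X (gaussianReal 0 v) P) (c : ℝ) :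
    ∫⁻ ω, ENNReal.ofReal (Real.exp (X ω - c)) ∂P = ENNReal.ofReal (Real.exp (v / 2 - c)) := by
  have hint := integrable_exp_gaussian hX 1
  have hexp := integral_exp_gaussian hX 1
  simp only [one_mul, one_pow, mul_one] at hint hexp
  simp only [Real.exp_sub]
  rw [← ofReal_integral_eq_lintegral_ofReal (hint.div_const _)
    (ae_of_all _ fun ω => by positivity), integral_div, hexp]

lemma integral_mul_exp_gaussian (hX : HasLaw X (gaussianReal 0 v) P) :
    ∫ ω, X ω * Real.exp (X ω) ∂P = v * Real.exp (v / 2) := by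
  have hset : integrableExpSet X P = Set.univ :=
    Set.eq_univ_of_forall fun t => integrable_exp_gaussian hX t
  have hmgf : mgf X P = fun t => Real.exp (v * t ^ 2 / 2) :=
    funext fun t => integral_exp_gaussian hX t
  have hderiv : HasDerivAt (mgf X P) (Real.exp (v * 1 ^ 2 / 2) * (v * (2 * 1 ^ 1) / 2)) 1 := by
    rw [hmgf]
    simpa using (((hasDerivAt_pow 2 (1 : ℝ)).const_mul (v : ℝ)).div_const 2).exp
  have h := deriv_mgf (X := X) (μ := P) (t := 1) (by simp [hset])
  rw [hderiv.deriv] at h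
  simp only [one_mul] at h
  rw [← h]
  ring_nf

lemma memLp_two_exp_gaussian (hX : HasLaw X (gaussianReal 0 v) P) (c : ℝ) :
    MemLp (fun ω => Real.exp (X ω - c)) 2 P := by
  have := hX.aemeasurable
  refine (memLp_two_iff_integrable_sq (AEMeasurable.aestronglyMeasurable (by fun_prop))).mpr ?_
  refine ((integrable_exp_gaussian hX 2).div_const (Real.exp c ^ 2)).congr (ae_of_all _ fun ω => ?_)
  simp only [Real.exp_sub, div_pow, ← Real.exp_nat_mul, Nat.cast_ofNat]

lemma integral_exp_sub_half_gaussian (hX : HasLaw X (gaussianReal 0 v) P) :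
    ∫ ω, Real.exp (X ω - v / 2) ∂P = 1 := by
  have hexp := integral_exp_gaussian hX 1
  simp only [one_mul, one_pow, mul_one] at hexp
  simp only [Real.exp_sub, integral_div, hexp, div_self (Real.exp_pos _).ne']

lemma memLp_two_exp_sub_one_sub_gaussian (hX : HasLaw X (gaussianReal 0 v) P) (c : ℝ) :
    MemLp (fun ω => Real.exp (X ω - c) - 1 - X ω) 2 P :=
  have := hX.isProbabilityMeasure
  ((memLp_two_exp_gaussian hX c).sub (memLp_const 1)).sub (memLp_gaussian hX 2)

lemma integral_exp_sub_one_sub_gaussian (hX : HasLaw X (gaussianReal 0 v) P) :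
    ∫ ω, (Real.exp (X ω - v / 2) - 1 - X ω) ∂P = 0 := by
  have hprob := hX.isProbabilityMeasure
  have hexp : Integrable (fun ω => Real.exp (X ω - v / 2)) P :=
    (memLp_two_exp_gaussian hX _).integrable one_le_two
  have hexp_sub : Integrable (fun ω => Real.exp (X ω - v / 2) - 1) P :=
    hexp.sub (integrable_const 1)
  rw [integral_sub hexp_sub ((memLp_gaussian hX 2).integrable one_le_two),
    integral_sub hexp (integrable_const 1), integral_exp_sub_half_gaussian hX,
    integral_gaussian hX]
  simp

lemma integral_exp_sub_one_sub_sq_gaussian (hX : HasLaw X (gaussianReal 0 v) P) :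
    ∫ ω, (Real.exp (X ω - v / 2) - 1 - X ω) ^ 2 ∂P = Real.exp v - 1 - v := by
  have hprob := hX.isProbabilityMeasure
  set Z : Ω → ℝ := fun ω => Real.exp (X ω - v / 2) with hZ
  have hX2 : MemLp X 2 P := memLp_gaussian hX 2
  have hZ2 : MemLp Z 2 P := memLp_two_exp_gaussian hX _
  have hexp : Real.exp (v / 2) * Real.exp (-(v / 2)) = 1 := by
    rw [← Real.exp_add, add_neg_cancel, Real.exp_zero]
  have intZ : ∫ ω, Z ω ∂P = 1 := integral_exp_sub_half_gaussian hX
  have intZsq : ∫ ω, (Z ^ 2) ω ∂P = Real.exp v := by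
    have hsq : ∀ ω, (Z ^ 2) ω = Real.exp (2 * X ω) * Real.exp (-v) := fun ω => by
      rw [← Real.exp_add, Pi.pow_apply, ← Real.exp_nat_mul]
      push_cast
      ring_nf
    simp only [hsq, integral_mul_const, integral_exp_gaussian hX]
    rw [← Real.exp_add]
    ring_nf
  have intZX : ∫ ω, (Z * X) ω ∂P = v := by
    have hmul : ∀ ω, (Z * X) ω = X ω * Real.exp (X ω) * Real.exp (-(v / 2)) := fun ω => by
      simp only [Pi.mul_apply, hZ, sub_eq_add_neg, Real.exp_add]
      ring
    simp only [hmul, integral_mul_const, integral_mul_exp_gaussian hX]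
    rw [mul_assoc, hexp, mul_one]
  have hmean : ∫ ω, (Z - X) ω ∂P = 1 := by
    rw [integral_sub' (hZ2.integrable one_le_two) (hX2.integrable one_le_two), intZ,
      integral_gaussian hX, sub_zero]
  calc ∫ ω, (Z ω - 1 - X ω) ^ 2 ∂P = Var[Z - X; P] := by
        rw [variance_eq_integral (hZ2.sub hX2).aemeasurable, hmean]
        simp only [Pi.sub_apply, sub_right_comm]
    _ = (Real.exp v - 1) - 2 * v + v := by
        rw [variance_sub hZ2 hX2, variance_eq_sub hZ2, covariance_eq_sub hZ2 hX2, hX.variance_eq,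
          variance_id_gaussianReal, intZ, intZsq, intZX, integral_gaussian hX, mul_zero, sub_zero,
          one_pow]
    _ = Real.exp v - 1 - v := by ring

lemma integral_exp_sub_one_sub_sq_gaussian_le (hX : HasLaw X (gaussianReal 0 v) P) (hv : v ≤ 1) :
    ∫ ω, (Real.exp (X ω - v / 2) - 1 - X ω) ^ 2 ∂P ≤ (v : ℝ) ^ 2 := by
  rw [integral_exp_sub_one_sub_sq_gaussian hX]
  refine (le_abs_self _).trans (Real.abs_exp_sub_one_sub_id_le ?_)
  rw [abs_of_nonneg v.coe_nonneg]
  exact_mod_cast hv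

end GaussianMoments

section Noise

variable {Ω : Type*} {mΩ : MeasurableSpace Ω} {d : ℕ} {P : Measure Ω}
  {ℱ : Filtration ℝ≥0 mΩ} {w : Lattice d → ℝ≥0 → Ω → ℝ} {b : Lattice d → ℝ} {s t : ℝ≥0}

/-- The increment over `[s, t]` of the correlated Wiener process `corrWiener`. -/
def noise (b : Lattice d → ℝ) (w : Lattice d → ℝ≥0 → Ω → ℝ) (s t : ℝ≥0) (x : Lattice d)
    (ω : Ω) : ℝ :=
  ∑' z, b (x - z) * (w z t ω - w z s ω)

lemma summable_abs_sub_left {G : Type*} [AddCommGroup G] {b : G → ℝ}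
    (hb : Summable fun z => |b z|) (x : G) : Summable fun z => |b (x - z)| :=
  (Equiv.subLeft x).summable_iff.mpr hb

lemma IsBrownianFamily.isProbabilityMeasure (hw : IsBrownianFamily P ℱ w) :
    IsProbabilityMeasure P :=
  hw.iIndep.isProbabilityMeasure

lemma IsBrownianFamily.hasLaw_increment (hw : IsBrownianFamily P ℱ w) (hst : s ≤ t)
    (z : Lattice d) : HasLaw (fun ω => w z t ω - w z s ω) (gaussianReal 0 (t - s)) P := by
  have hdist : nndist t.1 s.1 = t - s := by
    ext
    rw [coe_nndist, Real.dist_eq, NNReal.coe_sub hst]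
    exact abs_of_nonneg (sub_nonneg.mpr (by exact_mod_cast hst))
  exact hdist ▸ (hw.isBrownian z).toIsPreBrownianReal.hasLaw_sub t s

lemma IsBrownianFamily.iIndep_increment (hw : IsBrownianFamily P ℱ w) (s t : ℝ≥0) :
    iIndepFun (fun z ω => w z t ω - w z s ω) P :=
  hw.iIndep.comp (fun _ f => f t - f s) fun _ => by fun_prop

lemma ae_summable_noise (hw : IsBrownianFamily P ℱ w) (hb : Summable fun z => |b z|)
    (hst : s ≤ t) (x : Lattice d) :
    ∀ᵐ ω ∂P, Summable fun z => b (x - z) * (w z t ω - w z s ω) :=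
  ae_summable_mul_gaussian (hw.hasLaw_increment hst) (summable_abs_sub_left hb x)

lemma ae_summable_corrWiener (hw : IsBrownianFamily P ℱ w) (hb : Summable fun z => |b z|)
    (t : ℝ≥0) (x : Lattice d) : ∀ᵐ ω ∂P, Summable fun z => b (x - z) * w z t ω :=
  ae_summable_mul_gaussian (fun z => (hw.isBrownian z).toIsPreBrownianReal.hasLaw_eval t)
    (summable_abs_sub_left hb x)

lemma ae_corrWiener_sub (hw : IsBrownianFamily P ℱ w) (hb : Summable fun z => |b z|)
    (s t : ℝ≥0) (x : Lattice d) :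
    ∀ᵐ ω ∂P, corrWiener b w x t ω - corrWiener b w x s ω = noise b w s t x ω := by
  filter_upwards [ae_summable_corrWiener hw hb t x, ae_summable_corrWiener hw hb s x] with ω ht hs
  simp only [corrWiener, noise, mul_sub, ht.tsum_sub hs]

lemma measurable_noise_filtration (hw : IsBrownianFamily P ℱ w) (hst : s ≤ t) (x : Lattice d) :
    Measurable[ℱ t] (noise b w s t x) :=
  @Measurable.tsum _ _ _ (ℱ t) _ _ _ _ _ _ _ _ _ _ _ _ fun z =>
    ((hw.adapted z t).sub ((hw.adapted z s).mono (ℱ.mono hst) le_rfl)).const_mul _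

/-- The `σ`-algebra generated by the noise increments over `[s, t]`. -/
@[reducible] def noiseSigma (b : Lattice d → ℝ) (w : Lattice d → ℝ≥0 → Ω → ℝ) (s t : ℝ≥0) :
    MeasurableSpace Ω :=
  MeasurableSpace.comap (fun ω x => noise b w s t x ω) MeasurableSpace.pi

lemma measurable_noise_noiseSigma (b : Lattice d → ℝ) (w : Lattice d → ℝ≥0 → Ω → ℝ) (s t : ℝ≥0)
    (x : Lattice d) : Measurable[noiseSigma b w s t] (noise b w s t x) :=
  (measurable_pi_apply x).comp (comap_measurable fun ω x => noise b w s t x ω)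

lemma noiseSigma_le (hw : IsBrownianFamily P ℱ w) (hst : s ≤ t) : noiseSigma b w s t ≤ mΩ := by
  rw [noiseSigma, ← measurable_iff_comap_le]
  exact measurable_pi_lambda _ fun x =>
    (measurable_noise_filtration hw hst x).mono (ℱ.le _) le_rfl

lemma indep_noise (hw : IsBrownianFamily P ℱ w) (hst : s ≤ t) :
    Indep (noiseSigma b w s t) (ℱ s) P := by
  refine indep_of_indep_of_le_left (hw.indep_increments s t hst) ?_
  have hcomp : (fun ω x => noise b w s t x ω) =
      (fun f x => ∑' z, b (x - z) * f z : (Lattice d → ℝ) → Lattice d → ℝ) ∘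
        (fun ω z => w z t ω - w z s ω) := rfl
  rw [noiseSigma, hcomp, ← MeasurableSpace.comap_comp]
  refine MeasurableSpace.comap_mono ?_
  rw [← measurable_iff_comap_le]
  exact measurable_pi_lambda _ fun x => Measurable.tsum fun z =>
    (measurable_pi_apply z).const_mul _

lemma hasSum_sq_sum_corr (hb : Summable fun z => |b z|) {ι : Type*} [Fintype ι]
    (x : ι → Lattice d) :
    HasSum (fun z => (∑ i, b (x i - z)) ^ 2) (∑ i, ∑ j, corr b (x i - x j)) := by
  simp only [sq, Finset.sum_mul_sum]
  exact hasSum_sum fun i _ => hasSum_sum fun j _ => hasSum_corr hb _ _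

lemma sum_sum_corr_nonneg (hb : Summable fun z => |b z|) {ι : Type*} [Fintype ι]
    (x : ι → Lattice d) : 0 ≤ ∑ i, ∑ j, corr b (x i - x j) :=
  (hasSum_sq_sum_corr hb x).nonneg fun _ => sq_nonneg _

lemma hasLaw_sum_noise (hw : IsBrownianFamily P ℱ w) (hb : Summable fun z => |b z|)
    (hst : s ≤ t) {ι : Type*} [Fintype ι] (x : ι → Lattice d) :
    HasLaw (fun ω => ∑ i, noise b w s t (x i) ω)
      (gaussianReal 0 ((t - s) * (∑ i, ∑ j, corr b (x i - x j)).toNNReal)) P := by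
  have hc : Summable fun z => |∑ i, b (x i - z)| :=
    Summable.of_nonneg_of_le (fun _ => abs_nonneg _) (fun z => Finset.abs_sum_le_sum_abs _ _)
      (summable_sum fun i _ => summable_abs_sub_left hb (x i))
  have hσ : HasSum (fun z => (∑ i, b (x i - z)) ^ 2)
      ((∑ i, ∑ j, corr b (x i - x j)).toNNReal : ℝ) := by
    rw [Real.coe_toNNReal _ (sum_sum_corr_nonneg hb x)]
    exact hasSum_sq_sum_corr hb x
  refine (hasLaw_tsum_gaussian (hw.iIndep_increment s t) (hw.hasLaw_increment hst) hc hσ).congr ?_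
  filter_upwards [ae_all_iff.mpr fun i => ae_summable_noise hw hb hst (x i)] with ω hω
  simp only [noise, Finset.sum_mul]
  rw [Summable.tsum_finsetSum fun i _ => hω i]

/-- The variance `B(0)` of the noise per unit of time, as a nonnegative real. -/
def noiseVar (b : Lattice d → ℝ) : ℝ≥0 := (corr b 0).toNNReal

lemma coe_noiseVar (b : Lattice d → ℝ) : (noiseVar b : ℝ) = corr b 0 := by
  refine Real.coe_toNNReal _ (tsum_nonneg fun z => ?_)
  rw [zero_sub]
  exact mul_self_nonneg _

lemma hasLaw_noise (hw : IsBrownianFamily P ℱ w) (hb : Summable fun z => |b z|)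
    (hst : s ≤ t) (x : Lattice d) :
    HasLaw (noise b w s t x) (gaussianReal 0 ((t - s) * noiseVar b)) P := by
  simpa [noiseVar] using hasLaw_sum_noise hw hb hst (fun _ : Unit => x)

lemma lintegral_prod_exp_noise (hw : IsBrownianFamily P ℱ w) (hb : Summable fun z => |b z|)
    (hst : s ≤ t) {p : ℕ} (x : Fin p → Lattice d) :
    ∫⁻ ω, ∏ i, ENNReal.ofReal
        (Real.exp (noise b w s t (x i) ω - (t - s : ℝ≥0) * corr b 0 / 2)) ∂P =
      pointWeight (corr b) p (t - s : ℝ≥0) x := by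
  set v : ℝ := (t - s : ℝ≥0) * corr b 0 / 2
  have hprod : ∀ ω, ∏ i, ENNReal.ofReal (Real.exp (noise b w s t (x i) ω - v)) =
      ENNReal.ofReal (Real.exp (∑ i, noise b w s t (x i) ω - p * v)) := fun ω => by
    rw [← ENNReal.ofReal_prod_of_nonneg fun i _ => (Real.exp_pos _).le, ← Real.exp_sum,
      Finset.sum_sub_distrib, Finset.sum_const, Finset.card_univ, Fintype.card_fin, nsmul_eq_mul]
  simp only [hprod]
  rw [lintegral_ofReal_exp_gaussian (hasLaw_sum_noise hw hb hst x), pointWeight, NNReal.coe_mul,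
    Real.coe_toNNReal _ (sum_sum_corr_nonneg hb x), potential]
  congr 2
  ring

end Noise

section Scheme

variable {Ω : Type*} {mΩ : MeasurableSpace Ω} {d p : ℕ} {P : Measure Ω}
  {ℱ : Filtration ℝ≥0 mΩ} {w : Lattice d → ℝ≥0 → Ω → ℝ} {a b : Lattice d → ℝ}

/-- The `k`-th point of the time grid with step `h`. -/
def grid (h : ℝ≥0) (k : ℕ) : ℝ≥0 := k * h

lemma grid_mono (h : ℝ≥0) : Monotone (grid h) := fun i j hij => by
  unfold grid
  gcongr

lemma grid_succ_sub (h : ℝ≥0) (k : ℕ) : grid h (k + 1) - grid h k = h := by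
  simp [grid, add_mul]

/-- The multiplicative Euler scheme
`U_{k+1}(x) = exp(ΔW_k(x) - h B(0) / 2) ((1 + h ϰ ℒ) U_k)(x)`. Unlike the additive scheme it is
positive, so that it can take values in `[0, ∞]`. -/
def scheme (a b : Lattice d → ℝ) (ϰ : ℝ) (w : Lattice d → ℝ≥0 → Ω → ℝ) (h : ℝ≥0) :
    ℕ → Lattice d → Ω → ℝ≥0∞
  | 0 => fun _ _ => 1
  | k + 1 => fun x ω =>
      ENNReal.ofReal (Real.exp (noise b w (grid h k) (grid h (k + 1)) x ω - h * corr b 0 / 2)) *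
        avg (stepKernelE a (h * ϰ)) (fun y => scheme a b ϰ w h k y ω) x

lemma measurable_avg {α G : Type*} [Add G] [Countable G] {_ : MeasurableSpace α} (K : G → ℝ≥0∞)
    {F : G → α → ℝ≥0∞} (hF : ∀ x, Measurable (F x)) (x : G) :
    Measurable fun ω => avg K (fun y => F y ω) x :=
  Measurable.tsum fun _ => (hF _).const_mul _

lemma lintegral_avg {G : Type*} [Add G] [Countable G] (K : G → ℝ≥0∞) {F : G → Ω → ℝ≥0∞}
    (hF : ∀ x, AEMeasurable (F x) P) (x : G) :
    ∫⁻ ω, avg K (fun y => F y ω) x ∂P = avg K (fun y => ∫⁻ ω, F y ω ∂P) x := by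
  simp only [avg]
  rw [lintegral_tsum fun z => (hF _).const_mul _]
  exact tsum_congr fun z => lintegral_const_mul'' _ (hF _)

lemma measurable_scheme_filtration (hw : IsBrownianFamily P ℱ w) (ϰ : ℝ) (h : ℝ≥0) (k : ℕ)
    (x : Lattice d) : Measurable[ℱ (grid h k)] (scheme a b ϰ w h k x) := by
  induction k generalizing x with
  | zero => exact measurable_const
  | succ k ih =>
    have hle := grid_mono h k.le_succ
    have hnoise := measurable_noise_filtration (b := b) hw hle x
    exact ((hnoise.sub_const _).exp.ennreal_ofReal).mul
      (measurable_avg _ (fun y => (ih y).mono (ℱ.mono hle) le_rfl) x)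

lemma measurable_scheme (hw : IsBrownianFamily P ℱ w) (ϰ : ℝ) (h : ℝ≥0) (k : ℕ)
    (x : Lattice d) : Measurable (scheme a b ϰ w h k x) :=
  (measurable_scheme_filtration hw ϰ h k x).mono (ℱ.le _) le_rfl

lemma lintegral_prod_scheme (hw : IsBrownianFamily P ℱ w) (hb : Summable fun z => |b z|) (ϰ : ℝ)
    (h : ℝ≥0) (k : ℕ) (x : Fin p → Lattice d) :
    ∫⁻ ω, ∏ i, scheme a b ϰ w h k (x i) ω ∂P = discreteMoment a (corr b) ϰ p h k x := by
  induction k generalizing x with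
  | zero =>
    have hprob := hw.isProbabilityMeasure
    simp [scheme, discreteMoment, transferIter_zero]
  | succ k ih =>
    have hle := grid_mono h k.le_succ
    have hpast : Measurable[ℱ (grid h k)] fun ω =>
        ∏ i, avg (stepKernelE a (h * ϰ)) (fun y => scheme a b ϰ w h k y ω) (x i) :=
      Finset.measurable_fun_prod _ fun i _ =>
        measurable_avg _ (fun y => measurable_scheme_filtration hw ϰ h k y) (x i)
    have hnoise : Measurable[noiseSigma b w (grid h k) (grid h (k + 1))] fun ω =>
        ∏ i, ENNReal.ofReal
          (Real.exp (noise b w (grid h k) (grid h (k + 1)) (x i) ω - h * corr b 0 / 2)) :=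
      Finset.measurable_fun_prod _ fun i _ =>
        (((measurable_noise_noiseSigma b w _ _ (x i)).sub_const _).exp).ennreal_ofReal
    have hweight := lintegral_prod_exp_noise hw hb hle x
    rw [grid_succ_sub] at hweight
    simp only [scheme, Finset.prod_mul_distrib]
    rw [lintegral_mul_eq_lintegral_mul_lintegral_of_independent_measurableSpace
      (noiseSigma_le hw hle) (ℱ.le _) (indep_noise hw hle) hnoise hpast, hweight]
    simp only [prod_avg_eq_avg_powKernel]
    rw [lintegral_avg (F := fun (y : Fin p → Lattice d) ω => ∏ i, scheme a b ϰ w h k (y i) ω) _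
      (fun y => (Finset.measurable_fun_prod _ fun i _ =>
        measurable_scheme hw ϰ h k (y i)).aemeasurable),
      funext ih, discreteMoment, discreteMoment, transferIter_succ, transfer]

lemma lintegral_scheme_pow (hw : IsBrownianFamily P ℱ w) (hb : Summable fun z => |b z|) (ϰ : ℝ)
    (h : ℝ≥0) (k p : ℕ) (x : Lattice d) :
    ∫⁻ ω, scheme a b ϰ w h k x ω ^ p ∂P = discreteMoment a (corr b) ϰ p h k 0 := by
  rw [← discreteMoment_add_const a (corr b) ϰ h k 0 x, ← lintegral_prod_scheme hw hb]
  simp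

-- A fact about the transfer operator alone; it is Hölder's inequality once both sides are read as
-- moments of the scheme.
lemma discreteMoment_le_apply_zero (hw : IsBrownianFamily P ℱ w) (hb : Summable fun z => |b z|)
    (ϰ : ℝ) (h : ℝ≥0) (k : ℕ) (hp : p ≠ 0) (x : Fin p → Lattice d) :
    discreteMoment a (corr b) ϰ p h k x ≤ discreteMoment a (corr b) ϰ p h k 0 := by
  have hp' : (p : ℝ) ≠ 0 := Nat.cast_ne_zero.mpr hp
  have hholder := ENNReal.lintegral_prod_norm_pow_le (μ := P) (Finset.univ : Finset (Fin p))
    (f := fun i ω => scheme a b ϰ w h k (x i) ω ^ p) (p := fun _ => (p : ℝ)⁻¹)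
    (fun i _ => ((measurable_scheme hw ϰ h k _).pow_const p).aemeasurable)
    (by simp [hp']) (fun i _ => by positivity)
  simp only [lintegral_scheme_pow hw hb, Finset.prod_const, Finset.card_univ,
    Fintype.card_fin, ENNReal.pow_rpow_inv_natCast hp, ENNReal.rpow_inv_natCast_pow hp] at hholder
  rwa [← lintegral_prod_scheme hw hb]

lemma discreteMoment_add_le (hw : IsBrownianFamily P ℱ w) (hb : Summable fun z => |b z|) (ϰ : ℝ)
    (h : ℝ≥0) (hp : p ≠ 0) (m n : ℕ) :
    discreteMoment a (corr b) ϰ p h (m + n) 0 ≤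
      discreteMoment a (corr b) ϰ p h m 0 * discreteMoment a (corr b) ϰ p h n 0 := by
  rw [mul_comm]
  exact transferIter_add_le (discreteMoment_le_apply_zero hw hb ϰ h n hp) m 0

end Scheme

/-! ### Weighted second moments -/

section Energy

variable {Ω G : Type*} {mΩ : MeasurableSpace Ω} {P : Measure Ω} {μ : G → ℝ}

lemma sq_lintegral_le {g : Ω → ℝ≥0∞} (hg : AEMeasurable g P) :
    (∫⁻ ω, g ω ∂P) ^ 2 ≤ P Set.univ * ∫⁻ ω, g ω ^ 2 ∂P := by
  have h := ENNReal.lintegral_mul_le_Lp_mul_Lq P Real.HolderConjugate.two_two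
    (aemeasurable_const (b := (1 : ℝ≥0∞))) hg
  simp only [Pi.mul_apply, one_mul, ENNReal.one_rpow, lintegral_const] at h
  refine (pow_le_pow_left₀ zero_le h 2).trans_eq ?_
  simp only [mul_pow, ← ENNReal.rpow_mul_natCast]
  norm_num

lemma sq_avg_le [Add G] {K : G → ℝ≥0∞} (hK : ∑' z, K z = 1) (F : G → ℝ≥0∞) (x : G) :
    avg K F x ^ 2 ≤ avg K (fun y => F y ^ 2) x := by
  let _ : MeasurableSpace G := ⊤
  have h := sq_lintegral_le (P := Measure.count.withDensity K) (g := fun z => F (x + z))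
    Measurable.of_discrete.aemeasurable
  rwa [lintegral_withDensity_eq_lintegral_mul _ Measurable.of_discrete Measurable.of_discrete,
    lintegral_withDensity_eq_lintegral_mul _ Measurable.of_discrete Measurable.of_discrete,
    withDensity_apply _ MeasurableSet.univ, Measure.restrict_univ, lintegral_count,
    lintegral_count, lintegral_count, hK, one_mul] at h

/-- The weighted second moment `∑_x μ(x) ⟨f(x)²⟩` of a random field. -/
def energy (μ : G → ℝ) (P : Measure Ω) (f : G → Ω → ℝ) : ℝ≥0∞ :=
  ∑' x, ENNReal.ofReal (μ x) * ∫⁻ ω, ‖f x ω‖ₑ ^ 2 ∂P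

lemma ne_top_of_tsum_weight_ne_top {F : G → ℝ≥0∞} (hμ : ∀ x, 0 < μ x)
    (hF : ∑' x, ENNReal.ofReal (μ x) * F x ≠ ∞) (x : G) : F x ≠ ∞ := fun htop =>
  hF (ENNReal.tsum_eq_top_of_eq_top ⟨x, by
    rw [htop, ENNReal.mul_top (ENNReal.ofReal_pos.2 (hμ x)).ne']⟩)

lemma energy_congr {f g : G → Ω → ℝ} (h : ∀ x, f x =ᵐ[P] g x) :
    energy μ P f = energy μ P g := by
  refine tsum_congr fun x => congr_arg _ (lintegral_congr_ae ?_)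
  filter_upwards [h x] with ω hω
  rw [hω]

lemma energy_le_of_le {f g : G → Ω → ℝ} {c : ℝ≥0∞}
    (h : ∀ x, ∫⁻ ω, ‖f x ω‖ₑ ^ 2 ∂P ≤ c * ∫⁻ ω, ‖g x ω‖ₑ ^ 2 ∂P) :
    energy μ P f ≤ c * energy μ P g := by
  rw [energy, energy, ← ENNReal.tsum_mul_left]
  refine ENNReal.tsum_le_tsum fun x => ?_
  rw [mul_left_comm]
  gcongr
  exact h x

lemma energy_const_mul_le (c : ℝ≥0) (g : G → Ω → ℝ) :
    energy μ P (fun x ω => c * g x ω) ≤ (c ^ 2 : ℝ≥0) * energy μ P g := by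
  refine energy_le_of_le fun x => ?_
  simp only [enorm_mul, mul_pow]
  rw [lintegral_const_mul' _ _ (by simp)]
  simp [Real.enorm_of_nonneg (NNReal.coe_nonneg c)]

lemma energy_sub_comm (f g : G → Ω → ℝ) :
    energy μ P (fun x ω => f x ω - g x ω) = energy μ P (fun x ω => g x ω - f x ω) := by
  simp only [energy, enorm_sub_rev]

lemma enorm_add_sq_le {s : ℝ≥0} (hs : s ≠ 0) (y z : ℝ) :
    ‖y + z‖ₑ ^ 2 ≤ (1 + s : ℝ≥0) * ‖y‖ₑ ^ 2 + (1 + s⁻¹ : ℝ≥0) * ‖z‖ₑ ^ 2 := by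
  have h : ‖y + z‖₊ ^ 2 ≤ (1 + s) * ‖y‖₊ ^ 2 + (1 + s⁻¹) * ‖z‖₊ ^ 2 := by
    rw [← NNReal.coe_le_coe]
    push_cast
    simp only [Real.norm_eq_abs, sq_abs]
    have hsq : 0 ≤ (s : ℝ)⁻¹ * (s * y - z) ^ 2 := by positivity
    have hexpand :
        (s : ℝ)⁻¹ * (s * y - z) ^ 2 = s * y ^ 2 - 2 * y * z + (s : ℝ)⁻¹ * z ^ 2 := by
      field_simp
      ring
    linarith
  simp only [enorm_eq_nnnorm]
  exact_mod_cast h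

lemma energy_add_le {s : ℝ≥0} (hs : s ≠ 0) {f : G → Ω → ℝ} (g : G → Ω → ℝ)
    (hf : ∀ x, AEMeasurable (f x) P) :
    energy μ P (fun x ω => f x ω + g x ω) ≤
      (1 + s : ℝ≥0) * energy μ P f + (1 + s⁻¹ : ℝ≥0) * energy μ P g := by
  simp only [energy]
  rw [← ENNReal.tsum_mul_left, ← ENNReal.tsum_mul_left, ← ENNReal.tsum_add]
  refine ENNReal.tsum_le_tsum fun x => ?_
  rw [mul_left_comm, mul_left_comm _ (ENNReal.ofReal (μ x)), ← mul_add]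
  gcongr
  refine (lintegral_mono fun ω => enorm_add_sq_le hs (f x ω) (g x ω)).trans_eq ?_
  rw [lintegral_add_left' (((hf x).enorm.pow_const 2).const_mul _),
    lintegral_const_mul' _ _ ENNReal.coe_ne_top, lintegral_const_mul' _ _ ENNReal.coe_ne_top]

lemma lintegral_pow_le_liminf (q : ℕ) {f : ℕ → Ω → ℝ} {g : Ω → ℝ} (hf : ∀ n, AEMeasurable (f n) P)
    (h : TendstoInMeasure P f atTop g) :
    ∫⁻ ω, ‖g ω‖ₑ ^ q ∂P ≤ liminf (fun n => ∫⁻ ω, ‖f n ω‖ₑ ^ q ∂P) atTop := by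
  by_contra! hlt
  obtain ⟨c, hliminf_lt, hc_lt⟩ := exists_between hlt
  obtain ⟨φ, hφ, hφc⟩ := extraction_of_frequently_atTop
    (frequently_lt_of_liminf_lt (by isBoundedDefault) hliminf_lt)
  obtain ⟨ψ, -, hae⟩ := (h.comp hφ.tendsto_atTop).exists_seq_tendsto_ae
  refine hc_lt.not_ge ?_
  calc ∫⁻ ω, ‖g ω‖ₑ ^ q ∂P = ∫⁻ ω, liminf (fun k => ‖f (φ (ψ k)) ω‖ₑ ^ q) atTop ∂P := by
        refine lintegral_congr_ae ?_
        filter_upwards [hae] with ω hω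
        exact (((ENNReal.continuous_pow q).tendsto _).comp hω.enorm).liminf_eq.symm
    _ ≤ liminf (fun k => ∫⁻ ω, ‖f (φ (ψ k)) ω‖ₑ ^ q ∂P) atTop :=
        lintegral_liminf_le' fun k => (hf _).enorm.pow_const q
    _ ≤ liminf (fun _ : ℕ => c) atTop :=
        liminf_le_liminf (Eventually.of_forall fun k => (hφc _).le)
    _ = c := liminf_const c

lemma energy_le_of_tendstoInMeasure {f : ℕ → G → Ω → ℝ} {g : G → Ω → ℝ} {c : ℝ≥0∞}
    (hf : ∀ n x, AEMeasurable (f n x) P)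
    (h : ∀ x, TendstoInMeasure P (fun n => f n x) atTop (g x))
    (hc : ∀ n, energy μ P (f n) ≤ c) : energy μ P g ≤ c := by
  let _ : MeasurableSpace G := ⊤
  calc energy μ P g
      ≤ ∑' x, liminf (fun n => ENNReal.ofReal (μ x) * ∫⁻ ω, ‖f n x ω‖ₑ ^ 2 ∂P) atTop := by
        refine ENNReal.tsum_le_tsum fun x => ?_
        have hmono : Monotone fun y : ℝ≥0∞ => ENNReal.ofReal (μ x) * y :=
          fun y z hyz => mul_le_mul' le_rfl hyz
        refine (hmono (lintegral_pow_le_liminf 2 (fun n => hf n x) (h x))).trans_eq ?_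
        exact hmono.map_liminf_of_continuousAt _
          (ENNReal.continuous_const_mul ENNReal.ofReal_ne_top).continuousAt
    _ ≤ liminf (fun n => energy μ P (f n)) atTop := by
        simpa only [lintegral_count, energy] using lintegral_liminf_le (μ := Measure.count)
          (u := atTop) (f := fun (n : ℕ) x => ENNReal.ofReal (μ x) * ∫⁻ ω, ‖f n x ω‖ₑ ^ 2 ∂P)
          fun n => Measurable.of_discrete
    _ ≤ liminf (fun _ : ℕ => c) atTop := liminf_le_liminf (Eventually.of_forall hc)
    _ = c := liminf_const c

/-- `C` bounds the convolution operator with kernel `a` on the space with weight `μ`. -/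
def IsConvBound [Sub G] (a μ : G → ℝ) (C : ℝ≥0) : Prop :=
  ∀ y, ∑' z, ENNReal.ofReal (a z) * ENNReal.ofReal (μ (y - z)) ≤ C * ENNReal.ofReal (μ y)

lemma tsum_weight_avg [AddGroup G] (μ : G → ℝ) (K F : G → ℝ≥0∞) :
    ∑' x, ENNReal.ofReal (μ x) * avg K F x =
      ∑' y, (∑' z, K z * ENNReal.ofReal (μ (y - z))) * F y := by
  simp only [avg, ← ENNReal.tsum_mul_left, ← ENNReal.tsum_mul_right]
  rw [ENNReal.tsum_comm]
  conv_rhs => rw [ENNReal.tsum_comm]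
  refine tsum_congr fun z => ?_
  rw [← (Equiv.addRight z).tsum_eq (fun y => K z * ENNReal.ofReal (μ (y - z)) * F y)]
  refine tsum_congr fun x => ?_
  simp only [Equiv.coe_addRight, add_sub_cancel_right]
  ring

section AddCommGroup

variable [AddCommGroup G] {a : G → ℝ} {C τ : ℝ≥0}

lemma IsConvBound.tsum_weight_avg_le (hC : IsConvBound a μ C) (F : G → ℝ≥0∞) :
    ∑' x, ENNReal.ofReal (μ x) * avg (fun z => ENNReal.ofReal (a z)) F x ≤
      C * ∑' x, ENNReal.ofReal (μ x) * F x := by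
  rw [tsum_weight_avg, ← ENNReal.tsum_mul_left]
  refine ENNReal.tsum_le_tsum fun y => ?_
  rw [← mul_assoc]
  gcongr
  exact hC y

lemma IsConvBound.stepKernel (hC : IsConvBound a μ C) (τ : ℝ≥0) :
    IsConvBound (Anderson.stepKernel a τ) μ (1 + τ * C) := by
  classical
  intro y
  calc ∑' z, ENNReal.ofReal (Anderson.stepKernel a τ z) * ENNReal.ofReal (μ (y - z))
      ≤ ∑' z, ((if z = 0 then ENNReal.ofReal (μ y) else 0) +
          τ * (ENNReal.ofReal (a z) * ENNReal.ofReal (μ (y - z)))) := by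
        refine ENNReal.tsum_le_tsum fun z => ?_
        refine (mul_le_mul' ENNReal.ofReal_add_le le_rfl).trans ?_
        rw [add_mul, ENNReal.ofReal_mul (NNReal.coe_nonneg τ), ENNReal.ofReal_coe_nnreal, mul_assoc]
        gcongr
        rcases eq_or_ne z 0 with rfl | hz
        · simpa only [if_true, sub_zero] using mul_le_of_le_one_left' (by simp)
        · simp [hz]
    _ ≤ ENNReal.ofReal (μ y) + τ * (C * ENNReal.ofReal (μ y)) := by
        rw [ENNReal.tsum_add, ENNReal.tsum_mul_left, tsum_ite_eq]
        gcongr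
        exact hC y
    _ = (1 + τ * C : ℝ≥0) * ENNReal.ofReal (μ y) := by push_cast; ring

lemma enorm_stepAvg_le (ha : IsSymmetricKernel a) (h1 : τ ≤ 1) (f : G → ℝ) (x : G) :
    ‖stepAvg a τ f x‖ₑ ≤ avg (stepKernelE a τ) (fun y => ‖f y‖ₑ) x := by
  refine enorm_tsum_le_tsum_enorm.trans_eq (tsum_congr fun z => ?_)
  rw [enorm_mul, Real.enorm_of_nonneg ((ha.stepKernel τ.coe_nonneg h1).nonneg z), stepKernelE]

lemma energy_stepAvg_le [Countable G] (ha : IsSymmetricKernel a) (hC : IsConvBound a μ C)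
    (h1 : τ ≤ 1) {f : G → Ω → ℝ} (hf : ∀ x, AEMeasurable (f x) P) :
    energy μ P (fun x ω => stepAvg a τ (fun y => f y ω) x) ≤ (1 + τ * C : ℝ≥0) * energy μ P f := by
  refine (ENNReal.tsum_le_tsum fun x => ?_).trans ((hC.stepKernel τ).tsum_weight_avg_le _)
  gcongr
  calc ∫⁻ ω, ‖stepAvg a τ (fun y => f y ω) x‖ₑ ^ 2 ∂P
      ≤ ∫⁻ ω, avg (stepKernelE a τ) (fun y => ‖f y ω‖ₑ ^ 2) x ∂P := by
        refine lintegral_mono fun ω => ?_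
        exact (pow_le_pow_left₀ zero_le (enorm_stepAvg_le ha h1 _ x) 2).trans
          (sq_avg_le (tsum_stepKernelE ha τ.coe_nonneg h1) _ _)
    _ = avg (stepKernelE a τ) (fun y => ∫⁻ ω, ‖f y ω‖ₑ ^ 2 ∂P) x :=
        lintegral_avg _ (fun y => (hf y).enorm.pow_const 2) x

end AddCommGroup

section Lattice

variable {d : ℕ} {a μ : Lattice d → ℝ} {C : ℝ≥0}

lemma IsAdmissibleWeight.exists_isConvBound (ha : IsSymmetricKernel a)
    (hμ : IsAdmissibleWeight a μ) : ∃ C, IsConvBound a μ C := by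
  obtain ⟨C, hC⟩ := hμ.conv_le
  refine ⟨C.toNNReal, fun y => ?_⟩
  have hμ_le (x) : |μ x| ≤ ∑' z, μ z := by
    rw [abs_of_pos (hμ.pos x)]
    exact hμ.summable.le_tsum x fun _ _ => (hμ.pos _).le
  simp only [← ENNReal.ofReal_mul (ha.nonneg _)]
  rw [← ENNReal.ofReal_tsum_of_nonneg (fun z => mul_nonneg (ha.nonneg z) (hμ.pos _).le)
    (ha.summable_mul hμ_le fun z => y - z)]
  refine (ENNReal.ofReal_le_ofReal ((hC y).trans
    (mul_le_mul_of_nonneg_right (Real.le_coe_toNNReal C) (hμ.pos y).le))).trans_eq ?_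
  rw [ENNReal.ofReal_mul (NNReal.coe_nonneg _), ENNReal.ofReal_coe_nnreal]

lemma enorm_nonlocalLaplacian_sq_le (ha : IsSymmetricKernel a) (f : Lattice d → ℝ)
    (x : Lattice d) :
    ‖nonlocalLaplacian a f x‖ₑ ^ 2 ≤
      2 * avg (fun z => ENNReal.ofReal (a z)) (fun y => ‖f y‖ₑ ^ 2) x + 2 * ‖f x‖ₑ ^ 2 := by
  have hle_avg : ‖nonlocalLaplacian a f x‖ₑ ≤
      avg (fun z => ENNReal.ofReal (a z)) (fun y => ‖f y - f x‖ₑ) x := by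
    refine enorm_tsum_le_tsum_enorm.trans (ENNReal.tsum_le_tsum fun z => ?_)
    rw [enorm_mul, Real.enorm_of_nonneg (ha.nonneg z)]
  have hsub_sq (y) : ‖f y - f x‖ₑ ^ 2 ≤ 2 * ‖f y‖ₑ ^ 2 + 2 * ‖f x‖ₑ ^ 2 := by
    have := enorm_add_sq_le one_ne_zero (f y) (-f x)
    rw [enorm_neg, ← sub_eq_add_neg, inv_one, one_add_one_eq_two] at this
    exact_mod_cast this
  refine (pow_le_pow_left₀ zero_le hle_avg 2).trans ((sq_avg_le ha.tsum_ofReal _ _).trans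
    ((avg_mono hsub_sq x).trans_eq ?_))
  simp only [← avg_const_mul]
  simp only [avg, mul_add, ENNReal.tsum_add, ENNReal.tsum_mul_right, ha.tsum_ofReal, one_mul]

lemma energy_nonlocalLaplacian_le (ha : IsSymmetricKernel a) (hC : IsConvBound a μ C)
    {f : Lattice d → Ω → ℝ} (hf : ∀ x, AEMeasurable (f x) P) :
    energy μ P (fun x ω => nonlocalLaplacian a (fun y => f y ω) x) ≤
      (2 * (C + 1) : ℝ≥0) * energy μ P f := by
  calc energy μ P (fun x ω => nonlocalLaplacian a (fun y => f y ω) x)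
      ≤ ∑' x, ENNReal.ofReal (μ x) *
        (2 * avg (fun z => ENNReal.ofReal (a z)) (fun y => ∫⁻ ω, ‖f y ω‖ₑ ^ 2 ∂P) x +
          2 * ∫⁻ ω, ‖f x ω‖ₑ ^ 2 ∂P) := by
        refine ENNReal.tsum_le_tsum fun x => ?_
        gcongr
        refine (lintegral_mono fun ω => enorm_nonlocalLaplacian_sq_le ha _ x).trans_eq ?_
        rw [lintegral_add_right' _ (((hf x).enorm.pow_const 2).const_mul _),
          lintegral_const_mul' _ _ ENNReal.ofNat_ne_top,
          lintegral_const_mul' _ _ ENNReal.ofNat_ne_top,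
          lintegral_avg _ fun y => (hf y).enorm.pow_const 2]
    _ = 2 * ∑' x, ENNReal.ofReal (μ x) *
          avg (fun z => ENNReal.ofReal (a z)) (fun y => ∫⁻ ω, ‖f y ω‖ₑ ^ 2 ∂P) x +
          2 * energy μ P f := by
        simp only [mul_add, ENNReal.tsum_add, mul_left_comm _ (2 : ℝ≥0∞), ENNReal.tsum_mul_left,
          energy]
    _ ≤ 2 * (C * energy μ P f) + 2 * energy μ P f := by
        gcongr
        exact hC.tsum_weight_avg_le _
    _ = (2 * (C + 1) : ℝ≥0) * energy μ P f := by
        push_cast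
        ring

end Lattice

section TimeIntegral

variable [SFinite P] {f : ℝ → G → Ω → ℝ} {r t : ℝ} {K : ℝ≥0∞}

lemma lintegral_setLIntegral_sq_le [Countable G]
    (hf : ∀ x, Measurable fun q : ℝ × Ω => f q.1 x q.2)
    (hK : ∀ s ∈ Set.Ioc r t, energy μ P (f s) ≤ K) :
    ∑' x, ENNReal.ofReal (μ x) * ∫⁻ ω, (∫⁻ s in Set.Ioc r t, ‖f s x ω‖ₑ ^ 2) ∂P ≤
      ENNReal.ofReal (t - r) * K := by
  calc ∑' x, ENNReal.ofReal (μ x) * ∫⁻ ω, (∫⁻ s in Set.Ioc r t, ‖f s x ω‖ₑ ^ 2) ∂P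
      = ∑' x, ∫⁻ s in Set.Ioc r t, ENNReal.ofReal (μ x) * ∫⁻ ω, ‖f s x ω‖ₑ ^ 2 ∂P := by
        refine tsum_congr fun x => ?_
        rw [lintegral_const_mul' _ _ ENNReal.ofReal_ne_top, lintegral_lintegral_swap]
        exact ((hf x).comp measurable_swap).enorm.pow_const 2 |>.aemeasurable
    _ = ∫⁻ s in Set.Ioc r t, energy μ P (f s) :=
        (lintegral_tsum fun x =>
          (((hf x).enorm.pow_const 2).lintegral_prod_right'.const_mul _).aemeasurable).symm
    _ ≤ ∫⁻ _s in Set.Ioc r t, K := setLIntegral_mono measurable_const hK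
    _ = ENNReal.ofReal (t - r) * K := by rw [setLIntegral_const, Real.volume_Ioc, mul_comm]

lemma energy_integral_le [Countable G] (hf : ∀ x, Measurable fun q : ℝ × Ω => f q.1 x q.2)
    (hrt : r ≤ t) (hK : ∀ s ∈ Set.Ioc r t, energy μ P (f s) ≤ K) :
    energy μ P (fun x ω => ∫ s in r..t, f s x ω) ≤ ENNReal.ofReal (t - r) ^ 2 * K := by
  rw [sq, mul_assoc]
  refine le_trans ?_ (mul_le_mul' le_rfl (lintegral_setLIntegral_sq_le hf hK))
  rw [← ENNReal.tsum_mul_left]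
  refine ENNReal.tsum_le_tsum fun x => ?_
  rw [mul_left_comm]
  gcongr
  rw [← lintegral_const_mul' _ _ ENNReal.ofReal_ne_top]
  refine lintegral_mono fun ω => ?_
  beta_reduce
  rw [intervalIntegral.integral_of_le hrt]
  refine (pow_le_pow_left₀ zero_le (enorm_integral_le_lintegral_enorm _) 2).trans
    ((sq_lintegral_le ((hf x).comp measurable_prodMk_right).enorm.aemeasurable).trans_eq ?_)
  rw [Measure.restrict_apply_univ, Real.volume_Ioc]
  rfl

lemma ae_intervalIntegrable_of_energy_le [Countable G] (hμ : ∀ x, 0 < μ x)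
    (hf : ∀ x, Measurable fun q : ℝ × Ω => f q.1 x q.2) (hrt : r ≤ t) (hK_top : K ≠ ∞)
    (hK : ∀ s ∈ Set.Ioc r t, energy μ P (f s) ≤ K) (x : G) :
    ∀ᵐ ω ∂P, IntervalIntegrable (fun s => f s x ω) volume r t := by
  have hfin : ∫⁻ ω, (∫⁻ s in Set.Ioc r t, ‖f s x ω‖ₑ ^ 2) ∂P ≠ ∞ :=
    ne_top_of_tsum_weight_ne_top hμ ((lintegral_setLIntegral_sq_le hf hK).trans_lt
      (ENNReal.mul_lt_top ENNReal.ofReal_lt_top hK_top.lt_top)).ne x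
  have hmeas : Measurable fun ω => ∫⁻ s in Set.Ioc r t, ‖f s x ω‖ₑ ^ 2 :=
    (((hf x).comp measurable_swap).enorm.pow_const 2).lintegral_prod_right'
  filter_upwards [ae_lt_top hmeas hfin] with ω hω
  rw [intervalIntegrable_iff_integrableOn_Ioc_of_le hrt]
  have hpath : Measurable fun s => f s x ω := (hf x).comp measurable_prodMk_right
  have hsq := sq_lintegral_le (P := volume.restrict (Set.Ioc r t)) hpath.enorm.aemeasurable
  rw [Measure.restrict_apply_univ, Real.volume_Ioc] at hsq
  exact ⟨hpath.aestronglyMeasurable, (ENNReal.pow_lt_top_iff.1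
    (hsq.trans_lt (ENNReal.mul_lt_top ENNReal.ofReal_lt_top hω))).resolve_right two_ne_zero⟩

end TimeIntegral

end Energy

/-! ### Square-integrable martingale differences -/

section Centered

variable {Ω : Type*} {mΩ : MeasurableSpace Ω} {P : Measure Ω}

lemma lintegral_enorm_sq_eq_ofReal {f : Ω → ℝ} (hf : MemLp f 2 P) :
    ∫⁻ ω, ‖f ω‖ₑ ^ 2 ∂P = ENNReal.ofReal (∫ ω, f ω ^ 2 ∂P) := by
  rw [ofReal_integral_eq_lintegral_ofReal hf.integrable_sq (ae_of_all _ fun ω => sq_nonneg _)]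
  refine lintegral_congr fun ω => ?_
  rw [← sq_abs, ENNReal.ofReal_pow (abs_nonneg _), ← Real.norm_eq_abs, ofReal_norm]

lemma memLp_two_iff_lintegral_enorm_sq {f : Ω → ℝ} (hf : AEStronglyMeasurable f P) :
    MemLp f 2 P ↔ ∫⁻ ω, ‖f ω‖ₑ ^ 2 ∂P ≠ ∞ := by
  rw [MemLp, and_iff_right hf,
    eLpNorm_lt_top_iff_lintegral_rpow_enorm_lt_top two_ne_zero ENNReal.ofNat_ne_top,
    ← lt_top_iff_ne_top]
  simp

/-- `A` is square integrable and orthogonal to the square-integrable `m`-measurable variables.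
For a probability measure this says that `A` has conditional expectation `0` given `m`. -/
structure IsCentered (P : Measure Ω) (m : MeasurableSpace Ω) (A : Ω → ℝ) : Prop where
  memLp : MemLp A 2 P
  orth : ∀ Z : Ω → ℝ, MemLp Z 2 P → Measurable[m] Z → ∫ ω, Z ω * A ω ∂P = 0

variable {m m' : MeasurableSpace Ω} {A A' Y Z ξ : Ω → ℝ}

lemma IsCentered.zero (m : MeasurableSpace Ω) : IsCentered P m fun _ => 0 :=
  ⟨MemLp.zero', fun Z _ _ => by simp⟩

lemma IsCentered.add (hA : IsCentered P m A) (hA' : IsCentered P m A') :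
    IsCentered P m fun ω => A ω + A' ω := by
  refine ⟨hA.memLp.add hA'.memLp, fun Z hZ hZm => ?_⟩
  have hint : Integrable (fun ω => Z ω * A ω) P := hZ.integrable_mul hA.memLp
  have hint' : Integrable (fun ω => Z ω * A' ω) P := hZ.integrable_mul hA'.memLp
  simp only [mul_add]
  rw [integral_add hint hint', hA.orth Z hZ hZm,
    hA'.orth Z hZ hZm, add_zero]

lemma IsCentered.neg (hA : IsCentered P m A) : IsCentered P m fun ω => -A ω :=
  ⟨hA.memLp.neg, fun Z hZ hZm => by
    simp only [mul_neg, integral_neg, hA.orth Z hZ hZm, neg_zero]⟩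

lemma IsCentered.sub (hA : IsCentered P m A) (hA' : IsCentered P m A') :
    IsCentered P m fun ω => A ω - A' ω := by
  simpa only [sub_eq_add_neg] using hA.add hA'.neg

lemma IsCentered.sum {ι : Type*} {F : Finset ι} {A : ι → Ω → ℝ}
    (hA : ∀ i ∈ F, IsCentered P m (A i)) : IsCentered P m fun ω => ∑ i ∈ F, A i ω := by
  classical
  induction F using Finset.induction_on with
  | empty => exact IsCentered.zero m
  | insert i F hi ih =>
    simp only [Finset.sum_insert hi]
    exact (hA i (F.mem_insert_self i)).add (ih fun j hj => hA j (Finset.mem_insert_of_mem hj))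

lemma IsCentered.mono (hA : IsCentered P m A) (h : m' ≤ m) : IsCentered P m' A :=
  ⟨hA.memLp, fun Z hZ hZm => hA.orth Z hZ (hZm.mono h le_rfl)⟩

lemma IsCentered.lintegral_add_sq (hA : IsCentered P m A) (hZ : MemLp Z 2 P)
    (hZm : Measurable[m] Z) :
    ∫⁻ ω, ‖Z ω + A ω‖ₑ ^ 2 ∂P = ∫⁻ ω, ‖Z ω‖ₑ ^ 2 ∂P + ∫⁻ ω, ‖A ω‖ₑ ^ 2 ∂P := by
  have hcross : Integrable (fun ω => Z ω * A ω) P := hZ.integrable_mul hA.memLp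
  have hsum : Integrable (fun ω => Z ω ^ 2 + 2 * (Z ω * A ω)) P :=
    hZ.integrable_sq.add (hcross.const_mul 2)
  have hexpand : ∀ ω, (Z ω + A ω) ^ 2 = Z ω ^ 2 + 2 * (Z ω * A ω) + A ω ^ 2 := fun ω => by ring
  rw [lintegral_enorm_sq_eq_ofReal (f := fun ω => Z ω + A ω) (hZ.add hA.memLp),
    lintegral_enorm_sq_eq_ofReal hZ, lintegral_enorm_sq_eq_ofReal hA.memLp,
    ← ENNReal.ofReal_add (integral_nonneg fun ω => sq_nonneg _)
      (integral_nonneg fun ω => sq_nonneg _)]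
  simp only [hexpand]
  rw [integral_add hsum hA.memLp.integrable_sq,
    integral_add hZ.integrable_sq (hcross.const_mul 2), integral_const_mul, hA.orth Z hZ hZm,
    mul_zero, add_zero]

lemma lintegral_mul_sq_of_indep (hm : m ≤ mΩ) (hm' : m' ≤ mΩ) (hind : Indep m' m P)
    (hYm : Measurable[m] Y) (hξm : Measurable[m'] ξ) :
    ∫⁻ ω, ‖Y ω * ξ ω‖ₑ ^ 2 ∂P = (∫⁻ ω, ‖ξ ω‖ₑ ^ 2 ∂P) * ∫⁻ ω, ‖Y ω‖ₑ ^ 2 ∂P := by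
  simp only [enorm_mul, mul_pow, mul_comm ‖Y _‖ₑ]
  exact lintegral_mul_eq_lintegral_mul_lintegral_of_independent_measurableSpace hm' hm hind
    ((measurable_enorm.comp hξm).pow_const 2) ((measurable_enorm.comp hYm).pow_const 2)

lemma isCentered_mul_of_indep (hm : m ≤ mΩ) (hm' : m' ≤ mΩ) (hind : Indep m' m P)
    (hY : MemLp Y 2 P) (hYm : Measurable[m] Y) (hξ : MemLp ξ 2 P) (hξm : Measurable[m'] ξ)
    (hξ_mean : ∫ ω, ξ ω ∂P = 0) : IsCentered P m fun ω => Y ω * ξ ω := by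
  refine ⟨(memLp_two_iff_lintegral_enorm_sq (f := fun ω => Y ω * ξ ω) (hY.1.mul hξ.1)).2 ?_,
    fun Z hZ hZm => ?_⟩
  · rw [lintegral_mul_sq_of_indep hm hm' hind hYm hξm]
    exact ENNReal.mul_ne_top ((memLp_two_iff_lintegral_enorm_sq hξ.1).1 hξ)
      ((memLp_two_iff_lintegral_enorm_sq hY.1).1 hY)
  · have hindep : IndepFun (fun ω => Z ω * Y ω) ξ P := by
      rw [IndepFun_iff_Indep]
      exact indep_of_indep_of_le_left (indep_of_indep_of_le_right hind.symm hξm.comap_le)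
        (hZm.mul hYm).comap_le
    simp only [← mul_assoc]
    rw [hindep.integral_fun_mul_eq_mul_integral (hZ.1.mul hY.1) hξ.1, hξ_mean, mul_zero]

end Centered

section NoiseIsometry

variable {Ω : Type*} {mΩ : MeasurableSpace Ω} {d : ℕ} {P : Measure Ω}
  {ℱ : Filtration ℝ≥0 mΩ} {w : Lattice d → ℝ≥0 → Ω → ℝ} {b : Lattice d → ℝ}
  {s t h : ℝ≥0} {i j : ℕ} {Y : Ω → ℝ}

lemma isCentered_mul_noise (hw : IsBrownianFamily P ℱ w) (hb : Summable fun z => |b z|)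
    (hst : s ≤ t) (x : Lattice d) (hY : MemLp Y 2 P) (hYm : Measurable[ℱ s] Y) :
    IsCentered P (ℱ s) fun ω => Y ω * noise b w s t x ω :=
  have hlaw := hasLaw_noise hw hb hst x
  isCentered_mul_of_indep (ℱ.le s) (noiseSigma_le hw hst) (indep_noise hw hst) hY hYm
    (memLp_gaussian hlaw 2) (measurable_noise_noiseSigma b w s t x) (integral_gaussian hlaw)

lemma lintegral_mul_noise_sq (hw : IsBrownianFamily P ℱ w) (hb : Summable fun z => |b z|)
    (hst : s ≤ t) (x : Lattice d) (hYm : Measurable[ℱ s] Y) :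
    ∫⁻ ω, ‖Y ω * noise b w s t x ω‖ₑ ^ 2 ∂P =
      ((t - s) * noiseVar b : ℝ≥0) * ∫⁻ ω, ‖Y ω‖ₑ ^ 2 ∂P := by
  have hlaw := hasLaw_noise hw hb hst x
  rw [lintegral_mul_sq_of_indep (ℱ.le s) (noiseSigma_le hw hst) (indep_noise hw hst) hYm
    (measurable_noise_noiseSigma b w s t x), lintegral_enorm_sq_eq_ofReal (memLp_gaussian hlaw 2),
    integral_sq_gaussian hlaw, ENNReal.ofReal_coe_nnreal]

/-- The part `exp(ΔW(x) - (t - s) B(0) / 2) - 1 - ΔW(x)` of the multiplicative noise factor of the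
Euler scheme which is not linear in the noise increment `ΔW(x)` over `[s, t]`. -/
def expRemainder (b : Lattice d → ℝ) (w : Lattice d → ℝ≥0 → Ω → ℝ) (s t : ℝ≥0) (x : Lattice d)
    (ω : Ω) : ℝ :=
  Real.exp (noise b w s t x ω - ((t - s) * noiseVar b : ℝ≥0) / 2) - 1 - noise b w s t x ω

lemma measurable_expRemainder (b : Lattice d → ℝ) (w : Lattice d → ℝ≥0 → Ω → ℝ) (s t : ℝ≥0)
    (x : Lattice d) : Measurable[noiseSigma b w s t] (expRemainder b w s t x) :=
  have hnoise := measurable_noise_noiseSigma b w s t x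
  ((hnoise.sub_const _).exp.sub_const _).sub hnoise

lemma isCentered_mul_expRemainder (hw : IsBrownianFamily P ℱ w) (hb : Summable fun z => |b z|)
    (hst : s ≤ t) (x : Lattice d) (hY : MemLp Y 2 P) (hYm : Measurable[ℱ s] Y) :
    IsCentered P (ℱ s) fun ω => Y ω * expRemainder b w s t x ω :=
  have hlaw := hasLaw_noise hw hb hst x
  isCentered_mul_of_indep (ℱ.le s) (noiseSigma_le hw hst) (indep_noise hw hst) hY hYm
    (memLp_two_exp_sub_one_sub_gaussian hlaw _) (measurable_expRemainder b w s t x)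
    (integral_exp_sub_one_sub_gaussian hlaw)

lemma lintegral_mul_expRemainder_sq_le (hw : IsBrownianFamily P ℱ w)
    (hb : Summable fun z => |b z|) (hst : s ≤ t) (hsmall : (t - s) * noiseVar b ≤ 1)
    (x : Lattice d) (hYm : Measurable[ℱ s] Y) :
    ∫⁻ ω, ‖Y ω * expRemainder b w s t x ω‖ₑ ^ 2 ∂P ≤
      (((t - s) * noiseVar b) ^ 2 : ℝ≥0) * ∫⁻ ω, ‖Y ω‖ₑ ^ 2 ∂P := by
  have hlaw := hasLaw_noise hw hb hst x
  rw [lintegral_mul_sq_of_indep (ℱ.le s) (noiseSigma_le hw hst) (indep_noise hw hst) hYm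
    (measurable_expRemainder b w s t x)]
  gcongr
  simp only [expRemainder]
  rw [lintegral_enorm_sq_eq_ofReal (memLp_two_exp_sub_one_sub_gaussian hlaw _)]
  refine (ENNReal.ofReal_le_ofReal
    (integral_exp_sub_one_sub_sq_gaussian_le hlaw hsmall)).trans_eq ?_
  rw [← NNReal.coe_pow, ENNReal.ofReal_coe_nnreal]

variable {V : ℕ → Ω → ℝ}

lemma measurable_sum_noise (hw : IsBrownianFamily P ℱ w) (x : Lattice d)
    (hVm : ∀ k, i ≤ k → k < j → Measurable[ℱ (grid h k)] (V k)) :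
    Measurable[ℱ (grid h j)] fun ω =>
      ∑ k ∈ Finset.Ico i j, V k ω * noise b w (grid h k) (grid h (k + 1)) x ω := by
  refine Finset.measurable_fun_sum _ fun k hk => ?_
  obtain ⟨hik, hkj⟩ := Finset.mem_Ico.1 hk
  exact ((hVm k hik hkj).mono (ℱ.mono (grid_mono h hkj.le)) le_rfl).mul
    ((measurable_noise_filtration hw (grid_mono h k.le_succ) x).mono
      (ℱ.mono (grid_mono h hkj)) le_rfl)

lemma isCentered_sum_noise (hw : IsBrownianFamily P ℱ w) (hb : Summable fun z => |b z|)
    (x : Lattice d) (hV : ∀ k, i ≤ k → k < j → MemLp (V k) 2 P)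
    (hVm : ∀ k, i ≤ k → k < j → Measurable[ℱ (grid h k)] (V k)) :
    IsCentered P (ℱ (grid h i)) fun ω =>
      ∑ k ∈ Finset.Ico i j, V k ω * noise b w (grid h k) (grid h (k + 1)) x ω := by
  refine IsCentered.sum fun k hk => ?_
  obtain ⟨hik, hkj⟩ := Finset.mem_Ico.1 hk
  exact (isCentered_mul_noise hw hb (grid_mono h k.le_succ) x (hV k hik hkj) (hVm k hik hkj)).mono
    (ℱ.mono (grid_mono h hik))

lemma lintegral_sum_noise_sq (hw : IsBrownianFamily P ℱ w) (hb : Summable fun z => |b z|)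
    (x : Lattice d) (hV : ∀ k, i ≤ k → k < j → MemLp (V k) 2 P)
    (hVm : ∀ k, i ≤ k → k < j → Measurable[ℱ (grid h k)] (V k)) :
    ∫⁻ ω, ‖∑ k ∈ Finset.Ico i j, V k ω * noise b w (grid h k) (grid h (k + 1)) x ω‖ₑ ^ 2 ∂P =
      (h * noiseVar b : ℝ≥0) * ∑ k ∈ Finset.Ico i j, ∫⁻ ω, ‖V k ω‖ₑ ^ 2 ∂P := by
  rcases lt_or_ge j i with hji | hij
  · simp [Finset.Ico_eq_empty_of_le hji.le]
  induction j, hij using Nat.le_induction with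
  | base => simp
  | succ j hij ih =>
    have hV' (k) (hik : i ≤ k) (hkj : k < j) := hV k hik (hkj.trans j.lt_succ_self)
    have hVm' (k) (hik : i ≤ k) (hkj : k < j) := hVm k hik (hkj.trans j.lt_succ_self)
    have hlast := hVm j hij j.lt_succ_self
    have hle := grid_mono h j.le_succ
    simp only [Finset.sum_Ico_succ_top hij]
    rw [(isCentered_mul_noise hw hb hle x (hV j hij j.lt_succ_self) hlast).lintegral_add_sq
        (isCentered_sum_noise hw hb x hV' hVm').memLp (measurable_sum_noise hw x hVm'),
      ih hV' hVm', lintegral_mul_noise_sq hw hb hle x hlast, grid_succ_sub, mul_add]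

lemma energy_sum_noise (hw : IsBrownianFamily P ℱ w) (hb : Summable fun z => |b z|)
    (μ : Lattice d → ℝ) {V : ℕ → Lattice d → Ω → ℝ}
    (hV : ∀ k, i ≤ k → k < j → ∀ x, MemLp (V k x) 2 P)
    (hVm : ∀ k, i ≤ k → k < j → ∀ x, Measurable[ℱ (grid h k)] (V k x)) :
    energy μ P (fun x ω =>
      ∑ k ∈ Finset.Ico i j, V k x ω * noise b w (grid h k) (grid h (k + 1)) x ω) =
      (h * noiseVar b : ℝ≥0) * ∑ k ∈ Finset.Ico i j, energy μ P (V k) := by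
  simp only [energy]
  rw [← Summable.tsum_finsetSum fun _ _ => ENNReal.summable, ← ENNReal.tsum_mul_left]
  refine tsum_congr fun x => ?_
  rw [lintegral_sum_noise_sq hw hb x (fun k hik hkj => hV k hik hkj x)
    (fun k hik hkj => hVm k hik hkj x), ← Finset.mul_sum, mul_left_comm]

lemma ae_sum_noise (hw : IsBrownianFamily P ℱ w) (hb : Summable fun z => |b z|) (h : ℝ≥0)
    (x : Lattice d) (hij : i ≤ j) :
    ∀ᵐ ω ∂P, ∑ k ∈ Finset.Ico i j, noise b w (grid h k) (grid h (k + 1)) x ω =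
      noise b w (grid h i) (grid h j) x ω := by
  filter_upwards [ae_all_iff.2 fun k => ae_corrWiener_sub hw hb (grid h k) (grid h (k + 1)) x,
    ae_corrWiener_sub hw hb (grid h i) (grid h j) x] with ω hsteps htotal
  rw [← htotal, ← Finset.sum_Ico_sub (fun k => corrWiener b w x (grid h k) ω) hij]
  exact Finset.sum_congr rfl fun k _ => (hsteps k).symm

end NoiseIsometry

/-! ### Regularity of solutions -/

section Modification

variable {Ω : Type*} {mΩ : MeasurableSpace Ω} {P : Measure Ω}

lemma tendstoInMeasure_sub {ι E : Type*} [SeminormedAddCommGroup E] {l : Filter ι}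
    {f g : ι → Ω → E} {F G : Ω → E} (hf : TendstoInMeasure P f l F)
    (hg : TendstoInMeasure P g l G) :
    TendstoInMeasure P (fun n ω => f n ω - g n ω) l (fun ω => F ω - G ω) := by
  rw [tendstoInMeasure_iff_norm] at *
  intro ε hε
  have hsum := (hf (ε / 2) (by positivity)).add (hg (ε / 2) (by positivity))
  rw [add_zero] at hsum
  refine tendsto_of_tendsto_of_tendsto_of_le_of_le tendsto_const_nhds hsum (fun _ => zero_le)
    fun n => (measure_mono fun ω hω => ?_).trans (measure_union_le _ _)
  by_contra hsmall
  simp only [Set.mem_union, Set.mem_ofPred_eq, not_or, not_le] at hsmall hω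
  have htriangle : ‖f n ω - g n ω - (F ω - G ω)‖ ≤ ‖f n ω - F ω‖ + ‖g n ω - G ω‖ := by
    rw [sub_sub_sub_comm]
    exact norm_sub_le _ _
  linarith [hsmall.1, hsmall.2]

lemma tendstoInMeasure_const {ι E : Type*} [PseudoEMetricSpace E] (l : Filter ι) (F : Ω → E) :
    TendstoInMeasure P (fun _ => F) l F := fun ε hε => by
  simp [hε.not_ge, tendsto_const_nhds]

lemma exists_continuous_modification {S G : Type*} [Countable G] [TopologicalSpace S]
    [TopologicalSpace.MetrizableSpace S] [SecondCountableTopology S] [MeasurableSpace S]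
    [OpensMeasurableSpace S] {f : S → G → Ω → ℝ} (hfm : ∀ t x, Measurable (f t x))
    (hfc : ∀ x, ∀ᵐ ω ∂P, Continuous fun t => f t x ω) :
    ∃ g : S → G → Ω → ℝ, (∀ x, Measurable fun q : S × Ω => g q.1 x q.2) ∧
      ∀ᵐ ω ∂P, ∀ t x, f t x ω = g t x ω := by
  obtain ⟨N, hN, hNm, hN0⟩ := exists_measurable_superset_of_null (ae_iff.1 (ae_all_iff.2 hfc))
  refine ⟨fun t x => Nᶜ.indicator (f t x), fun x => ?_, ?_⟩
  · refine measurable_uncurry_of_continuous_of_measurable (u := fun t => Nᶜ.indicator (f t x))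
      (fun ω => ?_) fun t => (hfm t x).indicator hNm.compl
    by_cases hω : ω ∈ N
    · simpa [hω] using continuous_const
    · have hcont : ∀ x, Continuous fun t => f t x ω := by
        by_contra hc
        exact hω (hN hc)
      simpa [hω] using hcont x
  · filter_upwards [measure_eq_zero_iff_ae_notMem.1 hN0] with ω hω t x
    simp [hω]

end Modification

section Drift

variable {Ω : Type*} {mΩ : MeasurableSpace Ω} {P : Measure Ω} {d : ℕ} {a μ : Lattice d → ℝ}
  {κ C K r t : ℝ≥0} {f : ℝ≥0 → Lattice d → Ω → ℝ}

/-- The drift `∫_r^t ϰ ℒ f(s, x) ds`. -/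
def drift (a : Lattice d → ℝ) (κ : ℝ≥0) (f : ℝ≥0 → Lattice d → Ω → ℝ) (r t : ℝ≥0)
    (x : Lattice d) (ω : Ω) : ℝ :=
  ∫ s in (r : ℝ)..t, κ * nonlocalLaplacian a (fun y => f s.toNNReal y ω) x

lemma measurable_nonlocalLaplacian (a : Lattice d → ℝ) {g : Lattice d → Ω → ℝ}
    (hg : ∀ x, Measurable (g x)) (x : Lattice d) :
    Measurable fun ω => nonlocalLaplacian a (fun y => g y ω) x :=
  Measurable.tsum fun _ => ((hg _).sub (hg _)).const_mul _

lemma energy_const_mul_nonlocalLaplacian_le (ha : IsSymmetricKernel a) (hC : IsConvBound a μ C)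
    (κ : ℝ≥0) {g : Lattice d → Ω → ℝ} (hg : ∀ x, AEMeasurable (g x) P) :
    energy μ P (fun x ω => κ * nonlocalLaplacian a (fun y => g y ω) x) ≤
      (κ ^ 2 * (2 * (C + 1)) : ℝ≥0) * energy μ P g := by
  refine (energy_const_mul_le _ _).trans ?_
  rw [ENNReal.coe_mul, mul_assoc]
  gcongr
  exact energy_nonlocalLaplacian_le ha hC hg

lemma exists_measurable_drift_integrand (ha : IsSymmetricKernel a) (hC : IsConvBound a μ C)
    (κ : ℝ≥0) (hfm : ∀ s x, Measurable (f s x))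
    (hfc : ∀ x, ∀ᵐ ω ∂P, Continuous fun s => f s x ω)
    (hK : ∀ s ∈ Set.Icc r t, energy μ P (f s) ≤ K) :
    ∃ g : ℝ → Lattice d → Ω → ℝ, (∀ x, Measurable fun q : ℝ × Ω => g q.1 x q.2) ∧
      (∀ᵐ ω ∂P, ∀ x s, κ * nonlocalLaplacian a (fun y => f s.toNNReal y ω) x = g s x ω) ∧
      ∀ s ∈ Set.Ioc (r : ℝ) t, energy μ P (g s) ≤ (κ ^ 2 * (2 * (C + 1)) * K : ℝ≥0) := by
  obtain ⟨v, hvm, hvf⟩ := exists_continuous_modification hfm hfc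
  refine ⟨fun s x ω => κ * nonlocalLaplacian a (fun y => v s.toNNReal y ω) x, fun x => ?_, ?_,
    fun s hs => ?_⟩
  · exact (measurable_nonlocalLaplacian a (g := fun y (q : ℝ × Ω) => v q.1.toNNReal y q.2)
      (fun y => (hvm y).comp (measurable_fst.real_toNNReal.prodMk measurable_snd)) x).const_mul _
  · filter_upwards [hvf] with ω hω x s
    simp only [hω]
  · have hvsm (x) : Measurable (v s.toNNReal x) := (hvm x).comp measurable_prodMk_left
    have hvs : energy μ P (v s.toNNReal) = energy μ P (f s.toNNReal) := energy_congr fun x => by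
      filter_upwards [hvf] with ω hω using (hω _ x).symm
    refine (energy_const_mul_nonlocalLaplacian_le ha hC κ fun x => (hvsm x).aemeasurable).trans ?_
    rw [ENNReal.coe_mul _ K, hvs]
    gcongr
    exact hK _ ⟨NNReal.le_toNNReal_of_coe_le hs.1.le, Real.toNNReal_le_iff_le_coe.2 hs.2⟩

lemma ae_intervalIntegrable_drift [SFinite P] (ha : IsSymmetricKernel a)
    (hC : IsConvBound a μ C) (hμ : ∀ x, 0 < μ x) (κ : ℝ≥0) (hfm : ∀ s x, Measurable (f s x))
    (hfc : ∀ x, ∀ᵐ ω ∂P, Continuous fun s => f s x ω) (hrt : r ≤ t)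
    (hK : ∀ s ∈ Set.Icc r t, energy μ P (f s) ≤ K) (x : Lattice d) :
    ∀ᵐ ω ∂P, IntervalIntegrable
      (fun s : ℝ => κ * nonlocalLaplacian a (fun y => f s.toNNReal y ω) x) volume r t := by
  obtain ⟨g, hgm, hfg, hgK⟩ := exists_measurable_drift_integrand ha hC κ hfm hfc hK
  filter_upwards [hfg, ae_intervalIntegrable_of_energy_le hμ hgm (NNReal.coe_le_coe.2 hrt)
    ENNReal.coe_ne_top hgK x] with ω hω hint
  rwa [funext (hω x)]

lemma energy_drift_le [SFinite P] (ha : IsSymmetricKernel a) (hC : IsConvBound a μ C)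
    (κ : ℝ≥0) (hfm : ∀ s x, Measurable (f s x))
    (hfc : ∀ x, ∀ᵐ ω ∂P, Continuous fun s => f s x ω) (hrt : r ≤ t)
    (hK : ∀ s ∈ Set.Icc r t, energy μ P (f s) ≤ K) :
    energy μ P (drift a κ f r t) ≤ ((t - r) ^ 2 * (κ ^ 2 * (2 * (C + 1)) * K) : ℝ≥0) := by
  obtain ⟨g, hgm, hfg, hgK⟩ := exists_measurable_drift_integrand ha hC κ hfm hfc hK
  calc energy μ P (drift a κ f r t)
      = energy μ P (fun x ω => ∫ s in (r : ℝ)..t, g s x ω) := energy_congr fun x => by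
        filter_upwards [hfg] with ω hω
        rw [drift, funext (hω x)]
    _ ≤ ENNReal.ofReal (t - r) ^ 2 * (κ ^ 2 * (2 * (C + 1)) * K : ℝ≥0) :=
        energy_integral_le hgm (NNReal.coe_le_coe.2 hrt) hgK
    _ = ((t - r) ^ 2 * (κ ^ 2 * (2 * (C + 1)) * K) : ℝ≥0) := by
        rw [← NNReal.coe_sub hrt, ENNReal.ofReal_coe_nnreal]
        push_cast
        rfl

end Drift

section RiemannSum

variable {Ω : Type*} {mΩ : MeasurableSpace Ω} {P : Measure Ω} {d : ℕ}
  {ℱ : Filtration ℝ≥0 mΩ} {w : Lattice d → ℝ≥0 → Ω → ℝ} {b μ : Lattice d → ℝ}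
  {f : ℝ≥0 → Lattice d → Ω → ℝ} {h K : ℝ≥0} {i j m k : ℕ}

lemma grid_div (h : ℝ≥0) (hm : m ≠ 0) (k : ℕ) : grid (h / m) (k * m) = grid h k := by
  have hm' : (m : ℝ≥0) ≠ 0 := Nat.cast_ne_zero.2 hm
  simp only [grid, Nat.cast_mul]
  field_simp

lemma grid_div_mem_Icc (hm : m ≠ 0) (hik : i * m ≤ k) (hkj : k ≤ j * m) :
    grid (h / m) k ∈ Set.Icc (grid h i) (grid h j) := by
  rw [← grid_div h hm i, ← grid_div h hm j]
  exact ⟨grid_mono _ hik, grid_mono _ hkj⟩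

/-- The left-endpoint Riemann sums for the stochastic integral `∫ f dW` over `[i h, j h]`, on the
grid of mesh `h / m`. -/
def riemannSum (b : Lattice d → ℝ) (w : Lattice d → ℝ≥0 → Ω → ℝ) (f : ℝ≥0 → Lattice d → Ω → ℝ)
    (h : ℝ≥0) (i j m : ℕ) (x : Lattice d) (ω : Ω) : ℝ :=
  ∑ k ∈ Finset.Ico (i * m) (j * m), f (grid (h / m) k) x ω *
    noise b w (grid (h / m) k) (grid (h / m) (k + 1)) x ω

lemma riemannSum_zero_right (b : Lattice d → ℝ) (w : Lattice d → ℝ≥0 → Ω → ℝ)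
    (f : ℝ≥0 → Lattice d → Ω → ℝ) (h : ℝ≥0) (i j : ℕ) (x : Lattice d) :
    riemannSum b w f h i j 0 x = fun _ => 0 := by
  ext ω
  simp [riemannSum]

lemma measurable_riemannSum (hw : IsBrownianFamily P ℱ w)
    (hfm : ∀ s x, Measurable (f s x)) (h : ℝ≥0) (i j m : ℕ) (x : Lattice d) :
    Measurable (riemannSum b w f h i j m x) :=
  Finset.measurable_fun_sum _ fun k _ => (hfm _ x).mul
    ((measurable_noise_filtration hw (grid_mono _ k.le_succ) x).mono (ℱ.le _) le_rfl)

lemma isCentered_riemannSum (hw : IsBrownianFamily P ℱ w) (hb : Summable fun z => |b z|)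
    (hf : ∀ s ∈ Set.Icc (grid h i) (grid h j), ∀ x, MemLp (f s x) 2 P)
    (hfm : ∀ s ∈ Set.Icc (grid h i) (grid h j), ∀ x, Measurable[ℱ s] (f s x)) (m : ℕ)
    (x : Lattice d) : IsCentered P (ℱ (grid h i)) (riemannSum b w f h i j m x) := by
  rcases eq_or_ne m 0 with rfl | hm
  · rw [riemannSum_zero_right]
    exact IsCentered.zero _
  · rw [← grid_div h hm i]
    exact isCentered_sum_noise hw hb x
      (fun k hik hkj => hf _ (grid_div_mem_Icc hm hik hkj.le) x)
      fun k hik hkj => hfm _ (grid_div_mem_Icc hm hik hkj.le) x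

lemma energy_riemannSum_le (hw : IsBrownianFamily P ℱ w) (hb : Summable fun z => |b z|)
    (hf : ∀ s ∈ Set.Icc (grid h i) (grid h j), ∀ x, MemLp (f s x) 2 P)
    (hfm : ∀ s ∈ Set.Icc (grid h i) (grid h j), ∀ x, Measurable[ℱ s] (f s x))
    (hK : ∀ s ∈ Set.Icc (grid h i) (grid h j), energy μ P (f s) ≤ K) (m : ℕ) :
    energy μ P (riemannSum b w f h i j m) ≤
      ((grid h j - grid h i) * (noiseVar b * K) : ℝ≥0) := by
  rcases eq_or_ne m 0 with rfl | hm
  · simp [energy, riemannSum_zero_right]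
  have hmem (k) (hik : i * m ≤ k) (hkj : k < j * m) := grid_div_mem_Icc (h := h) hm hik hkj.le
  calc energy μ P (riemannSum b w f h i j m)
      = (h / m * noiseVar b : ℝ≥0) *
          ∑ k ∈ Finset.Ico (i * m) (j * m), energy μ P (f (grid (h / m) k)) :=
        energy_sum_noise hw hb μ (fun k hik hkj x => hf _ (hmem k hik hkj) x)
          fun k hik hkj x => hfm _ (hmem k hik hkj) x
    _ ≤ (h / m * noiseVar b : ℝ≥0) * ∑ _k ∈ Finset.Ico (i * m) (j * m), (K : ℝ≥0∞) := by
        gcongr with k hk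
        exact hK _ (hmem k (Finset.mem_Ico.1 hk).1 (Finset.mem_Ico.1 hk).2)
    _ = (((grid (h / m) (j * m) - grid (h / m) (i * m)) * (noiseVar b * K) : ℝ≥0) : ℝ≥0∞) := by
        rw [Finset.sum_const, Nat.card_Ico, nsmul_eq_mul]
        norm_cast
        simp only [grid]
        rw [← tsub_mul ((j * m : ℕ) : ℝ≥0), ← Nat.cast_tsub]
        ring
    _ = _ := by rw [grid_div h hm, grid_div h hm]

lemma itoSum_ae_eq_riemannSum (hw : IsBrownianFamily P ℱ w) (hb : Summable fun z => |b z|)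
    (f : ℝ≥0 → Lattice d → Ω → ℝ) (h : ℝ≥0) (hj : j ≠ 0) (hm : m ≠ 0) (x : Lattice d) :
    itoSum (fun s => f s x) (corrWiener b w x) (grid h j) (j * m) =ᵐ[P]
      riemannSum b w f h 0 j m x := by
  have hj' : (j : ℝ≥0) ≠ 0 := Nat.cast_ne_zero.2 hj
  have hm' : (m : ℝ≥0) ≠ 0 := Nat.cast_ne_zero.2 hm
  have hgrid (y : ℝ≥0) : y / ((j * m : ℕ) : ℝ≥0) * grid h j = y * (h / m) := by
    simp only [grid, Nat.cast_mul]
    field_simp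
  filter_upwards [ae_all_iff.2 fun k => ae_corrWiener_sub hw hb
    (grid (h / m) k) (grid (h / m) (k + 1)) x] with ω hω
  rw [riemannSum, zero_mul, ← Finset.range_eq_Ico, itoSum]
  refine Finset.sum_congr rfl fun k _ => ?_
  rw [hgrid, hgrid, ← hω k, grid, grid, Nat.cast_succ]

lemma exists_seq_tendsto_grid {r s : ℝ≥0} (hr : r ≠ 0) (hrs : r ≤ s) :
    ∃ q : ℕ → ℕ, (∀ m, m + 1 ≤ q m) ∧ (∀ m, grid (r / (m + 1 : ℕ)) (q m) ≤ s) ∧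
      Tendsto (fun m : ℕ => grid (r / (m + 1 : ℕ)) (q m)) atTop (𝓝 s) := by
  refine ⟨fun m => ⌊s / r * (m + 1 : ℕ)⌋₊, fun m => Nat.le_floor ?_, fun m => ?_, ?_⟩
  · refine le_mul_of_one_le_left zero_le ?_
    rwa [one_le_div₀ (pos_iff_ne_zero.2 hr)]
  · calc grid (r / (m + 1 : ℕ)) ⌊s / r * (m + 1 : ℕ)⌋₊
        ≤ s / r * (m + 1 : ℕ) * (r / (m + 1 : ℕ)) := by
          unfold grid
          gcongr
          exact Nat.floor_le zero_le
      _ = s := by field_simp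
  · have hfloor : Tendsto (fun n : ℕ => (⌊s / r * (n : ℝ≥0)⌋₊ : ℝ≥0) / n) atTop (𝓝 (s / r)) := by
      rw [← NNReal.tendsto_coe]
      refine ((tendsto_nat_floor_mul_div_atTop (NNReal.coe_nonneg (s / r))).comp
        (tendsto_natCast_atTop_atTop (R := ℝ))).congr fun n => ?_
      have hcoe : ⌊((s / r : ℝ≥0) : ℝ) * n⌋₊ = ⌊s / r * (n : ℝ≥0)⌋₊ :=
        Nonneg.nat_floor_coe (s / r * (n : ℝ≥0))
      rw [Function.comp_apply, hcoe, NNReal.coe_div, NNReal.coe_natCast, NNReal.coe_natCast]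
    have hmul := (hfloor.comp (tendsto_add_atTop_nat 1)).mul_const r
    rw [div_mul_cancel₀ _ hr] at hmul
    refine hmul.congr fun m => ?_
    simp only [grid, Function.comp]
    ring

end RiemannSum

section RegularSolution

variable {Ω : Type*} {mΩ : MeasurableSpace Ω} {P : Measure Ω} {d : ℕ}
  {ℱ : Filtration ℝ≥0 mΩ} {w : Lattice d → ℝ≥0 → Ω → ℝ} {a b μ : Lattice d → ℝ} {κ : ℝ≥0}
  {u : ℝ≥0 → Lattice d → Ω → ℝ} {T C K r s t : ℝ≥0} {i j : ℕ}

lemma IsSolution.measurable (hu : IsSolution a b κ P ℱ w u) (t : ℝ≥0) (x : Lattice d) :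
    Measurable (u t x) :=
  (hu.adapted x t).mono (ℱ.le t) le_rfl

/-- The standing assumptions on a solution of the parabolic Anderson problem on the time interval
`[0, T]`, with the weight `μ` and the constants of the a priori bounds made explicit. -/
structure IsRegularSolution (a b μ : Lattice d → ℝ) (κ : ℝ≥0) (P : Measure Ω)
    (ℱ : Filtration ℝ≥0 mΩ) (w : Lattice d → ℝ≥0 → Ω → ℝ) (u : ℝ≥0 → Lattice d → Ω → ℝ)
    (T C K : ℝ≥0) : Prop where
  kernel : IsSymmetricKernel a
  summable : Summable fun z => |b z|
  brownian : IsBrownianFamily P ℱ w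
  solution : IsSolution a b κ P ℱ w u
  weight_pos : ∀ x, 0 < μ x
  weight_summable : Summable μ
  conv : IsConvBound a μ C
  bound : ∀ t ≤ T, energy μ P (u t) ≤ K

lemma IsSolution.exists_isRegularSolution (hu : IsSolution a b κ P ℱ w u)
    (ha : IsSymmetricKernel a) (hb : Summable fun z => |b z|) (hw : IsBrownianFamily P ℱ w)
    (T : ℝ≥0) : ∃ μ C K, IsRegularSolution a b μ κ P ℱ w u T C K := by
  obtain ⟨μ, hμ, hbounded⟩ := hu.bounded
  obtain ⟨C, hC⟩ := hμ.exists_isConvBound ha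
  obtain ⟨K, hK⟩ := hbounded T
  exact ⟨μ, C, K, ha, hb, hw, hu, hμ.pos, hμ.summable, hC, hK⟩

lemma IsRegularSolution.memLp (H : IsRegularSolution a b μ κ P ℱ w u T C K) (ht : t ≤ T)
    (x : Lattice d) : MemLp (u t x) 2 P :=
  (memLp_two_iff_lintegral_enorm_sq (H.solution.measurable t x).aestronglyMeasurable).2
    (ne_top_of_tsum_weight_ne_top H.weight_pos
      ((H.bound t ht).trans_lt ENNReal.coe_lt_top).ne x)

/-- The increment `u(t) - u(r) - ∫_r^t ϰ ℒ u ds` of the martingale part of `u`, that is, the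
stochastic integral `∫_r^t u dW`. -/
def martIncr (a : Lattice d → ℝ) (κ : ℝ≥0) (u : ℝ≥0 → Lattice d → Ω → ℝ) (r t : ℝ≥0)
    (x : Lattice d) (ω : Ω) : ℝ :=
  u t x ω - u r x ω - drift a κ u r t x ω

lemma tendsto_riemannSum_zero (hw : IsBrownianFamily P ℱ w) (hb : Summable fun z => |b z|)
    (hu : IsSolution a b κ P ℱ w u) (h : ℝ≥0) (j : ℕ) (x : Lattice d) :
    TendstoInMeasure P (fun m => riemannSum b w u h 0 j m x) atTop
      (fun ω => u (grid h j) x ω - 1 - drift a κ u 0 (grid h j) x ω) := by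
  have heq : TendstoInMeasure P
      (fun n => itoSum (fun s => u s x) (corrWiener b w x) (grid h j) n) atTop
      (fun ω => u (grid h j) x ω - 1 - drift a κ u 0 (grid h j) x ω) :=
    hu.equation (grid h j) x
  rcases eq_or_ne j 0 with rfl | hj
  · have hito (n) : itoSum (fun s => u s x) (corrWiener b w x) (grid h 0) n = fun _ => 0 := by
      ext ω
      simp [itoSum, grid]
    have hriemann (m) : riemannSum b w u h 0 0 m x = fun _ => 0 := by
      ext ω
      simp [riemannSum]
    simpa only [hito, hriemann] using heq
  · refine (heq.comp (tendsto_id.const_mul_atTop' (Nat.pos_of_ne_zero hj))).congr' ?_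
      EventuallyEq.rfl
    filter_upwards [eventually_ne_atTop 0] with m hm
    exact itoSum_ae_eq_riemannSum hw hb u h hj hm x

lemma IsSolution.apply_zero_ae_eq_one (hu : IsSolution a b κ P ℱ w u)
    (hw : IsBrownianFamily P ℱ w) (hb : Summable fun z => |b z|) (x : Lattice d) :
    u 0 x =ᵐ[P] fun _ => 1 := by
  have hzero : (fun m => riemannSum b w u 0 0 0 m x) = fun _ _ => 0 := by
    ext m ω
    simp [riemannSum]
  have hlim := tendsto_riemannSum_zero hw hb hu 0 0 x
  rw [hzero] at hlim
  filter_upwards [tendstoInMeasure_ae_unique hlim (tendstoInMeasure_const atTop _)] with ω hω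
  simp only [grid, mul_zero, drift, NNReal.coe_zero, intervalIntegral.integral_same,
    sub_zero] at hω
  linarith

lemma IsRegularSolution.ae_intervalIntegrable_drift
    (H : IsRegularSolution a b μ κ P ℱ w u T C K) (hrt : r ≤ t) (ht : t ≤ T) (x : Lattice d) :
    ∀ᵐ ω ∂P, IntervalIntegrable
      (fun s : ℝ => κ * nonlocalLaplacian a (fun y => u s.toNNReal y ω) x) volume r t :=
  have := H.brownian.isProbabilityMeasure
  Anderson.ae_intervalIntegrable_drift H.kernel H.conv H.weight_pos κ H.solution.measurable
    H.solution.continuous_paths hrt (fun s hs => H.bound s (hs.2.trans ht)) x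

lemma IsRegularSolution.ae_drift_sub (H : IsRegularSolution a b μ κ P ℱ w u T C K)
    (hrt : r ≤ t) (ht : t ≤ T) (x : Lattice d) :
    ∀ᵐ ω ∂P, drift a κ u 0 t x ω - drift a κ u 0 r x ω = drift a κ u r t x ω := by
  filter_upwards [H.ae_intervalIntegrable_drift zero_le (hrt.trans ht) x,
    H.ae_intervalIntegrable_drift hrt ht x] with ω hint₀ hint
  rw [drift, drift, drift, ← intervalIntegral.integral_add_adjacent_intervals hint₀ hint,
    add_sub_cancel_left]

lemma IsRegularSolution.tendsto_riemannSum (H : IsRegularSolution a b μ κ P ℱ w u T C K)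
    (h : ℝ≥0) (hij : i ≤ j) (hj : grid h j ≤ T) (x : Lattice d) :
    TendstoInMeasure P (fun m => riemannSum b w u h i j m x) atTop
      (martIncr a κ u (grid h i) (grid h j) x) := by
  refine (tendstoInMeasure_sub
    (tendsto_riemannSum_zero H.brownian H.summable H.solution h j x)
    (tendsto_riemannSum_zero H.brownian H.summable H.solution h i x)).congr
    (fun m => Eventually.of_forall fun ω => ?_) ?_
  · simp only [riemannSum, zero_mul, ← Finset.range_eq_Ico]
    rw [Finset.sum_Ico_eq_sub _ (Nat.mul_le_mul_right m hij)]
  · filter_upwards [H.ae_drift_sub (grid_mono h hij) hj x] with ω hω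
    rw [martIncr, ← hω]
    ring

lemma IsRegularSolution.aemeasurable_martIncr (H : IsRegularSolution a b μ κ P ℱ w u T C K)
    (hij : i ≤ j) {h : ℝ≥0} (hj : grid h j ≤ T) (x : Lattice d) :
    AEMeasurable (martIncr a κ u (grid h i) (grid h j) x) P :=
  TendstoInMeasure.aemeasurable
    (fun m => (measurable_riemannSum H.brownian H.solution.measurable h i j m x).aemeasurable)
    (H.tendsto_riemannSum h hij hj x)

lemma IsRegularSolution.energy_martIncr_le (H : IsRegularSolution a b μ κ P ℱ w u T C K)
    (hij : i ≤ j) {h : ℝ≥0} (hj : grid h j ≤ T) :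
    energy μ P (martIncr a κ u (grid h i) (grid h j)) ≤
      ((grid h j - grid h i) * (noiseVar b * K) : ℝ≥0) :=
  energy_le_of_tendstoInMeasure
    (fun m x => (measurable_riemannSum H.brownian H.solution.measurable h i j m x).aemeasurable)
    (fun x => H.tendsto_riemannSum h hij hj x)
    (energy_riemannSum_le H.brownian H.summable (fun _ hs => H.memLp (hs.2.trans hj))
      (fun s _ x => H.solution.adapted x s) fun s hs => H.bound s (hs.2.trans hj))

/-- A constant `c` such that the squared weighted norm of `u(s) - u(r)` is at most `c (s - r)`,
for a solution `u` on `[0, T]` whose squared weighted norm is at most `K`. -/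
def holderConst (b : Lattice d → ℝ) (κ T C K : ℝ≥0) : ℝ≥0 :=
  2 * (noiseVar b * K) + 2 * (T * (κ ^ 2 * (2 * (C + 1)) * K))

lemma IsRegularSolution.energy_sub_grid_le (H : IsRegularSolution a b μ κ P ℱ w u T C K)
    (h : ℝ≥0) (hij : i ≤ j) (hj : grid h j ≤ T) :
    energy μ P (fun x ω => u (grid h j) x ω - u (grid h i) x ω) ≤
      ((grid h j - grid h i) * holderConst b κ T C K : ℝ≥0) := by
  have := H.brownian.isProbabilityMeasure
  set δ := grid h j - grid h i
  have hdrift : energy μ P (drift a κ u (grid h i) (grid h j)) ≤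
      (δ ^ 2 * (κ ^ 2 * (2 * (C + 1)) * K) : ℝ≥0) :=
    energy_drift_le H.kernel H.conv κ H.solution.measurable H.solution.continuous_paths
      (grid_mono h hij) fun s hs => H.bound s (hs.2.trans hj)
  have hδT : δ ≤ T := tsub_le_self.trans hj
  calc energy μ P (fun x ω => u (grid h j) x ω - u (grid h i) x ω)
      = energy μ P (fun x ω => martIncr a κ u (grid h i) (grid h j) x ω +
          drift a κ u (grid h i) (grid h j) x ω) := by simp only [martIncr, sub_add_cancel]
    _ ≤ (1 + 1 : ℝ≥0) * (δ * (noiseVar b * K) : ℝ≥0) +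
          (1 + 1⁻¹ : ℝ≥0) * (δ ^ 2 * (κ ^ 2 * (2 * (C + 1)) * K) : ℝ≥0) := by
        refine (energy_add_le one_ne_zero _ fun x => H.aemeasurable_martIncr hij hj x).trans ?_
        gcongr
        exact H.energy_martIncr_le hij hj
    _ = (δ * (2 * (noiseVar b * K) + 2 * (δ * (κ ^ 2 * (2 * (C + 1)) * K))) : ℝ≥0) := by
        norm_cast
        rw [inv_one]
        ring
    _ ≤ (δ * holderConst b κ T C K : ℝ≥0) := by
        unfold holderConst
        gcongr

lemma IsRegularSolution.energy_sub_le (H : IsRegularSolution a b μ κ P ℱ w u T C K)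
    (hrs : r ≤ s) (hs : s ≤ T) :
    energy μ P (fun x ω => u s x ω - u r x ω) ≤ ((s - r) * holderConst b κ T C K : ℝ≥0) := by
  rcases eq_or_ne r 0 with rfl | hr
  · simpa [grid] using H.energy_sub_grid_le s (Nat.zero_le 1) (by simpa [grid] using hs)
  obtain ⟨q, hq, hqs, hlim⟩ := exists_seq_tendsto_grid hr hrs
  have hgrid_r (m : ℕ) : grid (r / (m + 1 : ℕ)) (m + 1) = r := by
    simpa [grid] using grid_div r (Nat.succ_ne_zero m) 1
  have hmeas (m : ℕ) (x) : Measurable fun ω =>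
      u (grid (r / (m + 1 : ℕ)) (q m)) x ω - u r x ω :=
    (H.solution.measurable _ x).sub (H.solution.measurable _ x)
  have := H.brownian.isProbabilityMeasure
  refine energy_le_of_tendstoInMeasure (fun m x => (hmeas m x).aemeasurable) (fun x => ?_)
    fun m => ?_
  · refine tendstoInMeasure_of_tendsto_ae (fun m => (hmeas m x).aestronglyMeasurable) ?_
    filter_upwards [H.solution.continuous_paths x] with ω hω
    exact ((hω.tendsto s).comp hlim).sub_const _
  · have hle := H.energy_sub_grid_le (r / (m + 1 : ℕ)) (hq m) ((hqs m).trans hs)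
    rw [hgrid_r] at hle
    refine hle.trans ?_
    gcongr
    exact hqs m

end RegularSolution

/-! ### Convergence of the scheme -/

section Summability

variable {Ω : Type*} {mΩ : MeasurableSpace Ω} {P : Measure Ω} {d : ℕ} {a μ : Lattice d → ℝ}
  {C : ℝ≥0} {x : Lattice d}

lemma nonlocalLaplacian_eq_of_summable (ha : IsSymmetricKernel a) {f : Lattice d → ℝ}
    (hf : Summable fun z => a z * f (x + z)) :
    nonlocalLaplacian a f x = ∑' z, a z * f (x + z) - f x := by
  have hconst := ha.hasSum_one.mul_right (f x)
  simp only [nonlocalLaplacian, mul_sub]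
  rw [hf.tsum_sub hconst.summable, hconst.tsum_eq, one_mul]

lemma nonlocalLaplacian_sub (ha : IsSymmetricKernel a) {f g : Lattice d → ℝ}
    (hf : Summable fun z => a z * f (x + z)) (hg : Summable fun z => a z * g (x + z)) :
    nonlocalLaplacian a (fun y => f y - g y) x =
      nonlocalLaplacian a f x - nonlocalLaplacian a g x := by
  have hfg : Summable fun z => a z * (f (x + z) - g (x + z)) := by
    simpa only [mul_sub] using hf.sub hg
  rw [nonlocalLaplacian_eq_of_summable ha hf, nonlocalLaplacian_eq_of_summable ha hg,
    nonlocalLaplacian_eq_of_summable ha (f := fun y => f y - g y) hfg]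
  simp only [mul_sub]
  rw [hf.tsum_sub hg]
  ring

lemma stepAvg_eq_add_nonlocalLaplacian (ha : IsSymmetricKernel a) {f : Lattice d → ℝ}
    (hf : Summable fun z => a z * f (x + z)) (τ : ℝ) :
    stepAvg a τ f x = f x + τ * nonlocalLaplacian a f x := by
  rw [stepAvg_eq_of_summable hf, nonlocalLaplacian_eq_of_summable ha hf]
  ring

lemma summable_of_avg_sq_ne_top (ha : IsSymmetricKernel a) {f : Lattice d → ℝ}
    (hf : avg (fun z => ENNReal.ofReal (a z)) (fun y => ‖f y‖ₑ ^ 2) x ≠ ∞) :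
    Summable fun z => a z * f (x + z) := by
  refine summable_of_tsum_enorm_ne_top fun htop => hf (top_le_iff.1 ?_)
  have havg : avg (fun z => ENNReal.ofReal (a z)) (fun y => ‖f y‖ₑ) x = ∞ := by
    rw [← htop]
    exact tsum_congr fun z => by rw [enorm_mul, Real.enorm_of_nonneg (ha.nonneg z)]
  simpa [havg] using sq_avg_le ha.tsum_ofReal (fun y => ‖f y‖ₑ) x

lemma ae_avg_sq_ne_top (hC : IsConvBound a μ C) (hμ : ∀ x, 0 < μ x) {f : Lattice d → Ω → ℝ}
    (hf : ∀ x, AEMeasurable (f x) P) (hfe : energy μ P f ≠ ∞) (x : Lattice d) :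
    ∀ᵐ ω ∂P, avg (fun z => ENNReal.ofReal (a z)) (fun y => ‖f y ω‖ₑ ^ 2) x ≠ ∞ := by
  have hsq (y) : AEMeasurable (fun ω => ‖f y ω‖ₑ ^ 2) P := (hf y).enorm.pow_const 2
  have hfin : ∫⁻ ω, avg (fun z => ENNReal.ofReal (a z)) (fun y => ‖f y ω‖ₑ ^ 2) x ∂P ≠ ∞ := by
    rw [lintegral_avg _ hsq]
    exact ne_top_of_tsum_weight_ne_top hμ ((hC.tsum_weight_avg_le _).trans_lt
      (ENNReal.mul_lt_top ENNReal.coe_lt_top hfe.lt_top)).ne x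
  filter_upwards [ae_lt_top' (AEMeasurable.tsum fun z => (hsq _).const_mul _) hfin]
    with ω hω using hω.ne

lemma ae_summable_shift (ha : IsSymmetricKernel a) (hC : IsConvBound a μ C) (hμ : ∀ x, 0 < μ x)
    {f : Lattice d → Ω → ℝ} (hf : ∀ x, AEMeasurable (f x) P) (hfe : energy μ P f ≠ ∞)
    (x : Lattice d) : ∀ᵐ ω ∂P, Summable fun z => a z * f (x + z) ω := by
  filter_upwards [ae_avg_sq_ne_top hC hμ hf hfe x] with ω hω
  exact summable_of_avg_sq_ne_top ha (f := fun y => f y ω) hω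

end Summability

section DriftError

variable {Ω : Type*} {mΩ : MeasurableSpace Ω} {P : Measure Ω} {d : ℕ}
  {ℱ : Filtration ℝ≥0 mΩ} {w : Lattice d → ℝ≥0 → Ω → ℝ} {a b μ : Lattice d → ℝ} {κ : ℝ≥0}
  {u : ℝ≥0 → Lattice d → Ω → ℝ} {T C K r t : ℝ≥0}

lemma IsRegularSolution.energy_ne_top (H : IsRegularSolution a b μ κ P ℱ w u T C K)
    (ht : t ≤ T) : energy μ P (u t) ≠ ∞ :=
  ((H.bound t ht).trans_lt ENNReal.coe_lt_top).ne

lemma IsRegularSolution.ae_summable (H : IsRegularSolution a b μ κ P ℱ w u T C K)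
    (ht : t ≤ T) (x : Lattice d) : ∀ᵐ ω ∂P, Summable fun z => a z * u t (x + z) ω :=
  ae_summable_shift H.kernel H.conv H.weight_pos
    (fun y => (H.solution.measurable t y).aemeasurable) (H.energy_ne_top ht) x

lemma IsRegularSolution.ae_ae_summable (H : IsRegularSolution a b μ κ P ℱ w u T C K)
    (ht : t ≤ T) (x : Lattice d) :
    ∀ᵐ ω ∂P, ∀ᵐ s ∂(volume.restrict (Set.Ioc (r : ℝ) t)),
      Summable fun z => a z * u s.toNNReal (x + z) ω := by
  have := H.brownian.isProbabilityMeasure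
  obtain ⟨v, hvm, huv⟩ :=
    exists_continuous_modification H.solution.measurable H.solution.continuous_paths
  have hmeas : Measurable fun q : Ω × ℝ =>
      avg (fun z => ENNReal.ofReal (a z)) (fun y => ‖v q.2.toNNReal y q.1‖ₑ ^ 2) x :=
    Measurable.tsum fun z => (((hvm _).comp
      (measurable_snd.real_toNNReal.prodMk measurable_fst)).enorm.pow_const 2).const_mul _
  have hfinite : ∀ᵐ ω ∂P, ∀ᵐ s ∂(volume.restrict (Set.Ioc (r : ℝ) t)),
      avg (fun z => ENNReal.ofReal (a z)) (fun y => ‖v s.toNNReal y ω‖ₑ ^ 2) x ≠ ∞ := by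
    rw [Measure.ae_ae_comm (p := fun ω (s : ℝ) => avg (fun z => ENNReal.ofReal (a z))
      (fun y => ‖v s.toNNReal y ω‖ₑ ^ 2) x ≠ ∞) (hmeas (measurableSet_singleton ∞).compl)]
    filter_upwards [ae_restrict_mem measurableSet_Ioc] with s hs
    have hsT : s.toNNReal ≤ T := (Real.toNNReal_le_iff_le_coe.2 hs.2).trans ht
    filter_upwards [huv, ae_avg_sq_ne_top H.conv H.weight_pos
      (fun y => (H.solution.measurable s.toNNReal y).aemeasurable)
      (H.energy_ne_top hsT) x] with ω hω hfin
    simpa only [hω] using hfin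
  filter_upwards [hfinite, huv] with ω hω hωv
  filter_upwards [hω] with s hs
  refine summable_of_avg_sq_ne_top H.kernel (f := fun y => u s.toNNReal y ω) ?_
  simpa only [hωv] using hs

lemma IsRegularSolution.energy_sub_le_of_mem_Icc (H : IsRegularSolution a b μ κ P ℱ w u T C K)
    (ht : t ≤ T) {s : ℝ≥0} (hs : s ∈ Set.Icc r t) :
    energy μ P (fun x ω => u s x ω - u r x ω) ≤ ((t - r) * holderConst b κ T C K : ℝ≥0) :=
  (H.energy_sub_le hs.1 (hs.2.trans ht)).trans (by gcongr; exact hs.2)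

lemma IsRegularSolution.energy_drift_sub_le (H : IsRegularSolution a b μ κ P ℱ w u T C K)
    (hrt : r ≤ t) (ht : t ≤ T) :
    energy μ P (drift a κ (fun s x ω => u s x ω - u r x ω) r t) ≤
      ((t - r) ^ 2 * (κ ^ 2 * (2 * (C + 1)) * ((t - r) * holderConst b κ T C K)) : ℝ≥0) :=
  have := H.brownian.isProbabilityMeasure
  energy_drift_le H.kernel H.conv κ
    (fun s x => (H.solution.measurable s x).sub (H.solution.measurable r x))
    (fun x => (H.solution.continuous_paths x).mono fun _ hω => hω.sub continuous_const) hrt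
    fun _ => H.energy_sub_le_of_mem_Icc ht

lemma IsRegularSolution.ae_drift_eq (H : IsRegularSolution a b μ κ P ℱ w u T C K)
    (hrt : r ≤ t) (ht : t ≤ T) (x : Lattice d) :
    ∀ᵐ ω ∂P, drift a κ u r t x ω = drift a κ (fun s x ω => u s x ω - u r x ω) r t x ω +
      (t - r : ℝ≥0) * κ * nonlocalLaplacian a (fun y => u r y ω) x := by
  have := H.brownian.isProbabilityMeasure
  have hintegrable := Anderson.ae_intervalIntegrable_drift H.kernel H.conv H.weight_pos κ
    (f := fun s x ω => u s x ω - u r x ω)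
    (fun s x => (H.solution.measurable s x).sub (H.solution.measurable r x))
    (fun x => (H.solution.continuous_paths x).mono fun _ hω => hω.sub continuous_const) hrt
    (fun _ => H.energy_sub_le_of_mem_Icc ht) x
  filter_upwards [hintegrable, H.ae_ae_summable ht x, H.ae_summable (hrt.trans ht) x]
    with ω hint hsum hsum_r
  have hconst : ∫ _s in (r : ℝ)..t, κ * nonlocalLaplacian a (fun y => u r y ω) x =
      (t - r : ℝ≥0) * κ * nonlocalLaplacian a (fun y => u r y ω) x := by
    rw [intervalIntegral.integral_const, smul_eq_mul, NNReal.coe_sub hrt, mul_assoc]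
  rw [← hconst, drift, drift, ← intervalIntegral.integral_add hint intervalIntegrable_const]
  refine intervalIntegral.integral_congr_ae ?_
  rw [Set.uIoc_of_le (NNReal.coe_le_coe.2 hrt), ← ae_restrict_iff' measurableSet_Ioc]
  filter_upwards [hsum] with s hs
  rw [nonlocalLaplacian_sub H.kernel (f := fun y => u s.toNNReal y ω)
    (g := fun y => u r y ω) hs hsum_r]
  ring

end DriftError

section RealScheme

variable {Ω : Type*} {mΩ : MeasurableSpace Ω} {P : Measure Ω} {d : ℕ}
  {ℱ : Filtration ℝ≥0 mΩ} {w : Lattice d → ℝ≥0 → Ω → ℝ} {a b μ : Lattice d → ℝ} {κ h : ℝ≥0}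
  {u : ℝ≥0 → Lattice d → Ω → ℝ} {T C K : ℝ≥0} {k : ℕ}

/-- The Euler scheme `scheme` as a real-valued process. -/
def realScheme (a b : Lattice d → ℝ) (κ : ℝ≥0) (w : Lattice d → ℝ≥0 → Ω → ℝ) (h : ℝ≥0) (k : ℕ)
    (x : Lattice d) (ω : Ω) : ℝ :=
  (scheme a b κ w h k x ω).toReal

/-- The Euler scheme after the averaging half of a step, before the multiplication by the
noise. -/
def averagedScheme (a b : Lattice d → ℝ) (κ : ℝ≥0) (w : Lattice d → ℝ≥0 → Ω → ℝ) (h : ℝ≥0)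
    (k : ℕ) (x : Lattice d) (ω : Ω) : ℝ :=
  stepAvg a (h * κ : ℝ≥0) (fun y => realScheme a b κ w h k y ω) x

lemma measurable_stepAvg {m : MeasurableSpace Ω} {f : Lattice d → Ω → ℝ}
    (hf : ∀ x, Measurable[m] (f x)) (τ : ℝ) (x : Lattice d) :
    Measurable[m] fun ω => stepAvg a τ (fun y => f y ω) x :=
  Measurable.tsum fun _ => (hf _).const_mul _

lemma measurable_realScheme_filtration (hw : IsBrownianFamily P ℱ w) (κ h : ℝ≥0) (k : ℕ)
    (x : Lattice d) : Measurable[ℱ (grid h k)] (realScheme a b κ w h k x) :=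
  (measurable_scheme_filtration hw (κ : ℝ) h k x).ennreal_toReal

lemma measurable_realScheme (hw : IsBrownianFamily P ℱ w) (κ h : ℝ≥0) (k : ℕ) (x : Lattice d) :
    Measurable (realScheme a b κ w h k x) :=
  (measurable_realScheme_filtration hw κ h k x).mono (ℱ.le _) le_rfl

lemma measurable_averagedScheme_filtration (hw : IsBrownianFamily P ℱ w) (κ h : ℝ≥0) (k : ℕ)
    (x : Lattice d) : Measurable[ℱ (grid h k)] (averagedScheme a b κ w h k x) :=
  measurable_stepAvg (measurable_realScheme_filtration hw κ h k) _ x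

lemma lintegral_scheme_pow_le (ha : IsSymmetricKernel a) (hb : Summable fun z => |b z|)
    (hw : IsBrownianFamily P ℱ w) (hκ : h * κ ≤ 1) (k q : ℕ) (x : Lattice d) :
    ∫⁻ ω, scheme a b κ w h k x ω ^ q ∂P ≤
      ENNReal.ofReal (Real.exp (grid h k * momentRate (corr b) q)) := by
  rw [lintegral_scheme_pow hw hb]
  refine (discreteMoment_le ha (isPosDef_corr hb) κ.coe_nonneg h.coe_nonneg
    (mod_cast hκ) k 0).trans_eq ?_
  simp [grid]

lemma lintegral_realScheme_pow_le (ha : IsSymmetricKernel a) (hb : Summable fun z => |b z|)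
    (hw : IsBrownianFamily P ℱ w) (hκ : h * κ ≤ 1) (k q : ℕ) (x : Lattice d) :
    ∫⁻ ω, ‖realScheme a b κ w h k x ω‖ₑ ^ q ∂P ≤
      ENNReal.ofReal (Real.exp (grid h k * momentRate (corr b) q)) := by
  refine (lintegral_mono fun ω => ?_).trans (lintegral_scheme_pow_le ha hb hw hκ k q x)
  rw [realScheme, Real.enorm_of_nonneg ENNReal.toReal_nonneg]
  gcongr
  exact ENNReal.ofReal_toReal_le

/-- A bound for the energy of the Euler scheme up to time `T`. -/
def schemeBound (b μ : Lattice d → ℝ) (T : ℝ≥0) : ℝ≥0 :=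
  (∑' x, μ x).toNNReal * (Real.exp (T * momentRate (corr b) 2)).toNNReal

lemma energy_realScheme_le (H : IsRegularSolution a b μ κ P ℱ w u T C K) (hκ : h * κ ≤ 1)
    (hk : grid h k ≤ T) : energy μ P (realScheme a b κ w h k) ≤ schemeBound b μ T := by
  calc energy μ P (realScheme a b κ w h k)
      ≤ ∑' x, ENNReal.ofReal (μ x) * ENNReal.ofReal (Real.exp (T * momentRate (corr b) 2)) := by
        refine ENNReal.tsum_le_tsum fun x => ?_
        gcongr
        refine (lintegral_realScheme_pow_le H.kernel H.summable H.brownian hκ k 2 x).trans ?_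
        have := (isPosDef_corr H.summable).momentRate_nonneg 2
        gcongr
    _ = schemeBound b μ T := by
        rw [ENNReal.tsum_mul_right, schemeBound, ENNReal.coe_mul,
          ← ENNReal.ofReal_tsum_of_nonneg (fun x => (H.weight_pos x).le) H.weight_summable]
        rfl

lemma energy_realScheme_ne_top (H : IsRegularSolution a b μ κ P ℱ w u T C K) (hκ : h * κ ≤ 1)
    (hk : grid h k ≤ T) : energy μ P (realScheme a b κ w h k) ≠ ∞ :=
  ((energy_realScheme_le H hκ hk).trans_lt ENNReal.coe_lt_top).ne

lemma memLp_stepAvg (H : IsRegularSolution a b μ κ P ℱ w u T C K) {f : Lattice d → Ω → ℝ}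
    {τ : ℝ≥0} (hτ : τ ≤ 1) (hf : ∀ x, Measurable (f x)) (hfe : energy μ P f ≠ ∞) (x : Lattice d) :
    MemLp (fun ω => stepAvg a τ (fun y => f y ω) x) 2 P :=
  (memLp_two_iff_lintegral_enorm_sq (measurable_stepAvg hf τ x).aestronglyMeasurable).2
    (ne_top_of_tsum_weight_ne_top H.weight_pos
      ((energy_stepAvg_le H.kernel H.conv hτ fun y => (hf y).aemeasurable).trans_lt
        (ENNReal.mul_lt_top ENNReal.coe_lt_top hfe.lt_top)).ne x)

lemma memLp_averagedScheme (H : IsRegularSolution a b μ κ P ℱ w u T C K) (hκ : h * κ ≤ 1)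
    (hk : grid h k ≤ T) (x : Lattice d) : MemLp (averagedScheme a b κ w h k x) 2 P :=
  memLp_stepAvg H hκ (measurable_realScheme H.brownian κ h k) (energy_realScheme_ne_top H hκ hk) x

lemma energy_averagedScheme_le (H : IsRegularSolution a b μ κ P ℱ w u T C K) (hκ : h * κ ≤ 1)
    (hk : grid h k ≤ T) :
    energy μ P (averagedScheme a b κ w h k) ≤ ((1 + C) * schemeBound b μ T : ℝ≥0) := by
  refine (energy_stepAvg_le H.kernel H.conv hκ
    fun y => (measurable_realScheme H.brownian κ h k y).aemeasurable).trans ?_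
  rw [ENNReal.coe_mul]
  gcongr
  · exact mul_le_of_le_one_left zero_le hκ
  · exact energy_realScheme_le H hκ hk

lemma ae_summable_realScheme (H : IsRegularSolution a b μ κ P ℱ w u T C K) (hκ : h * κ ≤ 1)
    (hk : grid h k ≤ T) (x : Lattice d) :
    ∀ᵐ ω ∂P, Summable fun z => a z * realScheme a b κ w h k (x + z) ω :=
  ae_summable_shift H.kernel H.conv H.weight_pos
    (fun y => (measurable_realScheme H.brownian κ h k y).aemeasurable)
    (energy_realScheme_ne_top H hκ hk) x

lemma ae_scheme_ne_top (ha : IsSymmetricKernel a) (hb : Summable fun z => |b z|)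
    (hw : IsBrownianFamily P ℱ w) (hκ : h * κ ≤ 1) (k : ℕ) :
    ∀ᵐ ω ∂P, ∀ x, scheme a b κ w h k x ω ≠ ∞ := by
  refine ae_all_iff.2 fun x => ?_
  have hfin := (lintegral_scheme_pow_le ha hb hw hκ k 1 x).trans_lt ENNReal.ofReal_lt_top
  simp only [pow_one] at hfin
  filter_upwards [ae_lt_top (measurable_scheme hw κ h k x) hfin.ne] with ω hω using hω.ne

lemma ae_realScheme_succ (ha : IsSymmetricKernel a) (hb : Summable fun z => |b z|)
    (hw : IsBrownianFamily P ℱ w) (hκ : h * κ ≤ 1) (k : ℕ) (x : Lattice d) :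
    ∀ᵐ ω ∂P, realScheme a b κ w h (k + 1) x ω = averagedScheme a b κ w h k x ω *
      (1 + noise b w (grid h k) (grid h (k + 1)) x ω +
        expRemainder b w (grid h k) (grid h (k + 1)) x ω) := by
  filter_upwards [ae_scheme_ne_top ha hb hw hκ k] with ω hω
  have havg : (avg (stepKernelE a (h * κ)) (fun y => scheme a b κ w h k y ω) x).toReal =
      averagedScheme a b κ w h k x ω := by
    rw [avg, ENNReal.tsum_toReal_eq
      fun z => ENNReal.mul_ne_top (by simp [stepKernelE]) (hω _), averagedScheme, stepAvg]
    refine tsum_congr fun z => ?_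
    rw [ENNReal.toReal_mul, stepKernelE, realScheme, NNReal.coe_mul, ENNReal.toReal_ofReal
      ((ha.stepKernel (by positivity) (mod_cast hκ)).nonneg z)]
  have hexp : 1 + noise b w (grid h k) (grid h (k + 1)) x ω +
      expRemainder b w (grid h k) (grid h (k + 1)) x ω =
      Real.exp (noise b w (grid h k) (grid h (k + 1)) x ω - h * corr b 0 / 2) := by
    rw [expRemainder, grid_succ_sub, NNReal.coe_mul, coe_noiseVar]
    ring
  rw [hexp, ← havg, realScheme, scheme, ENNReal.toReal_mul,
    ENNReal.toReal_ofReal (Real.exp_pos _).le, mul_comm]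

/-- The deviation of the solution from its Euler scheme. -/
def schemeError (a b : Lattice d → ℝ) (κ : ℝ≥0) (w : Lattice d → ℝ≥0 → Ω → ℝ)
    (u : ℝ≥0 → Lattice d → Ω → ℝ) (h : ℝ≥0) (k : ℕ) (x : Lattice d) (ω : Ω) : ℝ :=
  u (grid h k) x ω - realScheme a b κ w h k x ω

lemma measurable_schemeError_filtration (H : IsRegularSolution a b μ κ P ℱ w u T C K) (h : ℝ≥0)
    (k : ℕ) (x : Lattice d) : Measurable[ℱ (grid h k)] (schemeError a b κ w u h k x) :=
  (H.solution.adapted x _).sub (measurable_realScheme_filtration H.brownian κ h k x)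

lemma measurable_schemeError (H : IsRegularSolution a b μ κ P ℱ w u T C K) (h : ℝ≥0)
    (k : ℕ) (x : Lattice d) : Measurable (schemeError a b κ w u h k x) :=
  (measurable_schemeError_filtration H h k x).mono (ℱ.le _) le_rfl

end RealScheme

section OneStep

variable {Ω : Type*} {mΩ : MeasurableSpace Ω} {P : Measure Ω} {d : ℕ}
  {ℱ : Filtration ℝ≥0 mΩ} {w : Lattice d → ℝ≥0 → Ω → ℝ} {a b μ : Lattice d → ℝ} {κ h ε : ℝ≥0}
  {u : ℝ≥0 → Lattice d → Ω → ℝ} {T C K : ℝ≥0} {k m : ℕ}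

lemma energy_sub_averagedScheme_le (H : IsRegularSolution a b μ κ P ℱ w u T C K)
    (hκ : h * κ ≤ 1) (hk : grid h k ≤ T) (hε : energy μ P (schemeError a b κ w u h k) ≤ ε) :
    energy μ P (fun x ω => u (grid h k) x ω - averagedScheme a b κ w h k x ω) ≤
      (2 * ε + h * (4 * κ * (C + 1) * schemeBound b μ T) : ℝ≥0) := by
  have hUm := measurable_realScheme (a := a) (b := b) H.brownian κ h k
  set U := realScheme a b κ w h k
  have hlaplacian : energy μ P (fun x ω => (h * κ : ℝ≥0) *
      nonlocalLaplacian a (fun y => U y ω) x) ≤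
        ((h * κ) ^ 2 * (2 * (C + 1)) * schemeBound b μ T : ℝ≥0) := by
    refine (energy_const_mul_nonlocalLaplacian_le H.kernel H.conv _
      fun x => (hUm x).aemeasurable).trans ?_
    rw [ENNReal.coe_mul _ (schemeBound b μ T)]
    gcongr
    exact energy_realScheme_le H hκ hk
  calc energy μ P (fun x ω => u (grid h k) x ω - averagedScheme a b κ w h k x ω)
      = energy μ P (fun x ω => averagedScheme a b κ w h k x ω - u (grid h k) x ω) :=
        energy_sub_comm _ _
    _ = energy μ P (fun x ω => (h * κ : ℝ≥0) * nonlocalLaplacian a (fun y => U y ω) x +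
          (U x ω - u (grid h k) x ω)) := energy_congr fun x => by
        filter_upwards [ae_summable_realScheme H hκ hk x] with ω hω
        rw [averagedScheme, stepAvg_eq_add_nonlocalLaplacian H.kernel (f := fun y => U y ω) hω]
        ring
    _ ≤ (1 + 1 : ℝ≥0) * ((h * κ) ^ 2 * (2 * (C + 1)) * schemeBound b μ T : ℝ≥0) +
          (1 + 1⁻¹ : ℝ≥0) * ε := by
        refine (energy_add_le one_ne_zero _ fun x =>
          ((measurable_nonlocalLaplacian a hUm x).const_mul _).aemeasurable).trans ?_
        gcongr
        rwa [energy_sub_comm]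
    _ = (2 * ε + (h * κ) * (h * (4 * κ * (C + 1) * schemeBound b μ T)) : ℝ≥0) := by
        norm_cast
        rw [inv_one]
        ring
    _ ≤ (2 * ε + h * (4 * κ * (C + 1) * schemeBound b μ T) : ℝ≥0) :=
        ENNReal.coe_le_coe.2 (add_le_add le_rfl (mul_le_of_le_one_left zero_le hκ))

lemma energy_path_sub_averagedScheme_le (H : IsRegularSolution a b μ κ P ℱ w u T C K)
    (hκ : h * κ ≤ 1) (hk : grid h (k + 1) ≤ T)
    (hε : energy μ P (schemeError a b κ w u h k) ≤ ε) {s : ℝ≥0}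
    (hs : s ∈ Set.Icc (grid h k) (grid h (k + 1))) :
    energy μ P (fun x ω => u s x ω - averagedScheme a b κ w h k x ω) ≤
      (4 * ε + h * (2 * holderConst b κ T C K + 8 * κ * (C + 1) * schemeBound b μ T) : ℝ≥0) := by
  have hincr := H.energy_sub_le_of_mem_Icc hk hs
  rw [grid_succ_sub] at hincr
  have hstart := energy_sub_averagedScheme_le H hκ ((grid_mono h k.le_succ).trans hk) hε
  calc energy μ P (fun x ω => u s x ω - averagedScheme a b κ w h k x ω)
      = energy μ P (fun x ω => (u s x ω - u (grid h k) x ω) +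
          (u (grid h k) x ω - averagedScheme a b κ w h k x ω)) := by
        simp only [sub_add_sub_cancel]
    _ ≤ (1 + 1 : ℝ≥0) * (h * holderConst b κ T C K : ℝ≥0) +
          (1 + 1⁻¹ : ℝ≥0) * (2 * ε + h * (4 * κ * (C + 1) * schemeBound b μ T) : ℝ≥0) := by
        refine (energy_add_le (f := fun x ω => u s x ω - u (grid h k) x ω) one_ne_zero _ fun x =>
          ((H.solution.measurable s x).sub (H.solution.measurable _ x)).aemeasurable).trans ?_
        gcongr
    _ = (4 * ε + h * (2 * holderConst b κ T C K + 8 * κ * (C + 1) * schemeBound b μ T) : ℝ≥0) := by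
        norm_cast
        rw [inv_one]
        ring

/-- The martingale part of the error made by the scheme in one step: the difference between the
stochastic integral `∫ u dW` over the step and the corresponding increment of the scheme. -/
def martError (a b : Lattice d → ℝ) (κ : ℝ≥0) (w : Lattice d → ℝ≥0 → Ω → ℝ)
    (u : ℝ≥0 → Lattice d → Ω → ℝ) (h : ℝ≥0) (k : ℕ) (x : Lattice d) (ω : Ω) : ℝ :=
  martIncr a κ u (grid h k) (grid h (k + 1)) x ω - averagedScheme a b κ w h k x ω *
    (noise b w (grid h k) (grid h (k + 1)) x ω +
      expRemainder b w (grid h k) (grid h (k + 1)) x ω)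

/-- The approximation of `martError` in which the stochastic integral `∫ (u - V) dW`, with `V` the
averaged scheme, is replaced by its Riemann sum on the grid of mesh `h / m`. -/
def martErrorApprox (a b : Lattice d → ℝ) (κ : ℝ≥0) (w : Lattice d → ℝ≥0 → Ω → ℝ)
    (u : ℝ≥0 → Lattice d → Ω → ℝ) (h : ℝ≥0) (k m : ℕ) (x : Lattice d) (ω : Ω) : ℝ :=
  riemannSum b w (fun s x ω => u s x ω - averagedScheme a b κ w h k x ω) h k (k + 1) m x ω -
    averagedScheme a b κ w h k x ω * expRemainder b w (grid h k) (grid h (k + 1)) x ω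

lemma IsRegularSolution.tendsto_martErrorApprox (H : IsRegularSolution a b μ κ P ℱ w u T C K)
    (hk : grid h (k + 1) ≤ T) (x : Lattice d) :
    TendstoInMeasure P (fun m => martErrorApprox a b κ w u h k m x) atTop
      (martError a b κ w u h k x) := by
  refine (tendstoInMeasure_sub (H.tendsto_riemannSum h k.le_succ hk x)
    (tendstoInMeasure_const atTop fun ω => averagedScheme a b κ w h k x ω *
      (noise b w (grid h k) (grid h (k + 1)) x ω +
        expRemainder b w (grid h k) (grid h (k + 1)) x ω))).congr' ?_ EventuallyEq.rfl
  filter_upwards [eventually_ne_atTop 0] with m hm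
  filter_upwards [ae_sum_noise H.brownian H.summable (h / m) x
    (Nat.mul_le_mul_right m k.le_succ)] with ω hω
  rw [grid_div h hm, grid_div h hm] at hω
  have hsplit : riemannSum b w (fun s x ω => u s x ω - averagedScheme a b κ w h k x ω)
      h k (k + 1) m x ω = riemannSum b w u h k (k + 1) m x ω -
        averagedScheme a b κ w h k x ω * noise b w (grid h k) (grid h (k + 1)) x ω := by
    rw [← hω, Finset.mul_sum, riemannSum, riemannSum, ← Finset.sum_sub_distrib]
    exact Finset.sum_congr rfl fun j _ => sub_mul _ _ _
  rw [martErrorApprox, hsplit]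
  ring

lemma IsRegularSolution.memLp_sub_averagedScheme (H : IsRegularSolution a b μ κ P ℱ w u T C K)
    (hκ : h * κ ≤ 1) (hk : grid h (k + 1) ≤ T) {s : ℝ≥0}
    (hs : s ∈ Set.Icc (grid h k) (grid h (k + 1))) (x : Lattice d) :
    MemLp (fun ω => u s x ω - averagedScheme a b κ w h k x ω) 2 P :=
  (H.memLp (hs.2.trans hk) x).sub
    (memLp_averagedScheme H hκ ((grid_mono h k.le_succ).trans hk) x)

lemma IsRegularSolution.measurable_sub_averagedScheme
    (H : IsRegularSolution a b μ κ P ℱ w u T C K) {s : ℝ≥0} (hs : grid h k ≤ s) (x : Lattice d) :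
    Measurable[ℱ s] (fun ω => u s x ω - averagedScheme a b κ w h k x ω) :=
  (H.solution.adapted x s).sub
    ((measurable_averagedScheme_filtration H.brownian κ h k x).mono (ℱ.mono hs) le_rfl)

lemma IsRegularSolution.isCentered_martErrorApprox (H : IsRegularSolution a b μ κ P ℱ w u T C K)
    (hκ : h * κ ≤ 1) (hk : grid h (k + 1) ≤ T) (m : ℕ) (x : Lattice d) :
    IsCentered P (ℱ (grid h k)) (martErrorApprox a b κ w u h k m x) :=
  have hle := grid_mono h k.le_succ
  (isCentered_riemannSum H.brownian H.summable (fun _ => H.memLp_sub_averagedScheme hκ hk)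
    (fun _ hs => H.measurable_sub_averagedScheme hs.1) m x).sub
    (isCentered_mul_expRemainder H.brownian H.summable hle x
      (memLp_averagedScheme H hκ (hle.trans hk) x)
      (measurable_averagedScheme_filtration H.brownian κ h k x))

lemma IsRegularSolution.energy_mul_expRemainder_le (H : IsRegularSolution a b μ κ P ℱ w u T C K)
    (hκ : h * κ ≤ 1) (hb : h * noiseVar b ≤ 1) (hk : grid h (k + 1) ≤ T) :
    energy μ P (fun x ω => averagedScheme a b κ w h k x ω *
      expRemainder b w (grid h k) (grid h (k + 1)) x ω) ≤
      ((h * noiseVar b) ^ 2 * ((1 + C) * schemeBound b μ T) : ℝ≥0) := by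
  have hle := grid_mono h k.le_succ
  refine (energy_le_of_le (c := ((h * noiseVar b) ^ 2 : ℝ≥0)) fun x => ?_).trans
    (mul_le_mul_right (energy_averagedScheme_le H hκ (hle.trans hk)) _)
  have hsq := lintegral_mul_expRemainder_sq_le (Y := averagedScheme a b κ w h k x) H.brownian
    H.summable hle (by rwa [grid_succ_sub]) x
    (measurable_averagedScheme_filtration H.brownian κ h k x)
  rwa [grid_succ_sub] at hsq

/-- The constant `c` in the bound `h (8 B(0) ε) + h² c` for the energy of `martError` over a step
that starts with an error of energy at most `ε`. -/
def martErrorConst (b μ : Lattice d → ℝ) (κ T C K : ℝ≥0) : ℝ≥0 :=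
  2 * (noiseVar b * (2 * holderConst b κ T C K + 8 * κ * (C + 1) * schemeBound b μ T) +
    noiseVar b ^ 2 * ((1 + C) * schemeBound b μ T))

lemma IsRegularSolution.energy_martErrorApprox_le (H : IsRegularSolution a b μ κ P ℱ w u T C K)
    (hκ : h * κ ≤ 1) (hb : h * noiseVar b ≤ 1) (hk : grid h (k + 1) ≤ T)
    (hε : energy μ P (schemeError a b κ w u h k) ≤ ε) :
    energy μ P (martErrorApprox a b κ w u h k m) ≤
      (h * (8 * noiseVar b * ε) + h ^ 2 * martErrorConst b μ κ T C K : ℝ≥0) := by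
  set f : ℝ≥0 → Lattice d → Ω → ℝ := fun s x ω => u s x ω - averagedScheme a b κ w h k x ω
  have hriemann := energy_riemannSum_le (f := f) H.brownian H.summable
    (fun _ => H.memLp_sub_averagedScheme hκ hk) (fun _ hs => H.measurable_sub_averagedScheme hs.1)
    (fun _ => energy_path_sub_averagedScheme_le H hκ hk hε) m
  have hremainder := H.energy_mul_expRemainder_le hκ hb hk
  rw [grid_succ_sub] at hriemann
  have hneg : energy μ P (fun x ω => -(averagedScheme a b κ w h k x ω *
      expRemainder b w (grid h k) (grid h (k + 1)) x ω)) =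
      energy μ P (fun x ω => averagedScheme a b κ w h k x ω *
        expRemainder b w (grid h k) (grid h (k + 1)) x ω) := by
    simp only [energy, enorm_neg]
  calc energy μ P (martErrorApprox a b κ w u h k m)
      ≤ (1 + 1 : ℝ≥0) * energy μ P (riemannSum b w f h k (k + 1) m) +
          (1 + 1⁻¹ : ℝ≥0) * energy μ P (fun x ω => averagedScheme a b κ w h k x ω *
            expRemainder b w (grid h k) (grid h (k + 1)) x ω) := by
        rw [← hneg]
        exact energy_add_le one_ne_zero _ fun x => (isCentered_riemannSum H.brownian H.summable
          (fun _ => H.memLp_sub_averagedScheme hκ hk)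
          (fun _ hs => H.measurable_sub_averagedScheme hs.1) m
          x).memLp.aestronglyMeasurable.aemeasurable
    _ ≤ (1 + 1 : ℝ≥0) * (h * (noiseVar b * (4 * ε + h * (2 * holderConst b κ T C K +
            8 * κ * (C + 1) * schemeBound b μ T))) : ℝ≥0) +
          (1 + 1⁻¹ : ℝ≥0) * ((h * noiseVar b) ^ 2 * ((1 + C) * schemeBound b μ T) : ℝ≥0) := by
        gcongr
    _ = (h * (8 * noiseVar b * ε) + h ^ 2 * martErrorConst b μ κ T C K : ℝ≥0) := by
        norm_cast
        rw [inv_one, martErrorConst]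
        ring

/-- The error of the scheme after one step, up to the variation of the drift within the step: the
averaged previous error plus `martError`. -/
def errorStep (a b : Lattice d → ℝ) (κ : ℝ≥0) (w : Lattice d → ℝ≥0 → Ω → ℝ)
    (u : ℝ≥0 → Lattice d → Ω → ℝ) (h : ℝ≥0) (k : ℕ) (x : Lattice d) (ω : Ω) : ℝ :=
  stepAvg a (h * κ : ℝ≥0) (fun y => schemeError a b κ w u h k y ω) x +
    martError a b κ w u h k x ω

lemma IsRegularSolution.ae_schemeError_succ (H : IsRegularSolution a b μ κ P ℱ w u T C K)
    (hκ : h * κ ≤ 1) (hk : grid h (k + 1) ≤ T) (x : Lattice d) :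
    ∀ᵐ ω ∂P, schemeError a b κ w u h (k + 1) x ω = errorStep a b κ w u h k x ω +
      drift a κ (fun s x ω => u s x ω - u (grid h k) x ω) (grid h k) (grid h (k + 1)) x ω := by
  have hle := grid_mono h k.le_succ
  have hkT : grid h k ≤ T := hle.trans hk
  filter_upwards [ae_realScheme_succ H.kernel H.summable H.brownian hκ k x, H.ae_drift_eq hle hk x,
    H.ae_summable hkT x, ae_summable_realScheme H hκ hkT x] with ω hscheme hdrift hu hU
  have herror : Summable fun z => a z * schemeError a b κ w u h k (x + z) ω := by
    simpa only [schemeError, mul_sub] using hu.sub hU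
  have hlaplacian : nonlocalLaplacian a (fun y => schemeError a b κ w u h k y ω) x =
      nonlocalLaplacian a (fun y => u (grid h k) y ω) x -
        nonlocalLaplacian a (fun y => realScheme a b κ w h k y ω) x :=
    nonlocalLaplacian_sub H.kernel (f := fun y => u (grid h k) y ω)
      (g := fun y => realScheme a b κ w h k y ω) hu hU
  rw [Nat.succ_eq_add_one, grid_succ_sub] at hdrift
  rw [schemeError, hscheme, errorStep, martError, martIncr, hdrift, averagedScheme,
    stepAvg_eq_add_nonlocalLaplacian H.kernel (f := fun y => schemeError a b κ w u h k y ω) herror,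
    stepAvg_eq_add_nonlocalLaplacian H.kernel (f := fun y => realScheme a b κ w h k y ω) hU,
    hlaplacian, schemeError, NNReal.coe_mul]
  ring

lemma IsRegularSolution.tendsto_stepAvg_add_martErrorApprox
    (H : IsRegularSolution a b μ κ P ℱ w u T C K) (hk : grid h (k + 1) ≤ T) (x : Lattice d) :
    TendstoInMeasure P (fun m ω =>
      stepAvg a (h * κ : ℝ≥0) (fun y => schemeError a b κ w u h k y ω) x +
        martErrorApprox a b κ w u h k m x ω) atTop (errorStep a b κ w u h k x) := by
  have hsub := tendstoInMeasure_sub (H.tendsto_martErrorApprox hk x)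
    (tendstoInMeasure_const atTop fun ω =>
      -stepAvg a (h * κ : ℝ≥0) (fun y => schemeError a b κ w u h k y ω) x)
  simp only [sub_neg_eq_add, add_comm (martErrorApprox ..), add_comm (martError ..)] at hsub
  exact hsub

lemma IsRegularSolution.memLp_stepAvg_schemeError (H : IsRegularSolution a b μ κ P ℱ w u T C K)
    (hκ : h * κ ≤ 1) (hε : energy μ P (schemeError a b κ w u h k) ≤ ε) (x : Lattice d) :
    MemLp (fun ω => stepAvg a (h * κ : ℝ≥0) (fun y => schemeError a b κ w u h k y ω) x) 2 P :=
  memLp_stepAvg H hκ (measurable_schemeError H h k) (ne_top_of_le_ne_top ENNReal.coe_ne_top hε) x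

lemma IsRegularSolution.aemeasurable_stepAvg_add_martErrorApprox
    (H : IsRegularSolution a b μ κ P ℱ w u T C K) (hκ : h * κ ≤ 1) (hk : grid h (k + 1) ≤ T)
    (hε : energy μ P (schemeError a b κ w u h k) ≤ ε) (m : ℕ) (x : Lattice d) :
    AEMeasurable (fun ω => stepAvg a (h * κ : ℝ≥0) (fun y => schemeError a b κ w u h k y ω) x +
      martErrorApprox a b κ w u h k m x ω) P :=
  ((H.memLp_stepAvg_schemeError hκ hε x).add
    (H.isCentered_martErrorApprox hκ hk m x).memLp).aestronglyMeasurable.aemeasurable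

lemma IsRegularSolution.energy_errorStep_le (H : IsRegularSolution a b μ κ P ℱ w u T C K)
    (hκ : h * κ ≤ 1) (hb : h * noiseVar b ≤ 1) (hk : grid h (k + 1) ≤ T)
    (hε : energy μ P (schemeError a b κ w u h k) ≤ ε) :
    energy μ P (errorStep a b κ w u h k) ≤
      ((1 + h * (κ * C + 8 * noiseVar b)) * ε + h ^ 2 * martErrorConst b μ κ T C K : ℝ≥0) := by
  refine energy_le_of_tendstoInMeasure
    (H.aemeasurable_stepAvg_add_martErrorApprox hκ hk hε)
    (H.tendsto_stepAvg_add_martErrorApprox hk) fun m => ?_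
  have hadd : energy μ P (fun x ω =>
      stepAvg a (h * κ : ℝ≥0) (fun y => schemeError a b κ w u h k y ω) x +
        martErrorApprox a b κ w u h k m x ω) =
      energy μ P (fun x ω => stepAvg a (h * κ : ℝ≥0) (fun y => schemeError a b κ w u h k y ω) x) +
        energy μ P (martErrorApprox a b κ w u h k m) := by
    simp only [energy]
    rw [← ENNReal.tsum_add]
    refine tsum_congr fun x => ?_
    rw [← mul_add, (H.isCentered_martErrorApprox hκ hk m x).lintegral_add_sq
      (H.memLp_stepAvg_schemeError hκ hε x)
      (measurable_stepAvg (measurable_schemeError_filtration H h k) _ x)]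
  rw [hadd]
  calc _ ≤ (1 + h * κ * C : ℝ≥0) * (ε : ℝ≥0∞) +
        (h * (8 * noiseVar b * ε) + h ^ 2 * martErrorConst b μ κ T C K : ℝ≥0) := by
        gcongr
        · exact (energy_stepAvg_le H.kernel H.conv hκ fun y =>
            (measurable_schemeError H h k y).aemeasurable).trans (by gcongr)
        · exact H.energy_martErrorApprox_le hκ hb hk hε
    _ = ((1 + h * (κ * C + 8 * noiseVar b)) * ε + h ^ 2 * martErrorConst b μ κ T C K : ℝ≥0) := by
        norm_cast
        ring

private lemma error_recursion_le (hh : h ≤ 1) (h0 : h ≠ 0) (c₀ c₁ c₂ : ℝ≥0) :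
    (1 + h) * ((1 + h * c₀) * ε + h ^ 2 * c₁) + (1 + h⁻¹) * (h ^ 2 * (h * c₂)) ≤
      (1 + h * (1 + 2 * c₀)) * ε + h ^ 2 * (2 * c₁ + 2 * c₂) := by
  have htwo : 1 + h ≤ 2 := (add_le_add le_rfl hh).trans_eq one_add_one_eq_two
  calc (1 + h) * ((1 + h * c₀) * ε + h ^ 2 * c₁) + (1 + h⁻¹) * (h ^ 2 * (h * c₂))
      = (1 + h * (1 + (1 + h) * c₀)) * ε + h ^ 2 * ((1 + h) * c₁ + (1 + h) * c₂) := by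
        field_simp
        ring
    _ ≤ (1 + h * (1 + 2 * c₀)) * ε + h ^ 2 * (2 * c₁ + 2 * c₂) := by gcongr

lemma IsRegularSolution.exists_energy_schemeError_succ_le
    (H : IsRegularSolution a b μ κ P ℱ w u T C K) :
    ∃ c c' : ℝ≥0, ∀ h : ℝ≥0, h ≠ 0 → h ≤ 1 → h * κ ≤ 1 → h * noiseVar b ≤ 1 → ∀ k : ℕ,
      grid h (k + 1) ≤ T → ∀ ε : ℝ≥0, energy μ P (schemeError a b κ w u h k) ≤ ε →
      energy μ P (schemeError a b κ w u h (k + 1)) ≤ ((1 + h * c) * ε + h ^ 2 * c' : ℝ≥0) := by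
  set c₀ := κ * C + 8 * noiseVar b
  set c₂ := κ ^ 2 * (2 * (C + 1)) * holderConst b κ T C K
  refine ⟨1 + 2 * c₀, 2 * martErrorConst b μ κ T C K + 2 * c₂, fun h h0 hh hκ hb k hk ε hε => ?_⟩
  have hstep := H.energy_errorStep_le hκ hb hk hε
  have hdrift := H.energy_drift_sub_le (grid_mono h k.le_succ) hk
  rw [Nat.succ_eq_add_one, grid_succ_sub, mul_left_comm (κ ^ 2 * _)] at hdrift
  rw [energy_congr fun x => H.ae_schemeError_succ hκ hk x]
  calc _ ≤ (1 + h : ℝ≥0) * energy μ P (errorStep a b κ w u h k) + (1 + h⁻¹ : ℝ≥0) *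
        energy μ P (drift a κ (fun s x ω => u s x ω - u (grid h k) x ω) (grid h k)
          (grid h (k + 1))) :=
        energy_add_le h0 _ fun x => TendstoInMeasure.aemeasurable
          (H.aemeasurable_stepAvg_add_martErrorApprox hκ hk hε · x)
          (H.tendsto_stepAvg_add_martErrorApprox hk x)
    _ ≤ (1 + h : ℝ≥0) * ((1 + h * c₀) * ε + h ^ 2 * martErrorConst b μ κ T C K : ℝ≥0) +
        (1 + h⁻¹ : ℝ≥0) * (h ^ 2 * (h * c₂) : ℝ≥0) := by gcongr
    _ ≤ ((1 + h * (1 + 2 * c₀)) * ε + h ^ 2 * (2 * martErrorConst b μ κ T C K + 2 * c₂) : ℝ≥0) := by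
        exact_mod_cast error_recursion_le hh h0 c₀ (martErrorConst b μ κ T C K) c₂

end OneStep

section MeanSquare

variable {Ω ι : Type*} {mΩ : MeasurableSpace Ω} {P : Measure Ω} {l : Filter ι}

lemma tendstoInMeasure_of_tendsto_lintegral_sq {f : ι → Ω → ℝ} {g : Ω → ℝ}
    (hf : ∀ n, AEMeasurable (f n) P) (hg : AEMeasurable g P)
    (h : Tendsto (fun n => ∫⁻ ω, ‖f n ω - g ω‖ₑ ^ 2 ∂P) l (𝓝 0)) : TendstoInMeasure P f l g := by
  refine tendstoInMeasure_of_tendsto_eLpNorm two_ne_zero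
    (fun n => (hf n).aestronglyMeasurable) hg.aestronglyMeasurable ?_
  have hsqrt := ((ENNReal.continuous_rpow_const (y := 1 / 2)).tendsto 0).comp h
  rw [ENNReal.zero_rpow_of_pos (by norm_num)] at hsqrt
  refine hsqrt.congr fun n => ?_
  rw [eLpNorm_eq_lintegral_rpow_enorm_toReal (by norm_num) (by norm_num)]
  simp

lemma tendsto_lintegral_sq_of_energy_le {G : Type*} {μ : G → ℝ} {x : G} (hμ : 0 < μ x)
    {f : ι → G → Ω → ℝ} {δ : ι → ℝ≥0} (hδ : Tendsto δ l (𝓝 0))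
    (h : ∀ᶠ n in l, energy μ P (f n) ≤ δ n) :
    Tendsto (fun n => ∫⁻ ω, ‖f n x ω‖ₑ ^ 2 ∂P) l (𝓝 0) := by
  have hμ0 : ENNReal.ofReal (μ x) ≠ 0 := by simpa using hμ
  have hlim : Tendsto (fun n => (ENNReal.ofReal (μ x))⁻¹ * (δ n : ℝ≥0∞)) l (𝓝 0) := by
    simpa using ENNReal.Tendsto.const_mul (a := (ENNReal.ofReal (μ x))⁻¹)
      (ENNReal.tendsto_coe.mpr hδ) (Or.inr (ENNReal.inv_ne_top.mpr hμ0))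
  refine tendsto_of_tendsto_of_tendsto_of_le_of_le' tendsto_const_nhds hlim
    (Eventually.of_forall fun _ => zero_le) ?_
  filter_upwards [h] with n hn
  rw [← ENNReal.mul_le_iff_le_inv hμ0 ENNReal.ofReal_ne_top]
  exact (ENNReal.le_tsum x).trans hn

lemma enorm_pow_sub_pow_le (p : ℕ) (x y : ℝ) :
    ‖x ^ p - y ^ p‖ₑ ≤ ‖x - y‖ₑ * (p * (‖x‖ₑ ^ (p - 1) + ‖y‖ₑ ^ (p - 1))) := by
  have habs : |x ^ p - y ^ p| ≤ |x - y| * (p * (|x| ^ (p - 1) + |y| ^ (p - 1))) := by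
    refine (abs_pow_sub_pow_le x y p).trans ?_
    rw [mul_assoc]
    gcongr
    rcases max_cases |x| |y| with h | h <;> rw [h.1]
    · exact le_add_of_nonneg_right (by positivity)
    · exact le_add_of_nonneg_left (by positivity)
  have hnnnorm : ‖x ^ p - y ^ p‖₊ ≤
      ‖x - y‖₊ * (p * (‖x‖₊ ^ (p - 1) + ‖y‖₊ ^ (p - 1))) := by
    rw [← NNReal.coe_le_coe]
    simpa using habs
  simpa [enorm_eq_nnnorm] using ENNReal.coe_le_coe.mpr hnnnorm

lemma lintegral_add_pow_sq_le {f g : Ω → ℝ} (hf : AEMeasurable f P) (q : ℕ) :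
    ∫⁻ ω, (‖f ω‖ₑ ^ q + ‖g ω‖ₑ ^ q) ^ 2 ∂P ≤
      2 * ∫⁻ ω, ‖f ω‖ₑ ^ (2 * q) ∂P + 2 * ∫⁻ ω, ‖g ω‖ₑ ^ (2 * q) ∂P := by
  rw [← lintegral_const_mul' 2 _ (by simp), ← lintegral_const_mul' 2 _ (by simp),
    ← lintegral_add_left' ((hf.enorm.pow_const _).const_mul _)]
  refine lintegral_mono fun ω => ?_
  have hsq : (‖f ω‖₊ ^ q + ‖g ω‖₊ ^ q) ^ 2 ≤ 2 * ‖f ω‖₊ ^ (2 * q) + 2 * ‖g ω‖₊ ^ (2 * q) := by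
    rw [mul_comm 2 q, pow_mul, pow_mul, ← mul_add]
    exact add_sq_le
  simpa [enorm_eq_nnnorm] using ENNReal.coe_le_coe.mpr hsq

lemma lintegral_enorm_pow_sub_pow_le {f g : Ω → ℝ} (hf : AEMeasurable f P) (hg : AEMeasurable g P)
    (p : ℕ) : ∫⁻ ω, ‖f ω ^ p - g ω ^ p‖ₑ ∂P ≤
      (∫⁻ ω, ‖f ω - g ω‖ₑ ^ 2 ∂P) ^ (1 / 2 : ℝ) *
        (p ^ 2 * (2 * ∫⁻ ω, ‖f ω‖ₑ ^ (2 * (p - 1)) ∂P +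
          2 * ∫⁻ ω, ‖g ω‖ₑ ^ (2 * (p - 1)) ∂P)) ^ (1 / 2 : ℝ) := by
  have hholder := ENNReal.lintegral_mul_le_Lp_mul_Lq P Real.HolderConjugate.two_two
    (hf.sub hg).enorm
    (((hf.enorm.pow_const (p - 1)).add (hg.enorm.pow_const (p - 1))).const_mul (p : ℝ≥0∞))
  refine (lintegral_mono fun ω => enorm_pow_sub_pow_le p (f ω) (g ω)).trans (hholder.trans ?_)
  simp only [ENNReal.rpow_two, mul_pow, Pi.add_apply, Pi.sub_apply]
  gcongr
  rw [lintegral_const_mul' _ _ (by simp)]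
  gcongr
  exact lintegral_add_pow_sq_le hf _

lemma tendsto_integral_pow {f : ι → Ω → ℝ} {g : Ω → ℝ} (p : ℕ)
    (hf : ∀ n, AEMeasurable (f n) P) (hg : AEMeasurable g P) {M : ℝ≥0∞} (hM : M ≠ ∞)
    (hfM : ∀ᶠ n in l, ∫⁻ ω, ‖f n ω‖ₑ ^ (2 * (p - 1)) ∂P ≤ M)
    (hgM : ∫⁻ ω, ‖g ω‖ₑ ^ (2 * (p - 1)) ∂P ≤ M)
    (hfi : ∀ᶠ n in l, Integrable (fun ω => f n ω ^ p) P) (hgi : Integrable (fun ω => g ω ^ p) P)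
    (h : Tendsto (fun n => ∫⁻ ω, ‖f n ω - g ω‖ₑ ^ 2 ∂P) l (𝓝 0)) :
    Tendsto (fun n => ∫ ω, f n ω ^ p ∂P) l (𝓝 (∫ ω, g ω ^ p ∂P)) := by
  refine tendsto_integral_of_L1 _ hgi.1 hfi ?_
  have hfin : ((p : ℝ≥0∞) ^ 2 * (2 * M + 2 * M)) ^ (1 / 2 : ℝ) ≠ ∞ :=
    ENNReal.rpow_ne_top_of_nonneg (by norm_num)
      (ENNReal.mul_ne_top (by simp) (by simp [hM, ENNReal.mul_eq_top]))
  have hbound := ENNReal.Tendsto.mul_const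
    (((ENNReal.continuous_rpow_const (y := 1 / 2)).tendsto 0).comp h) (Or.inr hfin)
  rw [ENNReal.zero_rpow_of_pos (by norm_num), zero_mul] at hbound
  refine tendsto_of_tendsto_of_tendsto_of_le_of_le' tendsto_const_nhds hbound
    (Eventually.of_forall fun _ => zero_le) ?_
  filter_upwards [hfM] with n hn
  refine (lintegral_enorm_pow_sub_pow_le (hf n) hg p).trans ?_
  simp only [Function.comp_apply]
  gcongr

end MeanSquare

section Moments

variable {Ω : Type*} {mΩ : MeasurableSpace Ω} {P : Measure Ω} {d : ℕ}
  {ℱ : Filtration ℝ≥0 mΩ} {w : Lattice d → ℝ≥0 → Ω → ℝ} {a b μ : Lattice d → ℝ} {κ h : ℝ≥0}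
  {u : ℝ≥0 → Lattice d → Ω → ℝ} {T C K : ℝ≥0}

lemma grid_one (h : ℝ≥0) : grid h 1 = h := by simp [grid]

lemma grid_div_self (t : ℝ≥0) {n : ℕ} (hn : n ≠ 0) : grid (t / n) n = t :=
  mul_div_cancel₀ t (by exact_mod_cast hn)

lemma tendsto_div_natCast (h : ℝ≥0) : Tendsto (fun m : ℕ => h / m) atTop (𝓝 0) := by
  rw [← NNReal.tendsto_coe]
  simpa using tendsto_const_div_atTop_nhds_zero_nat (h : ℝ)

lemma eventually_div_mul_le_one (h c : ℝ≥0) : ∀ᶠ m : ℕ in atTop, h / m * c ≤ 1 := by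
  have hlim := (tendsto_div_natCast h).mul_const c
  rw [zero_mul] at hlim
  exact (hlim.eventually_lt_const zero_lt_one).mono fun m hm => hm.le

lemma one_add_mul_pow_le_exp {k : ℕ} (hk : grid h k ≤ T) (c : ℝ≥0) :
    (1 + h * c) ^ k ≤ (Real.exp (T * c)).toNNReal := by
  rw [← NNReal.coe_le_coe, Real.coe_toNNReal _ (Real.exp_pos _).le]
  have hk' : (k * h : ℝ) ≤ T := by exact_mod_cast hk
  calc (((1 + h * c) ^ k : ℝ≥0) : ℝ) = (h * c + 1 : ℝ) ^ k := by push_cast; ring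
    _ ≤ Real.exp (h * c) ^ k := by
      gcongr
      exact Real.add_one_le_exp _
    _ = Real.exp (k * h * c) := by rw [← Real.exp_nat_mul, mul_assoc]
    _ ≤ Real.exp (T * c) := by gcongr

lemma IsRegularSolution.energy_schemeError_zero (H : IsRegularSolution a b μ κ P ℱ w u T C K) :
    energy μ P (schemeError a b κ w u h 0) = 0 := by
  have hzero : ∀ x, schemeError a b κ w u h 0 x =ᵐ[P] fun _ => 0 := fun x => by
    filter_upwards [H.solution.apply_zero_ae_eq_one H.brownian H.summable x] with ω hω
    simp [schemeError, realScheme, scheme, grid, hω]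
  rw [energy_congr hzero]
  simp [energy]

lemma IsRegularSolution.exists_energy_schemeError_le (H : IsRegularSolution a b μ κ P ℱ w u T C K) :
    ∃ D : ℝ≥0, ∀ h : ℝ≥0, h ≠ 0 → h ≤ 1 → h * κ ≤ 1 → h * noiseVar b ≤ 1 → ∀ k : ℕ,
      grid h k ≤ T → energy μ P (schemeError a b κ w u h k) ≤ (h * D : ℝ≥0) := by
  obtain ⟨c, c', hstep⟩ := H.exists_energy_schemeError_succ_le
  refine ⟨T * c' * (Real.exp (T * c)).toNNReal, fun h h0 hh hκ hb k hk => ?_⟩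
  have hgronwall : energy μ P (schemeError a b κ w u h k) ≤
      (k * (h ^ 2 * c') * (1 + h * c) ^ k : ℝ≥0) := by
    induction k with
    | zero => simp [H.energy_schemeError_zero]
    | succ k ih =>
      refine (hstep h h0 hh hκ hb k hk _ (ih ((grid_mono h k.le_succ).trans hk))).trans ?_
      rw [ENNReal.coe_le_coe]
      have hpow : 1 ≤ (1 + h * c) ^ (k + 1) := one_le_pow₀ (le_add_of_nonneg_right zero_le)
      calc (1 + h * c) * (k * (h ^ 2 * c') * (1 + h * c) ^ k) + h ^ 2 * c'
          = k * (h ^ 2 * c') * (1 + h * c) ^ (k + 1) + h ^ 2 * c' * 1 := by ring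
        _ ≤ k * (h ^ 2 * c') * (1 + h * c) ^ (k + 1) + h ^ 2 * c' * (1 + h * c) ^ (k + 1) := by
          gcongr
        _ = _ := by push_cast; ring
  refine hgronwall.trans (ENNReal.coe_le_coe.mpr ?_)
  calc k * (h ^ 2 * c') * (1 + h * c) ^ k = h * (grid h k * c' * (1 + h * c) ^ k) := by
        rw [grid]
        ring
    _ ≤ h * (T * c' * (Real.exp (T * c)).toNNReal) := by
        gcongr
        exact one_add_mul_pow_le_exp hk c

lemma IsRegularSolution.tendsto_realScheme (H : IsRegularSolution a b μ κ P ℱ w u T C K)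
    (h0 : h ≠ 0) {i : ℕ} (hi : grid h i ≤ T) (x : Lattice d) :
    Tendsto (fun m : ℕ => ∫⁻ ω,
      ‖realScheme a b κ w (h / m) (i * m) x ω - u (grid h i) x ω‖ₑ ^ 2 ∂P) atTop (𝓝 0) := by
  obtain ⟨D, hD⟩ := H.exists_energy_schemeError_le
  have hδ : Tendsto (fun m : ℕ => h / m * D) atTop (𝓝 0) := by
    simpa using (tendsto_div_natCast h).mul_const D
  refine tendsto_lintegral_sq_of_energy_le (H.weight_pos x) hδ
    (f := fun (m : ℕ) y ω => realScheme a b κ w (h / m) (i * m) y ω - u (grid h i) y ω) ?_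
  filter_upwards [eventually_ne_atTop 0, eventually_div_mul_le_one h 1,
    eventually_div_mul_le_one h κ, eventually_div_mul_le_one h (noiseVar b)] with m hm h1 hκ hb
  have hm' : (m : ℝ≥0) ≠ 0 := by exact_mod_cast hm
  have hle := hD (h / m) (div_ne_zero h0 hm') (by rwa [mul_one] at h1) hκ hb (i * m)
    (by rwa [grid_div h hm])
  rw [energy_sub_comm]
  unfold schemeError at hle
  rwa [grid_div h hm] at hle

lemma discreteMoment_ne_top (ha : IsSymmetricKernel a) (hb : Summable fun z => |b z|)
    (hκ : h * κ ≤ 1) (p n : ℕ) : discreteMoment a (corr b) κ p h n 0 ≠ ∞ :=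
  ((discreteMoment_le ha (isPosDef_corr hb) κ.coe_nonneg h.coe_nonneg (by exact_mod_cast hκ)
    n 0).trans_lt ENNReal.ofReal_lt_top).ne

lemma integrable_realScheme_pow (ha : IsSymmetricKernel a) (hb : Summable fun z => |b z|)
    (hw : IsBrownianFamily P ℱ w) (hκ : h * κ ≤ 1) (k p : ℕ) (x : Lattice d) :
    Integrable (fun ω => realScheme a b κ w h k x ω ^ p) P := by
  simp only [realScheme, ← ENNReal.toReal_pow]
  refine integrable_toReal_of_lintegral_ne_top
    ((measurable_scheme hw κ h k x).pow_const p).aemeasurable ?_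
  rw [lintegral_scheme_pow hw hb κ h k p x]
  exact discreteMoment_ne_top ha hb hκ p k

lemma integral_realScheme_pow (ha : IsSymmetricKernel a) (hb : Summable fun z => |b z|)
    (hw : IsBrownianFamily P ℱ w) (hκ : h * κ ≤ 1) (k p : ℕ) (x : Lattice d) :
    ∫ ω, realScheme a b κ w h k x ω ^ p ∂P = (discreteMoment a (corr b) κ p h k 0).toReal := by
  have hm : AEMeasurable (fun ω => scheme a b κ w h k x ω ^ p) P :=
    ((measurable_scheme hw κ h k x).pow_const p).aemeasurable
  have hmoment := lintegral_scheme_pow (a := a) hw hb κ h k p x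
  simp only [realScheme, ← ENNReal.toReal_pow]
  rw [← hmoment, integral_toReal hm (ae_lt_top' hm ?_)]
  rw [hmoment]
  exact discreteMoment_ne_top ha hb hκ p k

lemma IsSolution.lintegral_pow_le (hu : IsSolution a b κ P ℱ w u) (ha : IsSymmetricKernel a)
    (hb : Summable fun z => |b z|) (hw : IsBrownianFamily P ℱ w) (t : ℝ≥0) (x : Lattice d)
    (q : ℕ) : ∫⁻ ω, ‖u t x ω‖ₑ ^ q ∂P ≤ ENNReal.ofReal (Real.exp (t * momentRate (corr b) q)) := by
  rcases eq_or_ne t 0 with rfl | ht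
  · have := hw.isProbabilityMeasure
    calc ∫⁻ ω, ‖u 0 x ω‖ₑ ^ q ∂P = ∫⁻ _, 1 ∂P := by
          refine lintegral_congr_ae ?_
          filter_upwards [hu.apply_zero_ae_eq_one hw hb x] with ω hω
          simp [hω]
      _ ≤ _ := by simp
  · obtain ⟨μ, C, K, H⟩ := hu.exists_isRegularSolution ha hb hw t
    have hlim := H.tendsto_realScheme ht (grid_one t).le x
    simp only [one_mul, grid_one] at hlim
    have hm : ∀ n : ℕ, AEMeasurable (realScheme a b κ w (t / n) n x) P := fun n =>
      (measurable_realScheme hw κ _ _ x).aemeasurable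
    have hmeas := tendstoInMeasure_of_tendsto_lintegral_sq hm (hu.measurable t x).aemeasurable hlim
    refine (lintegral_pow_le_liminf q hm hmeas).trans
      (liminf_le_of_le (h := fun c hc => ?_))
    obtain ⟨n, hcn, hn, hn0⟩ := (hc.and ((eventually_div_mul_le_one t κ).and
      (eventually_ne_atTop 0))).exists
    have hle := hcn.trans (lintegral_realScheme_pow_le ha hb hw hn n q x)
    rwa [grid_div_self t hn0] at hle

lemma IsSolution.integrable_pow (hu : IsSolution a b κ P ℱ w u) (ha : IsSymmetricKernel a)
    (hb : Summable fun z => |b z|) (hw : IsBrownianFamily P ℱ w) (t : ℝ≥0) (x : Lattice d)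
    (q : ℕ) : Integrable (fun ω => u t x ω ^ q) P := by
  refine ⟨((hu.measurable t x).pow_const q).aestronglyMeasurable, ?_⟩
  rw [hasFiniteIntegral_iff_enorm]
  simp only [enorm_pow]
  exact (hu.lintegral_pow_le ha hb hw t x q).trans_lt ENNReal.ofReal_lt_top

lemma IsSolution.integral_zero_pow (hu : IsSolution a b κ P ℱ w u)
    (hb : Summable fun z => |b z|) (hw : IsBrownianFamily P ℱ w) (x : Lattice d) (q : ℕ) :
    ∫ ω, u 0 x ω ^ q ∂P = 1 := by
  have := hw.isProbabilityMeasure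
  calc ∫ ω, u 0 x ω ^ q ∂P = ∫ _, (1 : ℝ) ∂P := by
        refine integral_congr_ae ?_
        filter_upwards [hu.apply_zero_ae_eq_one hw hb x] with ω hω
        simp [hω]
    _ = 1 := by simp

lemma IsSolution.tendsto_discreteMoment (hu : IsSolution a b κ P ℱ w u) (ha : IsSymmetricKernel a)
    (hb : Summable fun z => |b z|) (hw : IsBrownianFamily P ℱ w) (h0 : h ≠ 0) (i p : ℕ)
    (x : Lattice d) :
    Tendsto (fun m : ℕ => (discreteMoment a (corr b) κ p ((h / m : ℝ≥0) : ℝ) (i * m) 0).toReal)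
      atTop (𝓝 (∫ ω, u (grid h i) x ω ^ p ∂P)) := by
  obtain ⟨μ, C, K, H⟩ := hu.exists_isRegularSolution ha hb hw (grid h i)
  have hstep := eventually_div_mul_le_one h κ
  refine (tendsto_integral_pow p (fun m => (measurable_realScheme hw κ _ _ x).aemeasurable)
    (hu.measurable _ x).aemeasurable ENNReal.ofReal_ne_top ?_ (hu.lintegral_pow_le ha hb hw _ x _)
    ?_ (hu.integrable_pow ha hb hw _ x _) (H.tendsto_realScheme h0 le_rfl x)).congr' ?_
  · filter_upwards [hstep, eventually_ne_atTop 0] with m hm hm0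
    simpa only [grid_div h hm0] using
      lintegral_realScheme_pow_le ha hb hw hm (i * m) (2 * (p - 1)) x
  · filter_upwards [hstep] with m hm using integrable_realScheme_pow ha hb hw hm _ _ x
  · filter_upwards [hstep] with m hm using integral_realScheme_pow ha hb hw hm _ _ x

end Moments

section Fekete

lemma tendsto_floor_add_div {g : ℕ → ℝ} {γ : ℝ} (hg : Tendsto (fun n : ℕ => g n / n) atTop (𝓝 γ))
    (i : ℕ) : Tendsto (fun t : ℝ≥0 => g (⌊t⌋₊ + i) / t) atTop (𝓝 γ) := by
  have hcoe : Tendsto (fun t : ℝ≥0 => (t : ℝ)) atTop atTop :=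
    NNReal.tendsto_coe_atTop.mpr tendsto_id
  have hfloor : Tendsto (fun t : ℝ≥0 => ⌊t⌋₊ + i) atTop atTop :=
    (tendsto_add_atTop_nat i).comp tendsto_nat_floor_atTop
  have hratio : Tendsto (fun t : ℝ≥0 => (⌊t⌋₊ : ℝ) / t + i / t) atTop (𝓝 1) := by
    rw [← add_zero (1 : ℝ)]
    refine Tendsto.add ?_ (tendsto_const_nhds.div_atTop hcoe)
    exact ((tendsto_nat_floor_div_atTop (R := ℝ)).comp hcoe).congr fun t => by
      have hfloor_coe : ⌊(t : ℝ)⌋₊ = ⌊t⌋₊ := Nonneg.nat_floor_coe t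
      simp only [Function.comp_apply, hfloor_coe]
  have hlim := (hg.comp hfloor).mul hratio
  rw [mul_one] at hlim
  refine hlim.congr' ?_
  filter_upwards [hfloor.eventually_ne_atTop 0] with t ht
  have ht' : (⌊t⌋₊ + i : ℝ) ≠ 0 := by exact_mod_cast ht
  simp only [Function.comp_apply, Nat.cast_add, ← add_div]
  field_simp

variable {f : ℝ≥0 → ℝ} {c : ℝ}

lemma exists_tendsto_natCast_div_of_subadditive (hf : ∀ s t, f (s + t) ≤ f s + f t)
    (hc : ∀ t, |f t| ≤ t * c) : ∃ γ, Tendsto (fun n : ℕ => f n / n) atTop (𝓝 γ) := by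
  have hsub : Subadditive fun n : ℕ => f n := fun m n => by
    push_cast
    exact hf m n
  refine ⟨hsub.lim, hsub.tendsto_lim ⟨-c, ?_⟩⟩
  rintro _ ⟨n, rfl⟩
  rcases Nat.eq_zero_or_pos n with rfl | hn
  · simpa using (abs_nonneg _).trans (hc 1)
  · have hn' : (0 : ℝ) < n := by exact_mod_cast hn
    have hlow := (abs_le.mp (hc n)).1
    rw [NNReal.coe_natCast] at hlow
    rw [le_div_iff₀ hn']
    linarith

lemma exists_tendsto_div_of_subadditive (hf : ∀ s t, f (s + t) ≤ f s + f t)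
    (hc : ∀ t, |f t| ≤ t * c) : ∃ γ, Tendsto (fun t : ℝ≥0 => f t / t) atTop (𝓝 γ) := by
  obtain ⟨γ, hγ⟩ := exists_tendsto_natCast_div_of_subadditive hf hc
  have hc0 : 0 ≤ c := by simpa using (abs_nonneg _).trans (hc 1)
  have hstep : ∀ s t, s ≤ t → t ≤ s + 1 → f t ≤ f s + c := fun s t hst hts => by
    have hadd := hf s (t - s)
    rw [add_tsub_cancel_of_le hst] at hadd
    have hsmall : ((t - s : ℝ≥0) : ℝ) ≤ 1 := by exact_mod_cast tsub_le_iff_left.mpr hts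
    have hle : f (t - s) ≤ c :=
      (le_abs_self _).trans ((hc _).trans (mul_le_of_le_one_left hc0 hsmall))
    linarith
  have hinv : Tendsto (fun t : ℝ≥0 => c / (t : ℝ)) atTop (𝓝 0) :=
    tendsto_const_nhds.div_atTop (NNReal.tendsto_coe_atTop.mpr tendsto_id)
  have hlow := (tendsto_floor_add_div (g := fun n => f n) hγ 1).sub hinv
  have hupp := (tendsto_floor_add_div (g := fun n => f n) hγ 0).add hinv
  rw [sub_zero] at hlow
  rw [add_zero] at hupp
  refine ⟨γ, tendsto_of_tendsto_of_tendsto_of_le_of_le hlow hupp (fun t => ?_) fun t => ?_⟩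
  · have hle := hstep t (⌊t⌋₊ + 1 : ℕ) (by exact_mod_cast (Nat.lt_floor_add_one t).le)
      (by push_cast; gcongr; exact Nat.floor_le zero_le)
    simp only [← sub_div]
    gcongr
    linarith
  · have hle := hstep ⌊t⌋₊ t (Nat.floor_le zero_le) (Nat.lt_floor_add_one t).le
    simp only [add_zero, ← add_div]
    gcongr

end Fekete

section Lyapunov

variable {Ω : Type*} {mΩ : MeasurableSpace Ω} {P : Measure Ω} {d : ℕ}
  {ℱ : Filtration ℝ≥0 mΩ} {w : Lattice d → ℝ≥0 → Ω → ℝ} {a b μ : Lattice d → ℝ} {κ h s t : ℝ≥0}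
  {u : ℝ≥0 → Lattice d → Ω → ℝ} {T C K : ℝ≥0} {p : ℕ}

lemma toReal_discreteMoment_mem_Icc (ha : IsSymmetricKernel a) (hb : Summable fun z => |b z|)
    (hκ : h * κ ≤ 1) (p n : ℕ) : (discreteMoment a (corr b) κ p h n 0).toReal ∈
      Set.Icc (Real.exp (-(grid h n * momentRate (corr b) p)))
        (Real.exp (grid h n * momentRate (corr b) p)) := by
  have hκ' : (h : ℝ) * κ ≤ 1 := by exact_mod_cast hκ
  have hgrid : (grid h n : ℝ) = n * h := by simp [grid]
  rw [hgrid]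
  exact ⟨(ENNReal.ofReal_le_iff_le_toReal (discreteMoment_ne_top ha hb hκ p n)).mp
      (le_discreteMoment ha (isPosDef_corr hb) κ.coe_nonneg h.coe_nonneg hκ' n 0),
    ENNReal.toReal_le_of_le_ofReal (Real.exp_pos _).le
      (discreteMoment_le ha (isPosDef_corr hb) κ.coe_nonneg h.coe_nonneg hκ' n 0)⟩

lemma IsSolution.integral_pow_mem_Icc (hu : IsSolution a b κ P ℱ w u) (ha : IsSymmetricKernel a)
    (hb : Summable fun z => |b z|) (hw : IsBrownianFamily P ℱ w) (t : ℝ≥0) (x : Lattice d)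
    (p : ℕ) : ∫ ω, u t x ω ^ p ∂P ∈ Set.Icc (Real.exp (-(t * momentRate (corr b) p)))
      (Real.exp (t * momentRate (corr b) p)) := by
  rcases eq_or_ne t 0 with rfl | ht
  · simp [hu.integral_zero_pow hb hw x p]
  · have hlim := hu.tendsto_discreteMoment ha hb hw ht 1 p x
    simp only [one_mul, grid_one] at hlim
    refine isClosed_Icc.mem_of_tendsto hlim ?_
    filter_upwards [eventually_div_mul_le_one t κ, eventually_ne_atTop 0] with m hm hm0
    simpa only [grid_div_self t hm0] using toReal_discreteMoment_mem_Icc ha hb hm p m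

lemma IsSolution.integral_pow_pos (hu : IsSolution a b κ P ℱ w u) (ha : IsSymmetricKernel a)
    (hb : Summable fun z => |b z|) (hw : IsBrownianFamily P ℱ w) (t : ℝ≥0) (x : Lattice d)
    (p : ℕ) : 0 < ∫ ω, u t x ω ^ p ∂P :=
  (Real.exp_pos _).trans_le (hu.integral_pow_mem_Icc ha hb hw t x p).1

lemma IsRegularSolution.energy_sub_le_nndist (H : IsRegularSolution a b μ κ P ℱ w u T C K)
    (hs : s ≤ T) (ht : t ≤ T) : energy μ P (fun x ω => u s x ω - u t x ω) ≤
      (nndist s t * holderConst b κ T C K : ℝ≥0) := by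
  wlog hst : t ≤ s generalizing s t
  · rw [energy_sub_comm, nndist_comm]
    exact this ht hs (le_of_not_ge hst)
  refine (H.energy_sub_le hst hs).trans ?_
  rw [ENNReal.coe_le_coe]
  gcongr
  rw [← NNReal.coe_le_coe, NNReal.coe_sub hst, coe_nndist, NNReal.dist_eq]
  exact le_abs_self _

lemma IsSolution.continuous_integral_pow (hu : IsSolution a b κ P ℱ w u)
    (ha : IsSymmetricKernel a) (hb : Summable fun z => |b z|) (hw : IsBrownianFamily P ℱ w)
    (x : Lattice d) (p : ℕ) : Continuous fun t => ∫ ω, u t x ω ^ p ∂P := by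
  refine continuous_iff_continuousAt.mpr fun t => ?_
  obtain ⟨μ, C, K, H⟩ := hu.exists_isRegularSolution ha hb hw (t + 1)
  have ht : t < t + 1 := lt_add_of_pos_right t one_pos
  have hnear : ∀ᶠ s in 𝓝 t, s ≤ t + 1 := (eventually_lt_nhds ht).mono fun s hs => hs.le
  have hmoment : ∀ s ≤ t + 1, ∫⁻ ω, ‖u s x ω‖ₑ ^ (2 * (p - 1)) ∂P ≤
      ENNReal.ofReal (Real.exp ((t + 1 : ℝ≥0) * momentRate (corr b) (2 * (p - 1)))) :=
    fun s hs => (hu.lintegral_pow_le ha hb hw s x _).trans (by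
      have := (isPosDef_corr hb).momentRate_nonneg (2 * (p - 1))
      gcongr)
  have hdist : Tendsto (fun s : ℝ≥0 => nndist s t * holderConst b κ (t + 1) C K) (𝓝 t) (𝓝 0) := by
    have hcont : Continuous fun s : ℝ≥0 => nndist s t * holderConst b κ (t + 1) C K := by fun_prop
    simpa using hcont.tendsto t
  exact tendsto_integral_pow p (fun s => (hu.measurable s x).aemeasurable)
    (hu.measurable t x).aemeasurable ENNReal.ofReal_ne_top (hnear.mono hmoment) (hmoment t ht.le)
    (Eventually.of_forall fun s => hu.integrable_pow ha hb hw s x _)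
    (hu.integrable_pow ha hb hw t x _)
    (tendsto_lintegral_sq_of_energy_le (H.weight_pos x) hdist
      (f := fun s y ω => u s y ω - u t y ω)
      (hnear.mono fun s hs => H.energy_sub_le_nndist hs ht.le))

lemma IsSolution.integral_pow_grid_add_le (hu : IsSolution a b κ P ℱ w u)
    (ha : IsSymmetricKernel a) (hb : Summable fun z => |b z|) (hw : IsBrownianFamily P ℱ w)
    (h0 : h ≠ 0) (i j : ℕ) (x : Lattice d) (hp : p ≠ 0) :
    ∫ ω, u (grid h (i + j)) x ω ^ p ∂P ≤
      (∫ ω, u (grid h i) x ω ^ p ∂P) * ∫ ω, u (grid h j) x ω ^ p ∂P := by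
  refine le_of_tendsto_of_tendsto (hu.tendsto_discreteMoment ha hb hw h0 (i + j) p x)
    ((hu.tendsto_discreteMoment ha hb hw h0 i p x).mul
      (hu.tendsto_discreteMoment ha hb hw h0 j p x)) ?_
  filter_upwards [eventually_div_mul_le_one h κ] with m hm
  rw [← ENNReal.toReal_mul, add_mul]
  exact ENNReal.toReal_mono
    (ENNReal.mul_ne_top (discreteMoment_ne_top ha hb hm _ _) (discreteMoment_ne_top ha hb hm _ _))
    (discreteMoment_add_le hw hb κ (h / m) hp (i * m) (j * m))

lemma tendsto_grid_floor (hs : s ≠ 0) (t : ℝ≥0) :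
    Tendsto (fun n : ℕ => grid (s / n) ⌊t / s * n⌋₊) atTop (𝓝 t) := by
  have hlim := ((tendsto_nat_floor_mul_div_atTop (R := ℝ) (a := ((t / s : ℝ≥0) : ℝ))
    (NNReal.coe_nonneg _)).comp tendsto_natCast_atTop_atTop).mul_const (s : ℝ)
  rw [← NNReal.coe_mul, div_mul_cancel₀ t hs] at hlim
  rw [← NNReal.tendsto_coe]
  refine hlim.congr fun n => ?_
  have hfloor : ⌊((t / s : ℝ≥0) : ℝ) * n⌋₊ = ⌊t / s * n⌋₊ :=
    Nonneg.nat_floor_coe (t / s * (n : ℝ≥0))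
  simp only [Function.comp_apply, hfloor, grid]
  push_cast
  ring

lemma grid_add (h : ℝ≥0) (i j : ℕ) : grid h (i + j) = grid h i + grid h j := by
  simp only [grid, Nat.cast_add, add_mul]

lemma IsSolution.integral_pow_add_le (hu : IsSolution a b κ P ℱ w u) (ha : IsSymmetricKernel a)
    (hb : Summable fun z => |b z|) (hw : IsBrownianFamily P ℱ w) (s t : ℝ≥0) (x : Lattice d)
    (hp : p ≠ 0) : ∫ ω, u (s + t) x ω ^ p ∂P ≤
      (∫ ω, u s x ω ^ p ∂P) * ∫ ω, u t x ω ^ p ∂P := by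
  rcases eq_or_ne s 0 with rfl | hs
  · simp [hu.integral_zero_pow hb hw x p]
  have hcont := hu.continuous_integral_pow ha hb hw x p
  have hgrid := tendsto_grid_floor hs t
  refine le_of_tendsto_of_tendsto ((hcont.tendsto (s + t)).comp (hgrid.const_add s))
    (((hcont.tendsto t).comp hgrid).const_mul (∫ ω, u s x ω ^ p ∂P)) ?_
  filter_upwards [eventually_ne_atTop 0] with n hn
  have hn' : (n : ℝ≥0) ≠ 0 := by exact_mod_cast hn
  simpa only [Function.comp_apply, grid_add, grid_div_self s hn] using
    hu.integral_pow_grid_add_le ha hb hw (div_ne_zero hs hn') n ⌊t / s * n⌋₊ x hp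

theorem IsSolution.exists_hasLyapunovExponent (hu : IsSolution a b κ P ℱ w u)
    (ha : IsSymmetricKernel a) (hb : Summable fun z => |b z|) (hw : IsBrownianFamily P ℱ w)
    (hp : p ≠ 0) : ∃ γ, HasLyapunovExponent P u p γ := by
  have hpos := fun t => hu.integral_pow_pos ha hb hw t 0 p
  obtain ⟨γ, hγ⟩ := exists_tendsto_div_of_subadditive
    (f := fun t => Real.log (∫ ω, u t 0 ω ^ p ∂P)) (c := momentRate (corr b) p)
    (fun s t => by
      rw [← Real.log_mul (hpos s).ne' (hpos t).ne']
      exact Real.log_le_log (hpos _) (hu.integral_pow_add_le ha hb hw s t 0 hp))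
    (fun t => by
      obtain ⟨hlow, hupp⟩ := hu.integral_pow_mem_Icc ha hb hw t 0 p
      exact abs_le.mpr ⟨(Real.le_log_iff_exp_le (hpos t)).mpr hlow,
        (Real.log_le_iff_le_exp (hpos t)).mpr hupp⟩)
  exact ⟨γ, fun t => hu.integrable_pow ha hb hw t 0 _, hpos, hγ⟩

end Lyapunov

section Comparison

variable {d : ℕ} {a b : Lattice d → ℝ} {κ h : ℝ≥0} {p : ℕ}
  {Ω : Type*} {mΩ : MeasurableSpace Ω} {P : Measure Ω}
  {ℱ : Filtration ℝ≥0 mΩ} {w : Lattice d → ℝ≥0 → Ω → ℝ} {u : ℝ≥0 → Lattice d → Ω → ℝ}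
  {Ω' : Type*} {mΩ' : MeasurableSpace Ω'} {P' : Measure Ω'}
  {ℱ' : Filtration ℝ≥0 mΩ'} {w' : Lattice d → ℝ≥0 → Ω' → ℝ} {v : ℝ≥0 → Lattice d → Ω' → ℝ}

lemma pow_mul_toReal_discreteMoment_two_le (ha : IsSymmetricKernel a)
    (hb : Summable fun z => |b z|) (hκ : h * (2 * κ) ≤ 1) (hp : p ≠ 0) (n : ℕ) :
    ((1 - h * κ) ^ p * Real.exp (h * (p * (p - 1) / 2 * corr b 0))) ^ n *
        (discreteMoment a (corr b) (κ / p : ℝ≥0) 2 (p * h : ℝ≥0) n 0).toReal ≤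
      (discreteMoment a (corr b) κ (p + 1) h n 0).toReal := by
  have hκ' : (h : ℝ) * (2 * κ) ≤ 1 := by exact_mod_cast hκ
  have hle := ENNReal.toReal_mono
    (discreteMoment_ne_top ha hb (by rw [← NNReal.coe_le_coe]; push_cast; linarith) (p + 1) n)
    (pow_mul_discreteMoment_two_le ha (isPosDef_corr hb) κ.coe_nonneg h.coe_nonneg
      (by linarith [hκ']) hp n)
  rw [ENNReal.toReal_mul, ENNReal.toReal_pow, ENNReal.toReal_ofReal (mul_nonneg
    (pow_nonneg (by linarith) p) (Real.exp_pos _).le)] at hle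
  simpa only [NNReal.coe_div, NNReal.coe_mul, NNReal.coe_natCast] using hle

lemma tendsto_one_sub_div_pow_mul_exp (t c c' : ℝ) (p : ℕ) :
    Tendsto (fun m : ℕ => ((1 - t / m * c) ^ p * Real.exp (t / m * c')) ^ m) atTop
      (𝓝 (Real.exp (t * (-(p * c) + c')))) := by
  have hlim := ((Real.tendsto_one_add_div_pow_exp (-(t * c))).pow p).mul_const (Real.exp (t * c'))
  rw [← Real.exp_nat_mul, ← Real.exp_add] at hlim
  have hexp : p * -(t * c) + t * c' = t * (-(p * c) + c') := by ring
  rw [hexp] at hlim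
  refine hlim.congr' ?_
  filter_upwards [eventually_ne_atTop 0] with m hm
  have hm' : (m : ℝ) ≠ 0 := by exact_mod_cast hm
  rw [mul_pow, ← pow_mul, ← pow_mul, mul_comm p m, ← Real.exp_nat_mul]
  congr 2
  · ring
  · field_simp

lemma IsSolution.exp_mul_integral_sq_le (hu : IsSolution a b κ P ℱ w u)
    (hv : IsSolution a b (κ / p : ℝ≥0) P' ℱ' w' v) (ha : IsSymmetricKernel a)
    (hb : Summable fun z => |b z|) (hw : IsBrownianFamily P ℱ w)
    (hw' : IsBrownianFamily P' ℱ' w') (hp : p ≠ 0) {t : ℝ≥0} (ht : t ≠ 0) (x : Lattice d) :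
    Real.exp (t * (-(p * κ) + p * (p - 1) / 2 * corr b 0)) * ∫ ω, v (p * t) x ω ^ 2 ∂P' ≤
      ∫ ω, u t x ω ^ (p + 1) ∂P := by
  have hpt : (p : ℝ≥0) * t ≠ 0 := mul_ne_zero (by exact_mod_cast hp) ht
  have hlim_u := hu.tendsto_discreteMoment ha hb hw ht 1 (p + 1) x
  have hlim_v := hv.tendsto_discreteMoment ha hb hw' hpt 1 2 x
  simp only [one_mul, grid_one] at hlim_u hlim_v
  refine le_of_tendsto_of_tendsto
    ((tendsto_one_sub_div_pow_mul_exp t κ (p * (p - 1) / 2 * corr b 0) p).mul hlim_v) hlim_u ?_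
  filter_upwards [eventually_div_mul_le_one t (2 * κ)] with m hm
  simpa only [mul_div_assoc, NNReal.coe_div, NNReal.coe_natCast] using
    pow_mul_toReal_discreteMoment_two_le ha hb hm hp m

lemma HasLyapunovExponent.add_mul_le (hu : IsSolution a b κ P ℱ w u)
    (hv : IsSolution a b (κ / p : ℝ≥0) P' ℱ' w' v) (ha : IsSymmetricKernel a)
    (hb : Summable fun z => |b z|) (hw : IsBrownianFamily P ℱ w)
    (hw' : IsBrownianFamily P' ℱ' w') (hp : p ≠ 0) {γ γ₂ : ℝ}
    (hγ : HasLyapunovExponent P u (p + 1) γ) (hγ₂ : HasLyapunovExponent P' v 2 γ₂) :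
    -(p * κ) + p * (p - 1) / 2 * corr b 0 + p * γ₂ ≤ γ := by
  have hp' : (0 : ℝ≥0) < p := by exact_mod_cast Nat.pos_of_ne_zero hp
  have hscaled := ((hγ₂.tendsto.comp (tendsto_id.const_mul_atTop hp')).const_mul (p : ℝ)).const_add
    (-(p * κ) + p * (p - 1) / 2 * corr b 0)
  refine le_of_tendsto_of_tendsto hscaled hγ.tendsto ?_
  filter_upwards [eventually_gt_atTop 0] with t ht
  have ht' : (0 : ℝ) < t := by exact_mod_cast ht
  have hlog := Real.log_le_log (mul_pos (Real.exp_pos _) (hγ₂.pos _))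
    (hu.exp_mul_integral_sq_le hv ha hb hw hw' hp ht.ne' 0)
  rw [Real.log_mul (Real.exp_pos _).ne' (hγ₂.pos _).ne', Real.log_exp] at hlog
  rw [le_div_iff₀ ht']
  refine le_trans (le_of_eq ?_) hlog
  have hp0 : (p : ℝ) ≠ 0 := by exact_mod_cast hp
  simp only [Function.comp_apply, id, NNReal.coe_mul, NNReal.coe_natCast]
  field_simp

lemma IsJumpKernel.dim_ne_zero (ha : IsJumpKernel a) : d ≠ 0 := by
  rintro rfl
  have hzero : a = fun _ => 0 := by
    ext z
    rw [Subsingleton.elim z 0, ha.zero]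
  exact zero_ne_one (hasSum_zero.unique (hzero ▸ ha.hasSum_one))

end Comparison

end Anderson

end

theorem mainTheorem3_general {d : ℕ} (a b : Anderson.Lattice d → ℝ)
    (ha : Anderson.IsSymmetricKernel a) (hb : Summable fun z => |b z|)
    (ϰ : ℝ) (hϰ : 0 ≤ ϰ) (p : ℕ) (hp : 2 ≤ p)
    {Ω : Type*} {mΩ : MeasurableSpace Ω} (P : Measure Ω)
    (ℱ : Filtration ℝ≥0 mΩ) (w : Anderson.Lattice d → ℝ≥0 → Ω → ℝ)
    (hw : Anderson.IsBrownianFamily P ℱ w)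
    (u : ℝ≥0 → Anderson.Lattice d → Ω → ℝ)
    (hu : Anderson.IsSolution a b ϰ P ℱ w u)
    {Ω' : Type*} {mΩ' : MeasurableSpace Ω'} (P' : Measure Ω')
    (ℱ' : Filtration ℝ≥0 mΩ') (w' : Anderson.Lattice d → ℝ≥0 → Ω' → ℝ)
    (hw' : Anderson.IsBrownianFamily P' ℱ' w')
    (v : ℝ≥0 → Anderson.Lattice d → Ω' → ℝ)
    (hv : Anderson.IsSolution a b (ϰ / ((p : ℝ) - 1)) P' ℱ' w' v) :
    ∃ γp γ2 : ℝ,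
      Anderson.HasLyapunovExponent P u p γp ∧
      Anderson.HasLyapunovExponent P' v 2 γ2 ∧
      γ2 + Anderson.corr b 0 * ((p : ℝ) - 2) / 2 - ϰ ≤ γp / ((p : ℝ) - 1) := by
  obtain ⟨q, rfl⟩ : ∃ q, p = q + 1 := ⟨p - 1, by omega⟩
  have hq : q ≠ 0 := by omega
  have hq0 : (0 : ℝ) < q := by positivity
  have hcast : ((q + 1 : ℕ) : ℝ) = q + 1 := by push_cast; rfl
  rw [hcast, add_sub_cancel_right] at hv ⊢
  lift ϰ to ℝ≥0 using hϰ
  have hv' : Anderson.IsSolution a b (ϰ / q : ℝ≥0) P' ℱ' w' v := by exact_mod_cast hv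
  obtain ⟨γp, hγp⟩ := hu.exists_hasLyapunovExponent ha hb hw q.succ_ne_zero
  obtain ⟨γ2, hγ2⟩ := hv'.exists_hasLyapunovExponent ha hb hw' two_ne_zero
  refine ⟨γp, γ2, hγp, hγ2, (le_div_iff₀ hq0).mpr ?_⟩
  linarith [hγp.add_mul_le hu hv' ha hb hw hw' hq hγ2]

theorem mainTheorem3 {d : ℕ} (a b : Anderson.Lattice d → ℝ)
    (ha : Anderson.IsJumpKernel a) (hb : Summable fun z => |b z|)
    (ϰ : ℝ) (hϰ : 0 < ϰ) (p : ℕ) (hp : 2 ≤ p)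
    -- `u` is the solution with diffusivity `ϰ`
    {Ω : Type*} {mΩ : MeasurableSpace Ω} (P : Measure Ω) [IsProbabilityMeasure P]
    (ℱ : Filtration ℝ≥0 mΩ) (w : Anderson.Lattice d → ℝ≥0 → Ω → ℝ)
    (hw : Anderson.IsBrownianFamily P ℱ w)
    (u : ℝ≥0 → Anderson.Lattice d → Ω → ℝ)
    (hu : Anderson.IsSolution a b ϰ P ℱ w u)
    -- `v` is the solution with diffusivity `ϰ / (p - 1)`
    {Ω' : Type*} {mΩ' : MeasurableSpace Ω'} (P' : Measure Ω') [IsProbabilityMeasure P']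
    (ℱ' : Filtration ℝ≥0 mΩ') (w' : Anderson.Lattice d → ℝ≥0 → Ω' → ℝ)
    (hw' : Anderson.IsBrownianFamily P' ℱ' w')
    (v : ℝ≥0 → Anderson.Lattice d → Ω' → ℝ)
    (hv : Anderson.IsSolution a b (ϰ / ((p : ℝ) - 1)) P' ℱ' w' v) :
    ∃ γp γ2 : ℝ,
      Anderson.HasLyapunovExponent P u p γp ∧
      Anderson.HasLyapunovExponent P' v 2 γ2 ∧
      γp / ((p : ℝ) - 1) >
        γ2 + Anderson.corr b 0 * ((p : ℝ) - 2) / 2 - 2 * ϰ * (d : ℝ) := by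
  obtain ⟨γp, γ2, hγp, hγ2, hle⟩ :=
    mainTheorem3_general a b ha.isSymmetricKernel hb ϰ hϰ.le p hp P ℱ w hw u hu P' ℱ' w' hw' v hv
  have hd : (1 : ℝ) ≤ d := by exact_mod_cast Nat.one_le_iff_ne_zero.mpr ha.dim_ne_zero
  exact ⟨γp, γ2, hγp, hγ2, hle.trans_lt' (by nlinarith)⟩
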